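/- Work with the open bosonic string in $D=26$ with metric $\eta=\mathrm{diag}(-1,1,\dots,1)$ and $\alpha'>0$. Let $\alpha_n^\mu,\,c_n,\,b_n$ ($n\in\mathbb Z$) be the matter and ghost oscillators, with $[\alpha_m^\mu,\alpha_n^\nu]=m\,\eta^{\mu\nu}\delta_{m+n,0}$, $\{b_m,c_n\}=\delta_{m+n,0}$, $\{b_m,b_n\}=\{c_m,c_n\}=0$, $\alpha_0^\mu=\sqrt{2\alpha'}\,p^\mu$, acting on the Fock space generated by $\alpha_{-n}^\mu, b_{-n}$ ($n\ge1$) and $c_{-n}$ ($n\ge 0$) from the state $|0,p;\downarrow\rangle$ of momentum $p$, which is annihilated by $b_0$ and by $\alpha^\mu_n,b_n,c_n$ ($n\ge1$). Let $\tilde N^g=\sum_{n>0}(c_{-n}b_n-b_{-n}c_n)$, let $N$ be the level, and let $\mathcal F^{m}_N(p)$ be the space of states without $c_0$ (that is, annihilated by $b_0$) of level $N$ and with $\tilde N^g=m$. Put $L_0=\alpha'p^2+N-1$, $$M=-2\sum_{n>0}n\,c_{-n}c_n,\qquad \tilde Q=\sum_{n\ne0}c_{-n}L^{(\mathrm m)}_n-\tfrac12\sum_{mn\ne0,\;m+n\ne0}(m-n):c_{-m}c_{-n}b_{m+n}:,\qquad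 Q=\tilde Q+c_0L_0+b_0M,$$ where $L_n^{(\mathrm m)}=\tfrac12\sum_k:\alpha_{n-k}\cdot\alpha_k:$. A string field $\Phi_n=\phi^{(n-1)}+c_0\,\omega^{(n-2)}$ of ghost number $n\in\mathbb Z$ assigns, to every momentum $p$ and level $N$ with $L_0\neq0$, states $\phi^{(n-1)}\in\mathcal F_N^{n-1}(p)$ and $\omega^{(n-2)}\in\mathcal F_N^{n-2}(p)$, with component fields valued in an arbitrary complex vector space $V$ (such as $\mathbb C$, or the even or odd part of a Grassmann algebra). The free gauge transformations are $\delta\Phi_n=Q\Lambda_{n-1}$, with $\Lambda_{n-1}$ a string field of ghost number $n-1$. A condition on string fields of ghost number $n$ *exactly fixes* this symmetry if (a) for every $\Phi_n$ there is $\Lambda_{n-1}$ such that $\Phi_n+Q\Lambda_{n-1}$ satisfies the condition, and (b) whenever $\Phi_n$ and $\Phi_n+Q\Lambda_{n-1}$ both satisfy the condition, $Q\Lambda_{n-1}=0$. Then: 1. For all $n,N\ge0$ and all $p$, $M^n:\mathcal F_N^{-n}(p)\to\mathcal F_N^{n}(p)$ (with coefficients in $V$) is a bijection; let $W_n$ denote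 its inverse. 2. The condition $b_0c_0\tilde Q\,\Phi_1=0$ exactly fixes $\delta\Phi_1=Q\Lambda_0$, and it is equivalent to $\tilde Q\phi^{(0)}=0$. 3. For every $n\in\mathbb Z$ the following condition exactly fixes $\delta\Phi_n=Q\Lambda_{n-1}$: - for $n\le1$: $\;b_0c_0\tilde Q M^{1-n}\,\Phi_n=0$; - for $n\ge2$: $\;\tilde Q\,W_{n-1}\phi^{(n-1)}=0$ and $\omega^{(n-2)}\in\tilde Q M^{n-2}\mathcal F_N^{-n+1}(p)$ at all $(p,N)$ with $L_0\ne 0$. For $n\le1$ the condition is equivalent to $\tilde QM^{1-n}\phi^{(n-1)}=0$; for $n\ge2$ it is equivalent to $\phi^{(n-1)}=0$ together with $\omega^{(n-2)}\in\tilde QM^{n-2}\mathcal F_N^{-n+1}(p)$. -/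

import Mathlib

open scoped TensorProduct

noncomputable section

namespace OpenString

/-! ## Pointwise finite sums of operators -/

/-- A family of operators such that on every vector only finitely many members act nontrivially. -/
def PointwiseFinite {ι E : Type*} [AddCommGroup E] [Module ℂ E] (T : ι → Module.End ℂ E) : Prop :=
  ∀ x : E, (Function.support fun i => T i x).Finite

/-- The sum `∑ᵢ Tᵢ` of a pointwise finite family of operators. -/
def opSum {ι E : Type*} [AddCommGroup E] [Module ℂ E] (T : ι → Module.End ℂ E)
    (hT : PointwiseFinite T) : Module.End ℂ E where
  toFun x := ∑ᶠ i, T i x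
  map_add' x y := by
    simp only [map_add]
    exact finsum_add_distrib (hT x) (hT y)
  map_smul' r x := by
    simp only [map_smul, RingHom.id_apply]
    exact (smul_finsum' r (hT x)).symm

/-! ## Matter oscillators -/

/-- The Minkowski metric `diag (-1, 1, …, 1)` in 26 dimensions. -/
def eta (μ : Fin 26) : ℝ := if μ = 0 then -1 else 1

/-- Space-time momenta `p^μ`. -/
abbrev Momentum := Fin 26 → ℝ

/-- `p² = η_{μν} p^μ p^ν`. -/
def momentumSq (p : Momentum) : ℝ := ∑ μ, eta μ * p μ ^ 2

/-- The matter Fock space over `|0,p⟩`: polynomials in the creation operators; the variable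
`(k, μ)` stands for `α_{-(k+1)}^μ`, and `1` for `|0,p⟩`. -/
abbrev MatterFock := MvPolynomial (ℕ × Fin 26) ℂ

/-- The oscillator `α_n^μ` on the matter Fock space of momentum `p`, with
`[α_m^μ, α_n^ν] = m η^{μν} δ_{m+n,0}` and `α_0^μ = √(2α') p^μ`. -/
def alpha (α' : ℝ) (p : Momentum) (μ : Fin 26) : ℤ → Module.End ℂ MatterFock
  | .ofNat 0 => ((Real.sqrt (2 * α') * p μ : ℝ) : ℂ) • 1
  | .ofNat (k + 1) =>
      (((k : ℝ) + 1) * eta μ : ℂ) • (MvPolynomial.pderiv (R := ℂ) (k, μ)).toLinearMap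
  | .negSucc k => LinearMap.mulLeft ℂ (MvPolynomial.X (k, μ))

theorem alpha_eventually_zero (x : MatterFock) :
    ∃ K : ℕ, ∀ (α' : ℝ) (p : Momentum) (n : ℤ) (μ : Fin 26), (K : ℤ) < n → alpha α' p μ n x = 0 := by
  refine ⟨x.vars.sup Prod.fst + 1, fun α' p n μ hn => ?_⟩
  match n, hn with
  | .ofNat 0, hn => simp only [Int.ofNat_eq_natCast] at hn; omega
  | .ofNat (k + 1), hn =>
    have hk : (k, μ) ∉ x.vars := by
      intro h
      have := Finset.le_sup (f := Prod.fst) h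
      simp only [Int.ofNat_eq_natCast] at hn
      simp only at this
      omega
    simp [alpha, MvPolynomial.pderiv_eq_zero_of_notMem_vars hk]
  | .negSucc k, hn => omega

/-- The summand `½ η_{μν} :α_{n-k}^μ α_k^ν:` of the matter Virasoro operator; the oscillator with
the larger mode number stands on the right. -/
def virasoroTerm (α' : ℝ) (p : Momentum) (n k : ℤ) : Module.End ℂ MatterFock :=
  (1 / 2 : ℂ) • ∑ μ, (eta μ : ℂ) • (alpha α' p μ (min k (n - k)) * alpha α' p μ (max k (n - k)))

theorem virasoroTerm_eq_zero {α' : ℝ} {p : Momentum} {x : MatterFock} {K : ℕ}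
    (hK : ∀ (α' : ℝ) (p : Momentum) (n : ℤ) (μ : Fin 26), (K : ℤ) < n → alpha α' p μ n x = 0)
    {n k : ℤ} (h : (K : ℤ) < max k (n - k)) : virasoroTerm α' p n k x = 0 := by
  simp [virasoroTerm, LinearMap.sum_apply, hK _ _ _ _ h]

theorem virasoroTerm_finite (α' : ℝ) (p : Momentum) (n : ℤ) :
    PointwiseFinite (virasoroTerm α' p n) := by
  intro x
  obtain ⟨K, hK⟩ := alpha_eventually_zero x
  refine (Set.finite_Icc (n - K) K).subset fun k hk => ?_
  by_contra hc
  refine hk (virasoroTerm_eq_zero hK ?_)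
  simp only [Set.mem_Icc, not_and_or, not_le] at hc
  rw [lt_max_iff]
  omega

/-- The matter Virasoro operator `L_n^{(m)} = ½ ∑_k :α_{n-k} · α_k:`. -/
def virasoro (α' : ℝ) (p : Momentum) (n : ℤ) : Module.End ℂ MatterFock :=
  opSum (virasoroTerm α' p n) (virasoroTerm_finite α' p n)

theorem virasoro_eventually_zero (α' : ℝ) (p : Momentum) (x : MatterFock) :
    ∃ K : ℕ, ∀ n : ℤ, (K : ℤ) < n → virasoro α' p n x = 0 := by
  obtain ⟨K, hK⟩ := alpha_eventually_zero x
  refine ⟨2 * K, fun n hn => ?_⟩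
  have h0 : ∀ k, virasoroTerm α' p n k x = 0 := fun k =>
    virasoroTerm_eq_zero hK (by rw [lt_max_iff]; push_cast at hn; omega)
  simp [virasoro, opSum, h0]

/-- The summand `η_{μν} α_{-(k+1)}^μ α_{k+1}^ν` of the matter level operator. -/
def matterLevelTerm (α' : ℝ) (p : Momentum) (k : ℕ) : Module.End ℂ MatterFock :=
  ∑ μ, (eta μ : ℂ) • (alpha α' p μ (-((k : ℤ) + 1)) * alpha α' p μ ((k : ℤ) + 1))

theorem matterLevelTerm_finite (α' : ℝ) (p : Momentum) : PointwiseFinite (matterLevelTerm α' p) := by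
  intro x
  obtain ⟨K, hK⟩ := alpha_eventually_zero x
  refine (Set.finite_Iio K).subset fun k hk => ?_
  by_contra hc
  refine hk ?_
  simp only [Set.mem_Iio, not_lt] at hc
  have h : ∀ μ, alpha α' p μ ((k : ℤ) + 1) x = 0 := fun μ => hK _ _ _ _ (by omega)
  simp [matterLevelTerm, LinearMap.sum_apply, h]

/-- The matter part `∑_{n>0} α_{-n} · α_n` of the level operator. -/
def matterLevel (α' : ℝ) (p : Momentum) : Module.End ℂ MatterFock :=
  opSum (matterLevelTerm α' p) (matterLevelTerm_finite α' p)

/-! ## Ghost oscillators -/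

/-- The ghost creation operators: `c k` stands for `c_{-k}` (`k ≥ 0`, including `c_0`) and
`b k` for `b_{-(k+1)}`. -/
inductive GhostGen
  | c (k : ℕ)
  | b (k : ℕ)

/-- The ghost Fock space over `|↓⟩`: the exterior algebra on the ghost creation operators, with `1`
standing for `|↓⟩`. -/
abbrev GhostFock := ExteriorAlgebra ℂ (GhostGen →₀ ℂ)

/-- Multiplication by a ghost creation operator. -/
def ghostCreate (g : GhostGen) : Module.End ℂ GhostFock :=
  LinearMap.mulLeft ℂ (ExteriorAlgebra.ι ℂ (Finsupp.single g 1))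

/-- The antiderivation that removes a ghost creation operator. -/
def ghostRemove (g : GhostGen) : Module.End ℂ GhostFock :=
  CliffordAlgebra.contractLeft (Q := (0 : QuadraticForm ℂ (GhostGen →₀ ℂ))) (Finsupp.lapply g)

/-- The ghost mode `c_n`; for `n > 0` it removes `b_{-n}`. -/
def cMode : ℤ → Module.End ℂ GhostFock
  | .ofNat 0 => ghostCreate (.c 0)
  | .ofNat (k + 1) => ghostRemove (.b k)
  | .negSucc k => ghostCreate (.c (k + 1))

/-- The antighost mode `b_n`; for `n ≥ 0` it removes `c_{-n}`. -/
def bMode : ℤ → Module.End ℂ GhostFock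
  | .ofNat k => ghostRemove (.c k)
  | .negSucc k => ghostCreate (.b k)

theorem ghostRemove_finite : PointwiseFinite ghostRemove := by
  intro x
  induction x using CliffordAlgebra.left_induction with
  | algebraMap r => simp [ghostRemove]
  | add x y hx hy =>
    refine (hx.union hy).subset fun g hg => ?_
    by_contra hc
    simp only [Set.mem_union, Function.mem_support, not_or, not_not] at hc
    exact hg (by simp [hc.1, hc.2])
  | ι_mul x m hx =>
    refine (hx.union m.hasFiniteSupport).subset fun g hg => ?_
    by_contra hc
    simp only [Set.mem_union, Function.mem_support, not_or, not_not, ghostRemove] at hc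
    refine hg ?_
    simp [ghostRemove, CliffordAlgebra.contractLeft_ι_mul, hc.1, hc.2]

theorem ghost_eventually_zero (x : GhostFock) :
    ∃ K : ℕ, ∀ n : ℤ, (K : ℤ) < n → cMode n x = 0 ∧ bMode n x = 0 := by
  have hf := ghostRemove_finite x
  have h1 : {k : ℕ | ghostRemove (.c k) x ≠ 0}.Finite :=
    Set.Finite.preimage (f := GhostGen.c) (fun a _ b _ h => GhostGen.c.inj h) hf
  have h2 : {k : ℕ | ghostRemove (.b k) x ≠ 0}.Finite :=
    Set.Finite.preimage (f := GhostGen.b) (fun a _ b _ h => GhostGen.b.inj h) hf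
  obtain ⟨A, hA⟩ := h1.bddAbove
  obtain ⟨B, hB⟩ := h2.bddAbove
  refine ⟨A + B + 1, fun n hn => ?_⟩
  match n, hn with
  | .ofNat 0, hn => simp only [Int.ofNat_eq_natCast] at hn; omega
  | .ofNat (k + 1), hn =>
    simp only [Int.ofNat_eq_natCast] at hn
    constructor
    · by_contra h
      have : k ≤ B := hB h
      omega
    · by_contra h
      have : k + 1 ≤ A := hA h
      omega
  | .negSucc k, hn => omega

/-- The summand `:c_{-m} c_{-n} b_{m+n}:` with nonzero modes: an annihilation operator `b` stands on
the right, a creation operator `b` on the left (where it is moved past two odd operators). The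
`c` modes anticommute among themselves. -/
def ccb (m n : ℤ) : Module.End ℂ GhostFock :=
  if 0 < m + n then cMode (-m) * cMode (-n) * bMode (m + n)
  else bMode (m + n) * cMode (-m) * cMode (-n)

/-- Pairs of modes with `m n ≠ 0` and `m + n ≠ 0`. -/
abbrev NonzeroPair := {mn : ℤ × ℤ // mn.1 * mn.2 ≠ 0 ∧ mn.1 + mn.2 ≠ 0}

/-- The summand `-½ (m - n) :c_{-m} c_{-n} b_{m+n}:`. -/
def ghostCubicTerm (mn : NonzeroPair) : Module.End ℂ GhostFock :=
  (-(1 / 2 : ℂ) * ((mn.1.1 : ℂ) - (mn.1.2 : ℂ))) • ccb mn.1.1 mn.1.2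

theorem cMode_anticomm (m n : ℤ) (x : GhostFock) :
    cMode m (cMode n x) = -cMode n (cMode m x) := by
  have cc : ∀ g h : GhostGen, ∀ x, ghostCreate g (ghostCreate h x) = -ghostCreate h (ghostCreate g x) := by
    intro g h x
    simp only [ghostCreate, LinearMap.mulLeft_apply, ← mul_assoc]
    rw [← neg_mul, eq_neg_of_add_eq_zero_left (ExteriorAlgebra.ι_add_mul_swap _ _)]
  have rr : ∀ g h : GhostGen, ∀ x, ghostRemove g (ghostRemove h x) = -ghostRemove h (ghostRemove g x) :=
    fun g h x => CliffordAlgebra.contractLeft_comm _ _ x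
  have rc : ∀ k l : ℕ, ∀ x, ghostRemove (.b k) (ghostCreate (.c l) x)
      = -ghostCreate (.c l) (ghostRemove (.b k) x) := by
    intro k l x
    simp [ghostRemove, ghostCreate, ExteriorAlgebra.ι, CliffordAlgebra.contractLeft_ι_mul]
  match m, n with
  | .ofNat 0, .ofNat 0 => exact cc _ _ _
  | .ofNat 0, .ofNat (l + 1) => simp [cMode, rc]
  | .ofNat 0, .negSucc l => exact cc _ _ _
  | .ofNat (k + 1), .ofNat 0 => exact rc _ _ _
  | .ofNat (k + 1), .ofNat (l + 1) => exact rr _ _ _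
  | .ofNat (k + 1), .negSucc l => exact rc _ _ _
  | .negSucc k, .ofNat 0 => exact cc _ _ _
  | .negSucc k, .ofNat (l + 1) => simp [cMode, rc]
  | .negSucc k, .negSucc l => exact cc _ _ _

theorem bc_anticomm (k n : ℤ) (h : k + n ≠ 0) (x : GhostFock) :
    bMode k (cMode n x) = -cMode n (bMode k x) := by
  have cc : ∀ g h : GhostGen, ∀ x, ghostCreate g (ghostCreate h x) = -ghostCreate h (ghostCreate g x) := by
    intro g h x
    simp only [ghostCreate, LinearMap.mulLeft_apply, ← mul_assoc]
    rw [← neg_mul, eq_neg_of_add_eq_zero_left (ExteriorAlgebra.ι_add_mul_swap _ _)]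
  have rr : ∀ g h : GhostGen, ∀ x, ghostRemove g (ghostRemove h x) = -ghostRemove h (ghostRemove g x) :=
    fun g h x => CliffordAlgebra.contractLeft_comm _ _ x
  have rc : ∀ g h : GhostGen, g ≠ h → ∀ x, ghostRemove g (ghostCreate h x)
      = -ghostCreate h (ghostRemove g x) := by
    intro g h hgh x
    simp [ghostRemove, ghostCreate, ExteriorAlgebra.ι, CliffordAlgebra.contractLeft_ι_mul,
      Finsupp.single_eq_of_ne hgh]
  match k, n with
  | .ofNat k, .ofNat 0 => exact rc _ _ (fun e => by cases e; simp at h) _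
  | .ofNat k, .ofNat (l + 1) => exact rr _ _ _
  | .ofNat k, .negSucc l => exact rc _ _ (fun e => by cases e; simp [Int.negSucc_eq] at h) _
  | .negSucc k, .ofNat 0 => exact cc _ _ _
  | .negSucc k, .ofNat (l + 1) =>
    have := rc (.b l) (.b k) (fun e => by cases e; simp [Int.negSucc_eq] at h) x
    simp [cMode, bMode, this]
  | .negSucc k, .negSucc l => exact cc _ _ _

theorem ghostCubicTerm_finite : PointwiseFinite ghostCubicTerm := by
  intro x
  obtain ⟨K, hK⟩ := ghost_eventually_zero x
  refine Set.Finite.subset (s := Subtype.val ⁻¹' (Set.Icc (-(K : ℤ)) (2 * K) ×ˢ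
    Set.Icc (-(K : ℤ)) (2 * K))) (((Set.finite_Icc _ _).prod (Set.finite_Icc _ _)).preimage
      Subtype.val_injective.injOn) fun mn hmn => ?_
  obtain ⟨⟨m, n⟩, h1, h2⟩ := mn
  have hm0 : m ≠ 0 := left_ne_zero_of_mul h1
  have hn0 : n ≠ 0 := right_ne_zero_of_mul h1
  by_contra hc
  refine hmn ?_
  have key : (K : ℤ) < -m ∨ (K : ℤ) < -n ∨ (K : ℤ) < m + n := by
    simp only [Set.mem_preimage, Set.mem_prod, Set.mem_Icc] at hc
    omega
  suffices ccb m n x = 0 by simp [ghostCubicTerm, this]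
  unfold ccb
  split_ifs with hp
  · simp only [Module.End.mul_apply]
    rcases key with h | h | h
    · have e : bMode (m + n) (cMode (-m) x) = 0 := by simp [(hK _ h).1]
      rw [cMode_anticomm]
      have e' : cMode (-m) (bMode (m + n) x) = 0 := by
        have := bc_anticomm (m + n) (-m) (by omega) x
        rw [e] at this
        exact neg_eq_zero.mp this.symm
      simp [e']
    · have e : bMode (m + n) (cMode (-n) x) = 0 := by simp [(hK _ h).1]
      have e' : cMode (-n) (bMode (m + n) x) = 0 := by
        have := bc_anticomm (m + n) (-n) (by omega) x
        rw [e] at this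
        exact neg_eq_zero.mp this.symm
      simp [e']
    · simp [(hK _ h).2]
  · simp only [Module.End.mul_apply]
    rcases key with h | h | h
    · rw [cMode_anticomm]
      simp [(hK _ h).1]
    · simp [(hK _ h).1]
    · omega

/-- `-½ ∑_{mn ≠ 0, m+n ≠ 0} (m - n) :c_{-m} c_{-n} b_{m+n}:`. -/
def ghostCubic : Module.End ℂ GhostFock := opSum ghostCubicTerm ghostCubicTerm_finite

/-- The summand `(k+1) c_{-(k+1)} c_{k+1}`. -/
def mTerm (k : ℕ) : Module.End ℂ GhostFock :=
  ((k : ℂ) + 1) • (cMode (-((k : ℤ) + 1)) * cMode ((k : ℤ) + 1))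

/-- The summand `c_{-(k+1)} b_{k+1} - b_{-(k+1)} c_{k+1}`. -/
def ghostNumberTerm (k : ℕ) : Module.End ℂ GhostFock :=
  cMode (-((k : ℤ) + 1)) * bMode ((k : ℤ) + 1) - bMode (-((k : ℤ) + 1)) * cMode ((k : ℤ) + 1)

/-- The summand `(k+1) (c_{-(k+1)} b_{k+1} + b_{-(k+1)} c_{k+1})`. -/
def ghostLevelTerm (k : ℕ) : Module.End ℂ GhostFock :=
  ((k : ℂ) + 1) •
    (cMode (-((k : ℤ) + 1)) * bMode ((k : ℤ) + 1) + bMode (-((k : ℤ) + 1)) * cMode ((k : ℤ) + 1))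

theorem finite_of_ghost {T : ℕ → Module.End ℂ GhostFock}
    (h : ∀ (k : ℕ) x, cMode ((k : ℤ) + 1) x = 0 → bMode ((k : ℤ) + 1) x = 0 → T k x = 0) :
    PointwiseFinite T := by
  intro x
  obtain ⟨K, hK⟩ := ghost_eventually_zero x
  refine (Set.finite_Iio K).subset fun k hk => ?_
  by_contra hc
  simp only [Set.mem_Iio, not_lt] at hc
  have := hK ((k : ℤ) + 1) (by omega)
  exact hk (h k x this.1 this.2)

theorem mTerm_finite : PointwiseFinite mTerm :=
  finite_of_ghost fun k x h1 _ => by simp [mTerm, h1]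

theorem ghostNumberTerm_finite : PointwiseFinite ghostNumberTerm :=
  finite_of_ghost fun k x h1 h2 => by simp [ghostNumberTerm, h1, h2]

theorem ghostLevelTerm_finite : PointwiseFinite ghostLevelTerm :=
  finite_of_ghost fun k x h1 h2 => by simp [ghostLevelTerm, h1, h2]

/-! ## The Fock space and the BRST operator -/

/-- The Fock space `𝓕(p) ⊕ c_0 𝓕(p)` over `|0,p;↓⟩`. -/
abbrev Fock := MatterFock ⊗[ℂ] GhostFock

/-- An operator of the ghost sector, acting on the Fock space. -/
def onGhost (T : Module.End ℂ GhostFock) : Module.End ℂ Fock := LinearMap.lTensor MatterFock T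

/-- An operator of the matter sector, acting on the Fock space. -/
def onMatter (T : Module.End ℂ MatterFock) : Module.End ℂ Fock := LinearMap.rTensor GhostFock T

/-- The ghost zero mode `c_0`. -/
def c0 : Module.End ℂ Fock := onGhost (cMode 0)

/-- The antighost zero mode `b_0`. -/
def b0 : Module.End ℂ Fock := onGhost (bMode 0)

/-- `Ñ^g = ∑_{n>0} (c_{-n} b_n - b_{-n} c_n)`. -/
def ghostNumber : Module.End ℂ Fock := onGhost (opSum ghostNumberTerm ghostNumberTerm_finite)

/-- The level operator `∑_{n>0} (α_{-n} · α_n + n c_{-n} b_n + n b_{-n} c_n)`. -/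
def level (α' : ℝ) (p : Momentum) : Module.End ℂ Fock :=
  onMatter (matterLevel α' p) + onGhost (opSum ghostLevelTerm ghostLevelTerm_finite)

/-- `M = -2 ∑_{n>0} n c_{-n} c_n`. -/
def M : Module.End ℂ Fock := onGhost ((-2 : ℂ) • opSum mTerm mTerm_finite)

/-- `L_0 = α' p² + (level) - 1`. -/
def L0 (α' : ℝ) (p : Momentum) : Module.End ℂ Fock :=
  ((α' * momentumSq p - 1 : ℝ) : ℂ) • 1 + level α' p

/-- The summand `c_{-n} L_n^{(m)}`, `n ≠ 0`. -/
def cVirasoroTerm (α' : ℝ) (p : Momentum) (n : {n : ℤ // n ≠ 0}) : Module.End ℂ Fock :=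
  onGhost (cMode (-n.1)) * onMatter (virasoro α' p n.1)

theorem cVirasoroTerm_finite (α' : ℝ) (p : Momentum) : PointwiseFinite (cVirasoroTerm α' p) := by
  intro x
  induction x using TensorProduct.induction_on with
  | zero => simp
  | add x y hx hy =>
    refine (hx.union hy).subset fun g hg => ?_
    by_contra hc
    simp only [Set.mem_union, Function.mem_support, not_or, not_not] at hc
    exact hg (by simp [hc.1, hc.2])
  | tmul f g =>
    obtain ⟨K, hK⟩ := virasoro_eventually_zero α' p f
    obtain ⟨J, hJ⟩ := ghost_eventually_zero g
    refine Set.Finite.subset (s := Subtype.val ⁻¹' (Set.Icc (-(J : ℤ)) K))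
      ((Set.finite_Icc _ _).preimage Subtype.val_injective.injOn) fun n hn => ?_
    by_contra hc
    simp only [Set.mem_preimage, Set.mem_Icc, not_and_or, not_le] at hc
    refine hn ?_
    rcases hc with h | h
    · simp [cVirasoroTerm, onGhost, onMatter, (hJ (-n.1) (by omega)).1]
    · simp [cVirasoroTerm, onGhost, onMatter, hK n.1 h]

/-- `Q̃ = ∑_{n≠0} c_{-n} L_n^{(m)} - ½ ∑_{mn≠0, m+n≠0} (m - n) :c_{-m} c_{-n} b_{m+n}:`. -/
def Qt (α' : ℝ) (p : Momentum) : Module.End ℂ Fock :=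
  opSum (cVirasoroTerm α' p) (cVirasoroTerm_finite α' p) + onGhost ghostCubic

/-- The BRST operator `Q = Q̃ + c_0 L_0 + b_0 M`. -/
def Q (α' : ℝ) (p : Momentum) : Module.End ℂ Fock :=
  Qt α' p + c0 * L0 α' p + b0 * M

/-! ## String fields

Component fields take values in a complex vector space `V` (for instance `ℂ`, or the even or the odd
part of a Grassmann algebra), on which the operators of the Fock space act trivially. -/

section Fields

variable (α' : ℝ) (V : Type*) [AddCommGroup V] [Module ℂ V]

/-- The action of an operator on states with coefficients in `V`. -/
def coeff (T : Module.End ℂ Fock) : Module.End ℂ (Fock ⊗[ℂ] V) := LinearMap.rTensor V T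

/-- `𝓕_N^m(p)` with coefficients in `V`: the states without `c_0`, of level `N` and with
`Ñ^g = m`. -/
def stateSpace (p : Momentum) (N : ℕ) (m : ℤ) : Submodule ℂ (Fock ⊗[ℂ] V) where
  carrier := {x | coeff V b0 x = 0 ∧ coeff V ghostNumber x = (m : ℂ) • x ∧
    coeff V (level α' p) x = (N : ℂ) • x}
  zero_mem' := by simp
  add_mem' := by
    rintro x y ⟨h1, h2, h3⟩ ⟨h1', h2', h3'⟩
    exact ⟨by rw [map_add, h1, h1', add_zero], by rw [map_add, h2, h2', smul_add],
      by rw [map_add, h3, h3', smul_add]⟩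
  smul_mem' := by
    rintro r x ⟨h1, h2, h3⟩
    exact ⟨by rw [map_smul, h1, smul_zero], by rw [map_smul, h2, smul_comm],
      by rw [map_smul, h3, smul_comm]⟩

/-- The inverse `W_n : 𝓕_N^n → 𝓕_N^{-n}` of `M^n : 𝓕_N^{-n} → 𝓕_N^n`. -/
def W (p : Momentum) (N n : ℕ) : Fock ⊗[ℂ] V → Fock ⊗[ℂ] V :=
  Function.invFunOn (coeff V (M ^ n)) (stateSpace α' V p N (-(n : ℤ)))

/-- The pairs (momentum, level) at which `L_0 = α' p² + N - 1` does not vanish. -/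
structure OffShell where
  p : Momentum
  N : ℕ
  L0_ne_zero : α' * momentumSq p + N - 1 ≠ 0

/-- Families of states, one for every momentum and level with `L_0 ≠ 0`. -/
abbrev Field := OffShell α' → Fock ⊗[ℂ] V

/-- String fields `Φ_n = φ^{(n-1)} + c_0 ω^{(n-2)}` of ghost number `n`, with `L_0 ≠ 0`. -/
def stringField (n : ℤ) : Submodule ℂ (Field α' V) :=
  Submodule.pi Set.univ fun s =>
    stateSpace α' V s.p s.N (n - 1) ⊔ (stateSpace α' V s.p s.N (n - 2)).map (coeff V c0)

variable {α' V}

/-- The part `φ = b_0 c_0 Φ` of `Φ = φ + c_0 ω`. -/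
def phi (x : Fock ⊗[ℂ] V) : Fock ⊗[ℂ] V := coeff V (b0 * c0) x

/-- The part `ω = b_0 Φ` of `Φ = φ + c_0 ω`. -/
def omega (x : Fock ⊗[ℂ] V) : Fock ⊗[ℂ] V := coeff V b0 x

/-- The free gauge variation `Λ ↦ Q Λ`. -/
def gaugeVar (Λ : Field α' V) : Field α' V := fun s => coeff V (Q α' s.p) (Λ s)

variable (α' V)

/-- The Landau-type gauge for ghost number `n`.
For `n ≤ 1`: `b_0 c_0 Q̃ M^{1-n} Φ_n = 0`.
For `n ≥ 2`: `Q̃ W_{n-1} φ^{(n-1)} = 0` and `ω^{(n-2)} ∈ Q̃ M^{n-2} 𝓕^{-n+1}`. -/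
def landauGauge (n : ℤ) : Set (Field α' V) :=
  {Φ | Φ ∈ stringField α' V n ∧ ∀ s : OffShell α',
    if n ≤ 1 then coeff V (b0 * c0 * Qt α' s.p * M ^ (1 - n).toNat) (Φ s) = 0
    else coeff V (Qt α' s.p) (W α' V s.p s.N (n - 1).toNat (phi (Φ s))) = 0 ∧
      omega (Φ s) ∈
        (stateSpace α' V s.p s.N (1 - n)).map (coeff V (Qt α' s.p * M ^ (n - 2).toNat))}

/-- The condition `Φ ∈ G` on string fields of ghost number `n` exactly fixes the gauge symmetry
`δΦ_n = Q Λ_{n-1}`: every field can be brought into `G`, and no nontrivial gauge transformation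
connects two fields of `G`. -/
def ExactlyFixes (n : ℤ) (G : Set (Field α' V)) : Prop :=
  (∀ Φ ∈ stringField α' V n, ∃ Λ ∈ stringField α' V (n - 1), Φ + gaugeVar Λ ∈ G) ∧
  (∀ Φ ∈ G, ∀ Λ ∈ stringField α' V (n - 1), Φ + gaugeVar Λ ∈ G → gaugeVar Λ = 0)

end Fields

end OpenString

end

/-!
# Landau-type gauges of the free open bosonic string field

Write `L_0 = r + level`. Three algebraic facts carry the proof.

* `Q̃² = -L_0 M` (`OscillatorRep.anomaly_eq_zero`); this is the statement `Q² = 0`. The combination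
  `Q̃² + L_0 M`, the anomaly, commutes with the modes of `α` and `c`, by the Jacobi identity of the ghost algebra.
  An induction over the Fock space thus reduces its vanishing to the states `b_{-k_1} ⋯ b_{-k_j} |0⟩`.
  It annihilates the vacuum, and for `j ≥ 1` it maps such a state to one of ghost number `2 - j` that
  contains only `c` excitations. For `j ≥ 2` there is none at the given level, and for `j = 1` the only
  possible excitation is `c_{-k}`, whose coefficient consists of the matter and ghost central terms and
  of that of `L_0 M`: it vanishes for `D = 26` and intercept one (`OscillatorRep.anomaly_cancellation`).
* `M`, the lowering operator `-∑ (2n)⁻¹ b_{-n} b_n` and the ghost number form an `sl₂` triple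
  (`OscillatorRep.M_lower`), with locally nilpotent raising and lowering operators. Hence `Mⁿ` is a
  bijection between the ghost numbers `-n` and `n` (`bijOn_pow_weight`).
* Off shell, `L_0` is a nonzero number, and the gauge orbit of `φ + c_0 ω` is parametrized by
  `δφ = Q̃ ξ`, `δω = L_0 ξ` (`GaugeData.exists_Q_eq`, `exactly_fixes`).

For ghost number `1 - k ≤ 1` the condition is `Q̃ M^k φ = 0`, and `Q̃ M^k (φ + Q̃ ξ) =
Q̃ M^k φ - L_0 M^{k+1} ξ`, so that the bijectivity of `M^{k+1}` determines `ξ` uniquely. For ghost number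
`k + 2 ≥ 2` the condition `Q̃ W φ = 0` means `φ = 0`, because applying `Q̃` again gives `L_0 M W φ = 0`,
and `M` is injective at negative ghost number. The gauge `φ = 0`, `ω ∈ Q̃ M^k 𝓕^{-k-1}` leads to
`L_0 M^{k+1} f = L_0 φ - Q̃ ω`, where `Q̃ M^k f` is the gauge-fixed `ω`; this again has a unique solution.

The operator identities are proved in an abstract representation (`OscillatorRep`), in which infinite
sums of operators are handled by `HasOpSum`, and applied to the Fock space through `fockRep`.
-/

noncomputable section

namespace OpenString

/-! ### Pointwise finite sums of operators -/

section OpSum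

variable {ι κ E : Type*} [AddCommGroup E] [Module ℂ E]

/-- `S` is the sum of the family `T` of operators: on every vector only finitely many members act
nontrivially, and they add up to `S`. -/
def HasOpSum (T : ι → Module.End ℂ E) (S : Module.End ℂ E) : Prop :=
  ∀ x, (Function.support fun i => T i x).Finite ∧ ∑ᶠ i, T i x = S x

theorem PointwiseFinite.hasOpSum {T : ι → Module.End ℂ E} (hT : PointwiseFinite T) :
    HasOpSum T (opSum T hT) := fun x => ⟨hT x, rfl⟩

namespace HasOpSum

variable {T T' : ι → Module.End ℂ E} {S S' : Module.End ℂ E}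

theorem unique (h : HasOpSum T S) (h' : HasOpSum T S') : S = S' :=
  LinearMap.ext fun x => (h x).2.symm.trans (h' x).2

theorem congr (h : HasOpSum T S) (hT : ∀ i, T' i = T i) : HasOpSum T' S := by
  rwa [show T' = T from funext hT]

theorem add (h : HasOpSum T S) (h' : HasOpSum T' S') : HasOpSum (fun i => T i + T' i) (S + S') :=
  fun x => ⟨((h x).1.union (h' x).1).subset (Function.support_add _ _), by
    simp only [LinearMap.add_apply]
    rw [finsum_add_distrib (h x).1 (h' x).1, (h x).2, (h' x).2]⟩

theorem mul_left (A : Module.End ℂ E) (h : HasOpSum T S) : HasOpSum (fun i => A * T i) (A * S) :=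
  fun x => ⟨(h x).1.subset fun i hi hc => hi (by simp only at hc; simp [hc]), by
    simp only [Module.End.mul_apply]
    rw [← (h x).2, map_finsum A (h x).1]⟩

theorem mul_right (A : Module.End ℂ E) (h : HasOpSum T S) : HasOpSum (fun i => T i * A) (S * A) :=
  fun x => h (A x)

theorem smul (r : ℂ) (h : HasOpSum T S) : HasOpSum (fun i => r • T i) (r • S) :=
  (h.mul_left (r • 1)).congr (fun i => by simp) |> fun h => by simpa using h

theorem neg (h : HasOpSum T S) : HasOpSum (fun i => -T i) (-S) := by
  simpa using h.smul (-1)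

theorem sub (h : HasOpSum T S) (h' : HasOpSum T' S') : HasOpSum (fun i => T i - T' i) (S - S') := by
  simpa [sub_eq_add_neg] using h.add h'.neg

theorem commutator (A : Module.End ℂ E) (h : HasOpSum T S) :
    HasOpSum (fun i => T i * A - A * T i) (S * A - A * S) :=
  (h.mul_right A).sub (h.mul_left A)

theorem anticommutator (A : Module.End ℂ E) (h : HasOpSum T S) :
    HasOpSum (fun i => T i * A + A * T i) (S * A + A * S) :=
  (h.mul_right A).add (h.mul_left A)

theorem reindex (h : HasOpSum T S) (e : κ ≃ ι) : HasOpSum (fun k => T (e k)) S := fun x =>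
  ⟨(h x).1.preimage e.injective.injOn, by
    rw [← (h x).2]
    exact finsum_comp_equiv (f := fun i => T i x) e⟩

theorem extend {j : ι → κ} (hj : Function.Injective j) {T' : κ → Module.End ℂ E}
    (h : HasOpSum T S) (h1 : ∀ i, T' (j i) = T i) (h0 : ∀ k, k ∉ Set.range j → T' k = 0) :
    HasOpSum T' S := by
  intro x
  have hs : (Function.support fun k => T' k x) ⊆ j '' (Function.support fun i => T i x) := by
    intro k hk
    by_cases hr : k ∈ Set.range j
    · obtain ⟨i, rfl⟩ := hr
      exact ⟨i, by simpa [h1] using hk, rfl⟩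
    · exact absurd (by simp [h0 k hr]) hk
  refine ⟨((h x).1.image j).subset hs, ?_⟩
  rw [← (h x).2]
  have hr : (fun k => T' k x) = fun k => ∑ᶠ _ : k ∈ Set.range j, T' k x := by
    funext k
    by_cases hk : k ∈ Set.range j
    · simp [hk]
    · simp [h0 k hk]
  rw [hr, finsum_mem_range hj]
  simp [h1]

theorem single (i : ι) (h : ∀ k, k ≠ i → T k = 0) : HasOpSum T (T i) := by
  intro x
  refine ⟨(Set.finite_singleton i).subset fun k hk => ?_, ?_⟩
  · by_contra hc
    exact hk (by simp [h k hc])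
  · exact finsum_eq_single _ i fun k hk => by simp [h k hk]

theorem curry {F : ι × κ → Module.End ℂ E} (h : HasOpSum F S)
    (hT : ∀ i, HasOpSum (fun k => F (i, k)) (T i)) : HasOpSum T S := by
  intro x
  have e : ∀ i, T i x = ∑ᶠ k, F (i, k) x := fun i => ((hT i) x).2.symm
  refine ⟨((h x).1.image Prod.fst).subset fun i hi => ?_, ?_⟩
  · by_contra hc
    refine hi ?_
    simp only [e]
    refine finsum_eq_zero_of_forall_eq_zero fun k => ?_
    by_contra hk
    exact hc ⟨(i, k), hk, rfl⟩
  · simp only [e]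
    rw [← (h x).2]
    exact (finsum_curry _ (h x).1).symm

theorem apply_eq_zero (h : HasOpSum T S) {x : E} (hx : ∀ i, T i x = 0) : S x = 0 := by
  rw [← (h x).2]
  exact finsum_eq_zero_of_forall_eq_zero hx

theorem apply_eq_sum (h : HasOpSum T S) {x : E} (s : Finset ι) (hx : ∀ i, i ∉ s → T i x = 0) :
    S x = ∑ i ∈ s, T i x := by
  rw [← (h x).2]
  refine finsum_eq_sum_of_support_subset _ fun i hi => ?_
  by_contra hc
  exact hi (hx i hc)

/-- A sum over `ℕ`, regarded as a sum over the positive integers `k + 1`. -/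
theorem int_of_nat {T : ℕ → Module.End ℂ E} {T' : ℤ → Module.End ℂ E} (h : HasOpSum T S)
    (h1 : ∀ k : ℕ, T' ((k : ℤ) + 1) = T k) : HasOpSum (fun k => if 0 < k then T' k else 0) S := by
  refine h.extend (j := fun k : ℕ => (k : ℤ) + 1) (fun a b hab => by simpa using hab) ?_ ?_
  · intro k
    rw [if_pos (by positivity), h1]
  · intro k hk
    refine if_neg fun hp => hk ⟨(k - 1).toNat, ?_⟩
    simp only
    omega

theorem eq_of_forall_eq (h : HasOpSum T S) (h' : HasOpSum T' S') (e : ∀ i, T i = T' i) : S = S' :=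
  h.unique (h'.congr e)

theorem commute {A : Module.End ℂ E} (h : HasOpSum T S) (hA : ∀ i, Commute (T i) A) : Commute S A :=
  (h.mul_right A).eq_of_forall_eq (h.mul_left A) fun i => (hA i).eq

theorem anticommute {A : Module.End ℂ E} (h : HasOpSum T S) (hA : ∀ i, T i * A = -(A * T i)) :
    S * A = -(A * S) :=
  (h.mul_right A).eq_of_forall_eq (h.mul_left A).neg hA

/-- A sum over the positive integers whose commutator with `A` is supported at `|k|`. -/
theorem commutator_eq {T : ℤ → Module.End ℂ E} {A : Module.End ℂ E} {k : ℤ} (hk : k ≠ 0)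
    (h : HasOpSum (fun i => if 0 < i then T i else 0) S)
    (h0 : ∀ i, 0 < i → i ≠ k → i ≠ -k → T i * A - A * T i = 0) :
    S * A - A * S = T |k| * A - A * T |k| := by
  refine (h.commutator A).unique ?_
  have := HasOpSum.single (T := fun i => (if 0 < i then T i else 0) * A - A * if 0 < i then T i else 0)
    |k| fun i hi => by
      by_cases hp : 0 < i
      · have h1 : i ≠ k := by
          rintro rfl
          exact hi (abs_of_pos hp).symm
        have h2 : i ≠ -k := by
          rintro rfl
          exact hi (abs_of_neg (neg_pos.mp hp)).symm
        simpa only [if_pos hp] using h0 i hp h1 h2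
      · simp [hp]
  simpa only [if_pos (abs_pos.mpr hk)] using this

theorem onGhost {T : ι → Module.End ℂ GhostFock} {S : Module.End ℂ GhostFock} (h : HasOpSum T S) :
    HasOpSum (fun i => onGhost (T i)) (onGhost S) := by
  intro x
  induction x using TensorProduct.induction_on with
  | zero => simp
  | add x y hx hy =>
    simp only [map_add]
    refine ⟨(hx.1.union hy.1).subset (Function.support_add _ _), ?_⟩
    rw [finsum_add_distrib hx.1 hy.1, hx.2, hy.2]
  | tmul f g =>
    have hs : (Function.support fun i => OpenString.onGhost (T i) (f ⊗ₜ[ℂ] g)) ⊆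
        Function.support fun i => T i g := fun i hi hc => hi (by
          simp only at hc
          simp [OpenString.onGhost, hc])
    refine ⟨(h g).1.subset hs, ?_⟩
    have e := map_finsum (TensorProduct.mk ℂ MatterFock GhostFock f) (h g).1
    rw [(h g).2] at e
    exact e.symm

theorem onMatter {T : ι → Module.End ℂ MatterFock} {S : Module.End ℂ MatterFock}
    (h : HasOpSum T S) : HasOpSum (fun i => onMatter (T i)) (onMatter S) := by
  intro x
  induction x using TensorProduct.induction_on with
  | zero => simp
  | add x y hx hy =>
    simp only [map_add]
    refine ⟨(hx.1.union hy.1).subset (Function.support_add _ _), ?_⟩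
    rw [finsum_add_distrib hx.1 hy.1, hx.2, hy.2]
  | tmul f g =>
    have hs : (Function.support fun i => OpenString.onMatter (T i) (f ⊗ₜ[ℂ] g)) ⊆
        Function.support fun i => T i f := fun i hi hc => hi (by
          simp only at hc
          simp [OpenString.onMatter, hc])
    refine ⟨(h f).1.subset hs, ?_⟩
    have e := map_finsum ((TensorProduct.mk ℂ MatterFock GhostFock).flip g) (h f).1
    rw [(h f).2] at e
    exact e.symm

end HasOpSum

end OpSum

/-! ### Lefschetz property of locally nilpotent `sl₂` representations -/

section Sl2

open Polynomial

variable {E : Type*} [AddCommGroup E] [Module ℂ E]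

theorem weight_pow {e h : Module.End ℂ E} {r : ℂ} (he : h * e - e * h = r • e) {w : ℂ} {x : E}
    (hx : h x = w • x) (k : ℕ) : h ((e ^ k) x) = (w + r * k) • (e ^ k) x := by
  induction k with
  | zero => simp [hx]
  | succ k ih =>
    have h1 := LinearMap.congr_fun he ((e ^ k) x)
    simp only [LinearMap.sub_apply, Module.End.mul_apply, LinearMap.smul_apply, ih, map_smul] at h1
    rw [pow_succ', Module.End.mul_apply, eq_add_of_sub_eq h1, ← add_smul]
    congr 1
    push_cast
    ring

/-- If `f e` acts on the weight space of weight `w` as `Ω - ρ w`, with `Ω` commuting with `e` and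
`h`, then `fⁿ eⁿ` acts on it as a polynomial in `Ω`. -/
theorem pow_pow_eq_aeval {e f h Ω : Module.End ℂ E} {r : ℂ} {ρ : ℂ → ℂ}
    (he : h * e - e * h = r • e) (hΩe : Commute Ω e) (hΩh : Commute Ω h)
    (hfe : ∀ w x, h x = w • x → f (e x) = Ω x - ρ w • x) {w : ℂ} (n : ℕ) :
    ∀ {x : E}, h x = w • x → (f ^ n) ((e ^ n) x) =
      aeval Ω (∏ j ∈ Finset.range n, (X - C (ρ (w + r * j)))) x := by
  induction n with
  | zero => simp
  | succ n ih =>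
    intro x hx
    have h1 : Ω ((e ^ n) x) = (e ^ n) (Ω x) := LinearMap.congr_fun (hΩe.pow_right n).eq x
    have h2 : h (Ω x) = w • Ω x := by
      rw [← map_smul, ← hx]
      exact (LinearMap.congr_fun hΩh.eq x).symm
    have h3 : h (Ω x - ρ (w + r * n) • x) = w • (Ω x - ρ (w + r * n) • x) := by
      rw [map_sub, map_smul, h2, hx, smul_sub, smul_comm]
    rw [pow_succ f, pow_succ' e, Module.End.mul_apply, Module.End.mul_apply,
      hfe _ _ (weight_pow he hx n), h1, ← map_smul, ← map_sub, ih h3, Finset.prod_range_succ]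
    simp [Module.algebraMap_end_apply]

theorem commute_aeval {Ω h : Module.End ℂ E} (hΩh : Commute Ω h) (P : ℂ[X]) :
    Commute (aeval Ω P) h := by
  induction P using Polynomial.induction_on' with
  | add P R hP hR => simpa using hP.add_left hR
  | monomial n a =>
    rw [aeval_monomial]
    exact (Algebra.commutes a h : _ = _) |> fun ha => Commute.mul_left ha (hΩh.pow_left n)

/-- In a representation of `sl₂` on which `e` and `f` are locally nilpotent, `eⁿ` is a bijection from
the weight space of weight `-n` onto that of weight `n`. Up to a constant shift, `fⁿ eⁿ` and `eⁿ fⁿ`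
are the same polynomial in the Casimir operator, and nilpotency provides another polynomial, coprime
to the first, by which the Casimir operator annihilates the given vector. -/
theorem bijOn_pow_weight {e f h : Module.End ℂ E} (hef : e * f - f * e = h)
    (he : h * e - e * h = (2 : ℂ) • e) (hf : h * f - f * h = (-2 : ℂ) • f)
    (hne : ∀ x, ∃ k, (e ^ k) x = 0) (hnf : ∀ x, ∃ k, (f ^ k) x = 0) (n : ℕ) :
    Set.BijOn (e ^ n : Module.End ℂ E) {x | h x = (-n : ℂ) • x} {x | h x = (n : ℂ) • x} := by
  set Ω : Module.End ℂ E := f * e + (1 / 2 : ℂ) • h + (1 / 4 : ℂ) • (h * h) with hΩ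
  have he' : h * e = e * h + (2 : ℂ) • e := eq_add_of_sub_eq' he
  have hf' : h * f = f * h + (-2 : ℂ) • f := eq_add_of_sub_eq' hf
  have hef' : e * f = f * e + h := eq_add_of_sub_eq' hef
  have hΩe : Commute Ω e := by
    have h1 : h * h * e = e * (h * h) + (4 : ℂ) • (e * h) + (4 : ℂ) • e := by
      rw [mul_assoc, he', mul_add, ← mul_assoc, he', mul_smul_comm, he']
      simp only [add_mul, smul_mul_assoc, mul_assoc]
      module
    have h2 : e * (f * e) = f * e * e + e * h + (2 : ℂ) • e := by
      rw [← mul_assoc, hef', add_mul, he', add_assoc]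
    unfold Commute SemiconjBy
    simp only [hΩ, add_mul, mul_add, smul_mul_assoc, mul_smul_comm, h1, h2, he']
    module
  have hΩf : Commute Ω f := by
    have h1 : h * h * f = f * (h * h) - (4 : ℂ) • (f * h) + (4 : ℂ) • f := by
      rw [mul_assoc, hf', mul_add, ← mul_assoc, hf', mul_smul_comm, hf']
      simp only [add_mul, smul_mul_assoc, mul_assoc]
      module
    have h2 : f * e * f = f * (f * e) + f * h := by
      rw [mul_assoc, hef', mul_add]
    unfold Commute SemiconjBy
    simp only [hΩ, add_mul, mul_add, smul_mul_assoc, mul_smul_comm, h1, h2, hf']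
    module
  have hΩh : Commute Ω h := by
    rw [← hef]
    exact (hΩe.mul_right hΩf).sub_right (hΩf.mul_right hΩe)
  set ρ : ℂ → ℂ := fun w => w * (w + 2) / 4 with hρ
  have hfe : ∀ w x, h x = w • x → f (e x) = Ω x - ρ w • x := by
    intro w x hx
    simp only [hΩ, hρ, LinearMap.add_apply, LinearMap.smul_apply, Module.End.mul_apply, hx, map_smul]
    module
  have hef2 : ∀ w x, h x = w • x → e (f x) = Ω x - ρ (-w) • x := by
    intro w x hx
    have := LinearMap.congr_fun hef' x
    simp only [Module.End.mul_apply, LinearMap.add_apply] at this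
    rw [this, hfe w x hx, hx]
    simp only [hρ]
    module
  -- the two polynomials in the Casimir operator
  set R : ℂ[X] := ∏ j ∈ Finset.range n, (X - C (ρ (-n + 2 * j))) with hR
  set P : ℕ → ℂ[X] := fun k => ∏ j ∈ Finset.range k, (X - C (ρ (n + 2 * j))) with hP
  have hcop : ∀ k, IsCoprime (P k) R := by
    intro k
    refine IsCoprime.prod_left fun i _ => IsCoprime.prod_right fun j hj => ?_
    refine isCoprime_X_sub_C_of_isUnit_sub (sub_ne_zero.mpr fun hc => ?_).isUnit
    have hj' := Finset.mem_range.mp hj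
    have h0 : (((n + i - j : ℤ) * (i + j + 1 : ℤ) : ℤ) : ℂ) = 0 := by
      push_cast
      simp only [hρ] at hc
      linear_combination hc
    have h1 : (0 : ℤ) < (n + i - j : ℤ) * (i + j + 1 : ℤ) := by
      refine mul_pos ?_ ?_ <;> omega
    exact h1.ne' (by exact_mod_cast h0)
  have hRe : ∀ x, h x = (-n : ℂ) • x → (f ^ n) ((e ^ n) x) = aeval Ω R x := fun x hx =>
    pow_pow_eq_aeval he hΩe hΩh hfe n hx
  have hRf : ∀ x, h x = (n : ℂ) • x → (e ^ n) ((f ^ n) x) = aeval Ω R x := fun x hx => by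
    rw [pow_pow_eq_aeval (ρ := fun w => ρ (-w)) hf hΩf hΩh hef2 n hx]
    simp only [hR, neg_add, neg_mul, neg_neg]
  have hPe : ∀ x, h x = (n : ℂ) • x → ∀ k, (e ^ k) x = 0 → aeval Ω (P k) x = 0 := by
    intro x hx k hk
    rw [← pow_pow_eq_aeval he hΩe hΩh hfe k hx, hk, map_zero]
  have hPf : ∀ x, h x = (-n : ℂ) • x → ∀ k, (f ^ k) x = 0 → aeval Ω (P k) x = 0 := by
    intro x hx k hk
    have := pow_pow_eq_aeval (ρ := fun w => ρ (-w)) hf hΩf hΩh hef2 k hx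
    simp only [neg_add, neg_mul, neg_neg] at this
    rw [← this, hk, map_zero]
  refine ⟨fun x hx => ?_, fun x hx y hy hxy => ?_, fun y hy => ?_⟩
  · refine (weight_pow he hx n).trans ?_
    congr 1
    ring
  · have hz : h (x - y) = (-n : ℂ) • (x - y) := by
      rw [map_sub, smul_sub, hx, hy]
    obtain ⟨k, hk⟩ := hnf (x - y)
    obtain ⟨a, b, hab⟩ := hcop k
    have h1 := congrArg (fun T => aeval Ω T (x - y)) hab
    have h2 : aeval Ω R (x - y) = 0 := by
      rw [← hRe _ hz, map_sub, hxy, sub_self, map_zero]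
    simp only [map_add, map_mul, LinearMap.add_apply, Module.End.mul_apply, hPf _ hz k hk, h2,
      map_zero, map_one, Module.End.one_apply, add_zero] at h1
    exact sub_eq_zero.mp h1.symm
  · obtain ⟨k, hk⟩ := hne y
    obtain ⟨a, b, hab⟩ := hcop k
    have h1 := congrArg (fun T => aeval Ω T y) hab
    rw [mul_comm b] at h1
    simp only [map_add, map_mul, LinearMap.add_apply, Module.End.mul_apply, hPe _ hy k hk,
      map_zero, map_one, Module.End.one_apply, zero_add] at h1
    have hb : h (aeval Ω b y) = (n : ℂ) • aeval Ω b y := by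
      rw [← map_smul, ← show h y = (n : ℂ) • y from hy]
      exact (LinearMap.congr_fun (commute_aeval hΩh b).eq y).symm
    refine ⟨(f ^ n) (aeval Ω b y), ?_, ?_⟩
    · refine (weight_pow hf hb n).trans ?_
      congr 1
      ring
    · rw [hRf _ hb, h1]

/-- A condition for local nilpotency to be inherited along an operator `u`. -/
theorem pow_succ_apply_eq_zero {T u w : Module.End ℂ E} (hu : T * u = u * T + w)
    (hw : T * w = w * T) {x : E} {k : ℕ} (hx : (T ^ k) x = 0) : (T ^ (k + 1)) (u x) = 0 := by
  have key : ∀ j : ℕ, T ^ (j + 1) * u = u * T ^ (j + 1) + (j + 1 : ℂ) • (w * T ^ j) := by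
    intro j
    induction j with
    | zero => simpa using hu
    | succ j ih =>
      rw [pow_succ' T (j + 1), mul_assoc, ih, mul_add, ← mul_assoc, hu, mul_smul_comm, ← mul_assoc,
        hw, add_mul, mul_assoc, mul_assoc w T, ← pow_succ', ← pow_succ']
      push_cast
      module
  have := LinearMap.congr_fun (key k) x
  simpa [pow_succ', hx] using this

end Sl2

/-! ### Gradings of operators -/

section Weight

variable {ι E : Type*} [AddCommGroup E] [Module ℂ E]

/-- The operator `A` raises the eigenvalues of `h` by `r`. -/
def HasWeight (h A : Module.End ℂ E) (r : ℂ) : Prop := h * A - A * h = r • A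

namespace HasWeight

variable {h A B : Module.End ℂ E} {r s : ℂ}

theorem eq (hA : HasWeight h A r) : h * A = A * h + r • A := eq_add_of_sub_eq' hA

theorem mul (hA : HasWeight h A r) (hB : HasWeight h B s) : HasWeight h (A * B) (r + s) := by
  unfold HasWeight
  rw [← mul_assoc, hA.eq, add_mul, mul_assoc A h, hB.eq]
  simp only [mul_add, smul_mul_assoc, mul_smul_comm, mul_assoc]
  module

theorem smul (hA : HasWeight h A r) (t : ℂ) : HasWeight h (t • A) r := by
  unfold HasWeight
  rw [mul_smul_comm, hA.eq, smul_mul_assoc]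
  module

theorem add (hA : HasWeight h A r) (hB : HasWeight h B r) : HasWeight h (A + B) r := by
  unfold HasWeight
  rw [mul_add, hA.eq, hB.eq, add_mul]
  module

theorem zero : HasWeight h 0 r := by simp [HasWeight]

theorem sum {s : Finset ι} {T : ι → Module.End ℂ E} (hT : ∀ i ∈ s, HasWeight h (T i) r) :
    HasWeight h (∑ i ∈ s, T i) r :=
  Finset.sum_induction _ (fun A => HasWeight h A r) (fun _ _ => add) zero hT

theorem opSum {T : ι → Module.End ℂ E} {S : Module.End ℂ E} (hS : HasOpSum T S)
    (hT : ∀ i, HasWeight h (T i) r) : HasWeight h S r := by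
  unfold HasWeight
  have h1 := (hS.mul_left h).eq_of_forall_eq ((hS.mul_right h).add (hS.smul r)) fun i => (hT i).eq
  rw [h1, add_sub_cancel_left]

theorem of_commute (hA : Commute h A) : HasWeight h A 0 := by
  simp [HasWeight, hA.eq]

theorem commute (hA : HasWeight h A 0) : Commute h A :=
  sub_eq_zero.mp (hA.trans (zero_smul ℂ A))

theorem congr (hA : HasWeight h A r) (hrs : r = s) : HasWeight h A s := hrs ▸ hA

theorem apply (hA : HasWeight h A r) {x : E} {t : ℂ} (hx : h x = t • x) :
    h (A x) = (r + t) • A x := by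
  have := LinearMap.congr_fun hA.eq x
  simp only [Module.End.mul_apply, LinearMap.add_apply, LinearMap.smul_apply, hx, map_smul] at this
  rw [this]
  module

end HasWeight

end Weight

/-! ### Representations of the oscillator algebra -/

/-- A representation of the matter and ghost oscillators that is generated by a vacuum, together with
the operators that are built from the oscillators.
* `cc`, `bb` and `aa` are the modes of `c`, `b` and `α`. The ghost zero modes `c0`, `b0` are separate,
  and `cc 0 = bb 0 = 0`, so that sums over nonzero modes become sums over all integers.
* `L n` is the matter Virasoro operator; only its values at `n ≠ 0` are specified.
* `gh` is the ghost number, and `lev` the level, with its matter and ghost parts.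
* `Qt` is `Q̃`, the sum of `QMatter = ∑ c_n L_{-n}` and the cubic `QGhost`.
* The constants are `α_0^μ = κ^μ` and `L_0 = r + level`; `sum_κ` expresses that the intercept
  is one. -/
structure OscillatorRep (E : Type*) [AddCommGroup E] [Module ℂ E] where
  cc : ℤ → Module.End ℂ E
  bb : ℤ → Module.End ℂ E
  aa : Fin 26 → ℤ → Module.End ℂ E
  c0 : Module.End ℂ E
  b0 : Module.End ℂ E
  L : ℤ → Module.End ℂ E
  M : Module.End ℂ E
  gh : Module.End ℂ E
  lev : Module.End ℂ E
  Qt : Module.End ℂ E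
  κ : Fin 26 → ℂ
  r : ℂ
  vac : E
  cc_zero : cc 0 = 0
  bb_zero : bb 0 = 0
  cc_cc' : ∀ m n, cc m * cc n + cc n * cc m = 0
  bb_bb' : ∀ m n, bb m * bb n + bb n * bb m = 0
  bb_cc : ∀ m n, bb m * cc n + cc n * bb m = if m + n = 0 ∧ m ≠ 0 then 1 else 0
  c0_cc' : ∀ m, c0 * cc m + cc m * c0 = 0
  c0_bb' : ∀ m, c0 * bb m + bb m * c0 = 0
  b0_cc' : ∀ m, b0 * cc m + cc m * b0 = 0
  b0_bb' : ∀ m, b0 * bb m + bb m * b0 = 0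
  b0_c0 : b0 * c0 + c0 * b0 = 1
  c0_c0 : c0 * c0 = 0
  aa_aa : ∀ μ ν m n, aa μ m * aa ν n =
    aa ν n * aa μ m + (if m + n = 0 ∧ μ = ν then (m : ℂ) * eta μ else 0) • 1
  aa_zero : ∀ μ, aa μ 0 = κ μ • 1
  sum_κ : ∑ μ, (eta μ : ℂ) * κ μ ^ 2 = 2 * (r + 1)
  aa_cc : ∀ μ m n, Commute (aa μ m) (cc n)
  aa_bb : ∀ μ m n, Commute (aa μ m) (bb n)
  aa_c0 : ∀ μ m, Commute (aa μ m) c0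
  aa_b0 : ∀ μ m, Commute (aa μ m) b0
  aa_vac : ∀ μ m, 0 < m → aa μ m vac = 0
  cc_vac : ∀ m, 0 < m → cc m vac = 0
  bb_vac : ∀ m, 0 < m → bb m vac = 0
  induction : ∀ P : E → Prop, P vac → (∀ x y, P x → P y → P (x + y)) →
    (∀ (t : ℂ) x, P x → P (t • x)) → (∀ μ m, m < 0 → ∀ x, P x → P (aa μ m x)) →
    (∀ m, m < 0 → ∀ x, P x → P (bb m x)) → (∀ m, m < 0 → ∀ x, P x → P (cc m x)) →
    (∀ x, P x → P (c0 x)) → ∀ x, P x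
  hasOpSum_L : ∀ n, n ≠ 0 →
    HasOpSum (fun k => (1 / 2 : ℂ) • ∑ μ, (eta μ : ℂ) • (aa μ k * aa μ (n - k))) (L n)
  hasOpSum_M : HasOpSum (fun k : ℤ => if 0 < k then (-2 * k : ℂ) • (cc (-k) * cc k) else 0) M
  hasOpSum_gh : HasOpSum (fun k : ℤ => if 0 < k then
    (1 : ℂ) • (cc (-k) * bb k) + (-1 : ℂ) • (bb (-k) * cc k) else 0) gh
  levMatter : Module.End ℂ E
  levGhost : Module.End ℂ E
  lev_eq : lev = levMatter + levGhost
  hasOpSum_levMatter :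
    HasOpSum (fun k : ℤ => if 0 < k then ∑ μ, (eta μ : ℂ) • (aa μ (-k) * aa μ k) else 0) levMatter
  hasOpSum_levGhost : HasOpSum (fun k : ℤ => if 0 < k then
    (k : ℂ) • (cc (-k) * bb k) + (k : ℂ) • (bb (-k) * cc k) else 0) levGhost
  QMatter : Module.End ℂ E
  QGhost : Module.End ℂ E
  Qt_eq : Qt = QMatter + QGhost
  hasOpSum_QMatter : HasOpSum (fun n => cc n * L (-n)) QMatter
  hasOpSum_QGhost : HasOpSum (fun kl : ℤ × ℤ => (1 / 2 * (kl.1 - kl.2) : ℂ) •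
    (cc kl.1 * cc kl.2 * bb (-(kl.1 + kl.2)))) QGhost

namespace OscillatorRep

variable {E : Type*} [AddCommGroup E] [Module ℂ E] (F : OscillatorRep E)

theorem eta_mul_eta (μ : Fin 26) : (eta μ : ℂ) * eta μ = 1 := by
  unfold eta
  split_ifs <;> simp

theorem apply_of_anticommute {A B : Module.End ℂ E} (h : A * B = -(B * A)) {x : E} (hx : A x = 0) :
    A (B x) = 0 := by
  have := LinearMap.congr_fun h x
  simpa [hx] using this

theorem apply_of_commute {A B : Module.End ℂ E} (h : Commute A B) {x : E} (hx : A x = 0) :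
    A (B x) = 0 := by
  have := LinearMap.congr_fun h.eq x
  simpa [hx] using this

theorem cc_cc (m n : ℤ) : F.cc m * F.cc n = -(F.cc n * F.cc m) :=
  eq_neg_of_add_eq_zero_left (F.cc_cc' m n)

theorem bb_bb (m n : ℤ) : F.bb m * F.bb n = -(F.bb n * F.bb m) :=
  eq_neg_of_add_eq_zero_left (F.bb_bb' m n)

theorem c0_cc (m : ℤ) : F.c0 * F.cc m = -(F.cc m * F.c0) :=
  eq_neg_of_add_eq_zero_left (F.c0_cc' m)

theorem c0_bb (m : ℤ) : F.c0 * F.bb m = -(F.bb m * F.c0) :=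
  eq_neg_of_add_eq_zero_left (F.c0_bb' m)

theorem b0_cc (m : ℤ) : F.b0 * F.cc m = -(F.cc m * F.b0) :=
  eq_neg_of_add_eq_zero_left (F.b0_cc' m)

theorem b0_bb (m : ℤ) : F.b0 * F.bb m = -(F.bb m * F.b0) :=
  eq_neg_of_add_eq_zero_left (F.b0_bb' m)

theorem bb_cc_eq (m n : ℤ) :
    F.bb m * F.cc n = -(F.cc n * F.bb m) + (if m + n = 0 ∧ m ≠ 0 then (1 : ℂ) else 0) • 1 := by
  rw [← sub_eq_iff_eq_add', sub_neg_eq_add, bb_cc]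
  split_ifs <;> simp

theorem bb_cc_of_ne {m n : ℤ} (h : m + n ≠ 0) : F.bb m * F.cc n = -(F.cc n * F.bb m) := by
  simp [bb_cc_eq, h]

theorem aa_commute {μ ν : Fin 26} {m n : ℤ} (h : m + n ≠ 0) : Commute (F.aa μ m) (F.aa ν n) := by
  have := F.aa_aa μ ν m n
  rwa [if_neg fun hc => h hc.1, zero_smul, add_zero] at this

/-- An operator that commutes with the oscillators and annihilates the vacuum vanishes. -/
theorem eq_zero_of_commute {T : Module.End ℂ E} (hvac : T F.vac = 0)
    (ha : ∀ μ m, Commute T (F.aa μ m)) (hb : ∀ m, Commute T (F.bb m)) (hc : ∀ m, Commute T (F.cc m))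
    (hc0 : Commute T F.c0) : T = 0 := by
  have key : ∀ {A : Module.End ℂ E}, Commute T A → ∀ x, T x = 0 → T (A x) = 0 :=
    fun h _ hx => apply_of_commute h hx
  exact LinearMap.ext <| F.induction (fun x => T x = 0) hvac (fun x y hx hy => by simp [hx, hy])
    (fun t x hx => by simp [hx]) (fun μ m _ => key (ha μ m)) (fun m _ => key (hb m))
    (fun m _ => key (hc m)) (key hc0)

/-- On every state all sufficiently high modes vanish. -/
theorem eventually_zero (x : E) : ∃ K : ℤ, ∀ n, K < n →
    F.cc n x = 0 ∧ F.bb n x = 0 ∧ ∀ μ, F.aa μ n x = 0 := by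
  refine F.induction (fun x => ∃ K : ℤ, ∀ n, K < n →
    F.cc n x = 0 ∧ F.bb n x = 0 ∧ ∀ μ, F.aa μ n x = 0) ?_ ?_ ?_ ?_ ?_ ?_ ?_ x
  · exact ⟨0, fun n hn => ⟨F.cc_vac n hn, F.bb_vac n hn, fun μ => F.aa_vac μ n hn⟩⟩
  · rintro x y ⟨K, hK⟩ ⟨J, hJ⟩
    refine ⟨max K J, fun n hn => ?_⟩
    obtain ⟨h1, h2, h3⟩ := hK n (by omega)
    obtain ⟨h4, h5, h6⟩ := hJ n (by omega)
    simp [h1, h2, h3, h4, h5, h6]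
  · rintro t x ⟨K, hK⟩
    refine ⟨K, fun n hn => ?_⟩
    obtain ⟨h1, h2, h3⟩ := hK n hn
    simp [h1, h2, h3]
  · rintro μ m hm x ⟨K, hK⟩
    refine ⟨max K (-m), fun n hn => ?_⟩
    obtain ⟨h1, h2, h3⟩ := hK n (by omega)
    exact ⟨apply_of_commute (F.aa_cc _ _ _).symm h1, apply_of_commute (F.aa_bb _ _ _).symm h2,
      fun ν => apply_of_commute (F.aa_commute (by omega)) (h3 ν)⟩
  · rintro m hm x ⟨K, hK⟩
    refine ⟨max K (-m), fun n hn => ?_⟩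
    obtain ⟨h1, h2, h3⟩ := hK n (by omega)
    refine ⟨apply_of_anticommute ?_ h1, apply_of_anticommute (F.bb_bb _ _) h2,
      fun ν => apply_of_commute (F.aa_bb _ _ _) (h3 ν)⟩
    rw [F.bb_cc_of_ne (by omega), neg_neg]
  · rintro m hm x ⟨K, hK⟩
    refine ⟨max K (-m), fun n hn => ?_⟩
    obtain ⟨h1, h2, h3⟩ := hK n (by omega)
    exact ⟨apply_of_anticommute (F.cc_cc _ _) h1,
      apply_of_anticommute (F.bb_cc_of_ne (by omega)) h2,
      fun ν => apply_of_commute (F.aa_cc _ _ _) (h3 ν)⟩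
  · rintro x ⟨K, hK⟩
    refine ⟨K, fun n hn => ?_⟩
    obtain ⟨h1, h2, h3⟩ := hK n hn
    refine ⟨apply_of_anticommute ?_ h1, apply_of_anticommute ?_ h2,
      fun ν => apply_of_commute (F.aa_c0 _ _) (h3 ν)⟩
    · rw [c0_cc, neg_neg]
    · rw [c0_bb, neg_neg]

/-! ### Bilinear operators in the ghosts -/

/-- Commutators of a product of two odd operators. -/
theorem odd_mul_commutator {R : Type*} [Ring R] (A B C : R) :
    A * B * C - C * (A * B) = A * (B * C + C * B) - (A * C + C * A) * B := by
  noncomm_ring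

theorem cc_bb (m n : ℤ) :
    F.cc m * F.bb n + F.bb n * F.cc m = if n + m = 0 ∧ n ≠ 0 then 1 else 0 := by
  rw [add_comm, bb_cc]

section Bilinear

variable {F} {S : Module.End ℂ E} {u v : ℤ → ℂ}

/-- The operator `∑_{k>0} (u_k c_{-k} b_k + v_k b_{-k} c_k)` is a weighted count of excitations. -/
theorem number_cc (h : HasOpSum (fun k : ℤ => if 0 < k then
    u k • (F.cc (-k) * F.bb k) + v k • (F.bb (-k) * F.cc k) else 0) S) (k : ℤ) :
    HasWeight S (F.cc k) (if k < 0 then u (-k) else -v k) := by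
  by_cases hk : k = 0
  · rw [hk, F.cc_zero]
    exact HasWeight.zero
  have key : ∀ i, (u i • (F.cc (-i) * F.bb i) + v i • (F.bb (-i) * F.cc i)) * F.cc k
      - F.cc k * (u i • (F.cc (-i) * F.bb i) + v i • (F.bb (-i) * F.cc i)) =
      u i • (F.cc (-i) * if i + k = 0 ∧ i ≠ 0 then 1 else 0)
        - v i • ((if -i + k = 0 ∧ -i ≠ 0 then 1 else 0) * F.cc i) := by
    intro i
    have h1 := odd_mul_commutator (F.cc (-i)) (F.bb i) (F.cc k)
    have h2 := odd_mul_commutator (F.bb (-i)) (F.cc i) (F.cc k)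
    rw [F.bb_cc, F.cc_cc', zero_mul, sub_zero] at h1
    rw [F.bb_cc, F.cc_cc', mul_zero, zero_sub] at h2
    rw [← neg_eq_iff_eq_neg] at h2
    rw [← h1, ← h2]
    simp only [add_mul, mul_add, smul_mul_assoc, mul_smul_comm]
    module
  refine (HasOpSum.commutator_eq hk h fun i hi hik hik' => ?_).trans ?_
  · rw [key, if_neg, if_neg] <;> first | (rintro ⟨h1, h2⟩; omega) | simp
  · rw [key]
    rcases lt_or_gt_of_ne hk with h0 | h0
    · rw [abs_of_neg h0, if_pos (by omega), if_neg (by omega), if_pos h0]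
      simp
    · rw [abs_of_pos h0, if_neg (by omega), if_pos (by omega), if_neg (by omega)]
      simp

theorem number_bb (h : HasOpSum (fun k : ℤ => if 0 < k then
    u k • (F.cc (-k) * F.bb k) + v k • (F.bb (-k) * F.cc k) else 0) S) (k : ℤ) :
    HasWeight S (F.bb k) (if k < 0 then v (-k) else -u k) := by
  by_cases hk : k = 0
  · rw [hk, F.bb_zero]
    exact HasWeight.zero
  have key : ∀ i, (u i • (F.cc (-i) * F.bb i) + v i • (F.bb (-i) * F.cc i)) * F.bb k
      - F.bb k * (u i • (F.cc (-i) * F.bb i) + v i • (F.bb (-i) * F.cc i)) =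
      v i • (F.bb (-i) * if k + i = 0 ∧ k ≠ 0 then 1 else 0)
        - u i • ((if k + -i = 0 ∧ k ≠ 0 then 1 else 0) * F.bb i) := by
    intro i
    have h1 := odd_mul_commutator (F.cc (-i)) (F.bb i) (F.bb k)
    have h2 := odd_mul_commutator (F.bb (-i)) (F.cc i) (F.bb k)
    rw [F.cc_bb, F.bb_bb', mul_zero, zero_sub] at h1
    rw [F.cc_bb, F.bb_bb', zero_mul, sub_zero] at h2
    rw [← neg_eq_iff_eq_neg] at h1
    rw [← h2, ← h1]
    simp only [add_mul, mul_add, smul_mul_assoc, mul_smul_comm]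
    module
  refine (HasOpSum.commutator_eq hk h fun i hi hik hik' => ?_).trans ?_
  · rw [key, if_neg, if_neg] <;> first | (rintro ⟨h1, h2⟩; omega) | simp
  · rw [key]
    rcases lt_or_gt_of_ne hk with h0 | h0
    · rw [abs_of_neg h0, if_pos (by omega), if_neg (by omega), if_pos h0]
      simp
    · rw [abs_of_pos h0, if_neg (by omega), if_pos (by omega), if_neg (by omega)]
      simp

theorem ccSum_bb (h : HasOpSum (fun k : ℤ => if 0 < k then u k • (F.cc (-k) * F.cc k) else 0) S)
    (k : ℤ) : S * F.bb k - F.bb k * S = (if k < 0 then u (-k) else -u k) • F.cc k := by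
  by_cases hk : k = 0
  · simp [hk, F.bb_zero, F.cc_zero]
  have key : ∀ i, (u i • (F.cc (-i) * F.cc i)) * F.bb k - F.bb k * (u i • (F.cc (-i) * F.cc i)) =
      u i • (F.cc (-i) * (if k + i = 0 ∧ k ≠ 0 then 1 else 0)
        - (if k + -i = 0 ∧ k ≠ 0 then 1 else 0) * F.cc i) := by
    intro i
    have h1 := odd_mul_commutator (F.cc (-i)) (F.cc i) (F.bb k)
    rw [F.cc_bb, F.cc_bb] at h1
    rw [← h1, smul_mul_assoc, mul_smul_comm, smul_sub]
  refine (HasOpSum.commutator_eq hk h fun i hi hik hik' => ?_).trans ?_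
  · rw [key, if_neg, if_neg] <;> first | (rintro ⟨h1, h2⟩; omega) | simp
  · rw [key]
    rcases lt_or_gt_of_ne hk with h0 | h0
    · rw [abs_of_neg h0, if_pos (by omega), if_neg (by omega), if_pos h0]
      simp
    · rw [abs_of_pos h0, if_neg (by omega), if_pos (by omega), if_neg (by omega)]
      simp

theorem bbSum_cc (h : HasOpSum (fun k : ℤ => if 0 < k then u k • (F.bb (-k) * F.bb k) else 0) S)
    (k : ℤ) : S * F.cc k - F.cc k * S = (if k < 0 then u (-k) else -u k) • F.bb k := by
  by_cases hk : k = 0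
  · simp [hk, F.bb_zero, F.cc_zero]
  have key : ∀ i, (u i • (F.bb (-i) * F.bb i)) * F.cc k - F.cc k * (u i • (F.bb (-i) * F.bb i)) =
      u i • (F.bb (-i) * (if i + k = 0 ∧ i ≠ 0 then 1 else 0)
        - (if -i + k = 0 ∧ -i ≠ 0 then 1 else 0) * F.bb i) := by
    intro i
    have h1 := odd_mul_commutator (F.bb (-i)) (F.bb i) (F.cc k)
    rw [F.bb_cc, F.bb_cc] at h1
    rw [← h1, smul_mul_assoc, mul_smul_comm, smul_sub]
  refine (HasOpSum.commutator_eq hk h fun i hi hik hik' => ?_).trans ?_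
  · rw [key, if_neg, if_neg] <;> first | (rintro ⟨h1, h2⟩; omega) | simp
  · rw [key]
    rcases lt_or_gt_of_ne hk with h0 | h0
    · rw [abs_of_neg h0, if_pos (by omega), if_neg (by omega), if_pos h0]
      simp
    · rw [abs_of_pos h0, if_neg (by omega), if_pos (by omega), if_neg (by omega)]
      simp

end Bilinear

/-- A product of two operators that anticommute with `A` commutes with `A`. -/
theorem commute_mul_of_anticommute {R : Type*} [Ring R] {A B C : R} (h : A * C = -(C * A))
    (h' : B * C = -(C * B)) : Commute (A * B) C := by
  unfold Commute SemiconjBy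
  rw [mul_assoc, h', mul_neg, ← mul_assoc, h, neg_mul, neg_neg, mul_assoc]

theorem commute_of_hasOpSum_ite {T : ℤ → Module.End ℂ E} {S A : Module.End ℂ E}
    (h : HasOpSum (fun k => if 0 < k then T k else 0) S) (hT : ∀ k, Commute (T k) A) :
    Commute S A :=
  h.commute fun k => by
    split_ifs
    · exact hT k
    · exact Commute.zero_left A

theorem M_cc (k : ℤ) : Commute F.M (F.cc k) :=
  commute_of_hasOpSum_ite F.hasOpSum_M fun _ =>
    (commute_mul_of_anticommute (F.cc_cc _ _) (F.cc_cc _ _)).smul_left _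

theorem M_aa (μ : Fin 26) (m : ℤ) : Commute F.M (F.aa μ m) :=
  commute_of_hasOpSum_ite F.hasOpSum_M fun _ =>
    ((F.aa_cc _ _ _).symm.mul_left (F.aa_cc _ _ _).symm).smul_left _

theorem M_c0 : Commute F.M F.c0 :=
  commute_of_hasOpSum_ite F.hasOpSum_M fun i => (commute_mul_of_anticommute
    (by rw [c0_cc, neg_neg]) (by rw [c0_cc, neg_neg])).smul_left _

theorem M_b0 : Commute F.M F.b0 :=
  commute_of_hasOpSum_ite F.hasOpSum_M fun i => (commute_mul_of_anticommute
    (by rw [b0_cc, neg_neg]) (by rw [b0_cc, neg_neg])).smul_left _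

theorem M_bb (k : ℤ) : F.M * F.bb k - F.bb k * F.M = (2 * k : ℂ) • F.cc k := by
  rw [ccSum_bb (u := fun k => -2 * k) F.hasOpSum_M]
  congr 1
  split_ifs <;> push_cast <;> ring

theorem gh_cc (k : ℤ) : HasWeight F.gh (F.cc k) 1 :=
  (number_cc (u := fun _ => 1) (v := fun _ => -1) F.hasOpSum_gh k).congr (by split_ifs <;> simp)

theorem gh_bb (k : ℤ) : HasWeight F.gh (F.bb k) (-1) :=
  (number_bb (u := fun _ => 1) (v := fun _ => -1) F.hasOpSum_gh k).congr (by split_ifs <;> simp)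

theorem gh_aa (μ : Fin 26) (m : ℤ) : Commute F.gh (F.aa μ m) :=
  commute_of_hasOpSum_ite F.hasOpSum_gh fun _ =>
    (((F.aa_cc _ _ _).symm.mul_left (F.aa_bb _ _ _).symm).smul_left _).add_left
      (((F.aa_bb _ _ _).symm.mul_left (F.aa_cc _ _ _).symm).smul_left _)

theorem number_c0 {S : Module.End ℂ E} {u v : ℤ → ℂ} (h : HasOpSum (fun k : ℤ => if 0 < k then
    u k • (F.cc (-k) * F.bb k) + v k • (F.bb (-k) * F.cc k) else 0) S) : Commute S F.c0 :=
  commute_of_hasOpSum_ite h fun i =>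
    ((commute_mul_of_anticommute (by rw [c0_cc, neg_neg]) (by rw [c0_bb, neg_neg])).smul_left
      _).add_left
    ((commute_mul_of_anticommute (by rw [c0_bb, neg_neg]) (by rw [c0_cc, neg_neg])).smul_left _)

theorem number_b0 {S : Module.End ℂ E} {u v : ℤ → ℂ} (h : HasOpSum (fun k : ℤ => if 0 < k then
    u k • (F.cc (-k) * F.bb k) + v k • (F.bb (-k) * F.cc k) else 0) S) : Commute S F.b0 :=
  commute_of_hasOpSum_ite h fun i =>
    ((commute_mul_of_anticommute (by rw [b0_cc, neg_neg]) (by rw [b0_bb, neg_neg])).smul_left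
      _).add_left
    ((commute_mul_of_anticommute (by rw [b0_bb, neg_neg]) (by rw [b0_cc, neg_neg])).smul_left _)

theorem gh_c0 : Commute F.gh F.c0 :=
  F.number_c0 (u := fun _ => 1) (v := fun _ => -1) F.hasOpSum_gh

theorem gh_b0 : Commute F.gh F.b0 :=
  F.number_b0 (u := fun _ => 1) (v := fun _ => -1) F.hasOpSum_gh

theorem gh_M : HasWeight F.gh F.M 2 :=
  HasWeight.opSum F.hasOpSum_M fun k => by
    split_ifs
    · exact (((F.gh_cc _).mul (F.gh_cc _)).smul _).congr (by norm_num)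
    · exact HasWeight.zero

theorem levMatter_aa (ν : Fin 26) (m : ℤ) : HasWeight F.levMatter (F.aa ν m) (-m) := by
  by_cases hm : m = 0
  · rw [hm, F.aa_zero]
    exact (HasWeight.of_commute ((Commute.one_right _).smul_right _)).congr (by simp)
  have key : ∀ i, (∑ μ, (eta μ : ℂ) • (F.aa μ (-i) * F.aa μ i)) * F.aa ν m
      - F.aa ν m * (∑ μ, (eta μ : ℂ) • (F.aa μ (-i) * F.aa μ i)) =
      (if i + m = 0 then (i : ℂ) else 0) • F.aa ν (-i)
        + (if -i + m = 0 then (-i : ℂ) else 0) • F.aa ν i := by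
    intro i
    rw [Finset.sum_mul, Finset.mul_sum, ← Finset.sum_sub_distrib, Finset.sum_eq_single ν]
    · rw [smul_mul_assoc, mul_smul_comm, mul_assoc, F.aa_aa ν ν i m, mul_add, ← mul_assoc,
        F.aa_aa ν ν (-i) m, add_mul, ← mul_assoc]
      simp only [and_true, mul_smul_comm, smul_mul_assoc, one_mul, mul_one]
      split_ifs <;> push_cast <;> simp only [smul_add, smul_smul, mul_left_comm _ (i : ℂ),
        mul_neg, neg_mul, eta_mul_eta, mul_zero] <;> module
    · intro μ _ hμ
      have h1 : ∀ j, Commute (F.aa μ j) (F.aa ν m) := fun j => by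
        have := F.aa_aa μ ν j m
        rwa [if_neg fun hc => hμ hc.2, zero_smul, add_zero] at this
      rw [smul_mul_assoc, mul_smul_comm, ((h1 (-i)).mul_left (h1 i)).eq, sub_self]
    · simp
  refine (HasOpSum.commutator_eq hm F.hasOpSum_levMatter fun i hi hik hik' => ?_).trans ?_
  · rw [key, if_neg (by omega), if_neg (by omega), zero_smul, zero_smul, add_zero]
  · rw [key]
    rcases lt_or_gt_of_ne hm with h0 | h0
    · rw [abs_of_neg h0, if_pos (by omega), if_neg (by omega)]
      simp
    · rw [abs_of_pos h0, if_neg (by omega), if_pos (by omega)]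
      simp

theorem levMatter_commute {A : Module.End ℂ E} (hA : ∀ μ m, Commute (F.aa μ m) A) :
    Commute F.levMatter A :=
  commute_of_hasOpSum_ite F.hasOpSum_levMatter fun _ =>
    Commute.sum_left _ _ _ fun μ _ => ((hA μ _).mul_left (hA μ _)).smul_left _

theorem lev_add_weight {A : Module.End ℂ E} {s t : ℂ} (h : HasWeight F.levMatter A s)
    (h' : HasWeight F.levGhost A t) : HasWeight F.lev A (s + t) := by
  unfold HasWeight at *
  rw [F.lev_eq, add_mul, mul_add, add_sub_add_comm, h, h', add_smul]

theorem lev_aa (μ : Fin 26) (m : ℤ) : HasWeight F.lev (F.aa μ m) (-m) :=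
  (F.lev_add_weight (F.levMatter_aa μ m) (.of_commute <|
    commute_of_hasOpSum_ite F.hasOpSum_levGhost fun _ =>
    (((F.aa_cc _ _ _).symm.mul_left (F.aa_bb _ _ _).symm).smul_left _).add_left
      (((F.aa_bb _ _ _).symm.mul_left (F.aa_cc _ _ _).symm).smul_left _))).congr (add_zero _)

theorem lev_cc (k : ℤ) : HasWeight F.lev (F.cc k) (-k) :=
  (F.lev_add_weight (.of_commute (F.levMatter_commute fun μ m => F.aa_cc μ m k))
    (number_cc (u := fun k => k) (v := fun k => k) F.hasOpSum_levGhost k)).congr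
      (by split_ifs <;> simp)

theorem lev_bb (k : ℤ) : HasWeight F.lev (F.bb k) (-k) :=
  (F.lev_add_weight (.of_commute (F.levMatter_commute fun μ m => F.aa_bb μ m k))
    (number_bb (u := fun k => k) (v := fun k => k) F.hasOpSum_levGhost k)).congr
      (by split_ifs <;> simp)

theorem lev_c0 : Commute F.lev F.c0 := by
  rw [F.lev_eq]
  exact (F.levMatter_commute F.aa_c0).add_left
    (F.number_c0 (u := fun k => k) (v := fun k => k) F.hasOpSum_levGhost)

theorem lev_M : Commute F.lev F.M :=
  (HasWeight.opSum F.hasOpSum_M fun k => by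
    split_ifs
    · exact (((F.lev_cc _).mul (F.lev_cc _)).smul _).congr (by push_cast; ring)
    · exact HasWeight.zero).commute

theorem lev_gh : Commute F.lev F.gh :=
  (HasWeight.opSum F.hasOpSum_gh fun k => by
    split_ifs
    · exact ((((F.lev_cc _).mul (F.lev_bb _)).smul _).congr (by push_cast; ring)).add
        ((((F.lev_bb _).mul (F.lev_cc _)).smul _).congr (by push_cast; ring))
    · exact HasWeight.zero).commute

theorem apply_eq_zero_of_hasOpSum_ite {T : ℤ → Module.End ℂ E} {S : Module.End ℂ E}
    (h : HasOpSum (fun k => if 0 < k then T k else 0) S) {x : E} (hT : ∀ k, 0 < k → T k x = 0) :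
    S x = 0 :=
  h.apply_eq_zero fun k => by
    split_ifs with hk
    · exact hT k hk
    · rfl

theorem M_vac : F.M F.vac = 0 :=
  apply_eq_zero_of_hasOpSum_ite F.hasOpSum_M fun k hk => by simp [F.cc_vac k hk]

theorem gh_vac : F.gh F.vac = 0 :=
  apply_eq_zero_of_hasOpSum_ite F.hasOpSum_gh fun k hk => by simp [F.cc_vac k hk, F.bb_vac k hk]

theorem lev_vac : F.lev F.vac = 0 := by
  rw [F.lev_eq, LinearMap.add_apply,
    apply_eq_zero_of_hasOpSum_ite F.hasOpSum_levGhost fun k hk => by simp [F.cc_vac k hk, F.bb_vac k hk],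
    apply_eq_zero_of_hasOpSum_ite F.hasOpSum_levMatter fun k hk => by
      simp [F.aa_vac _ k hk, LinearMap.sum_apply], add_zero]

/-! ### The `sl₂` triple that contains `M` -/

theorem lower_finite : PointwiseFinite fun k : ℤ =>
    if 0 < k then (-1 / (2 * k) : ℂ) • (F.bb (-k) * F.bb k) else 0 := by
  intro x
  obtain ⟨K, hK⟩ := F.eventually_zero x
  refine (Set.finite_Icc 0 K).subset fun k hk => ?_
  by_contra hc
  refine hk ?_
  simp only [Set.mem_Icc, not_and_or, not_le] at hc
  simp only
  split_ifs with h0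
  · simp [(hK k (by omega)).2.1]
  · rfl

/-- The lowering operator `-∑_{n>0} (2n)⁻¹ b_{-n} b_n`, which forms an `sl₂` triple with `M` and the
ghost number. -/
def lower : Module.End ℂ E := opSum _ F.lower_finite

theorem hasOpSum_lower : HasOpSum (fun k : ℤ =>
    if 0 < k then (-1 / (2 * k) : ℂ) • (F.bb (-k) * F.bb k) else 0) F.lower :=
  F.lower_finite.hasOpSum

/-- For `k = 0` both sides vanish, as `cc 0 = bb 0 = 0`. -/
theorem lower_cc (k : ℤ) : F.lower * F.cc k - F.cc k * F.lower = (1 / (2 * k) : ℂ) • F.bb k := by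
  rw [bbSum_cc (u := fun k => -1 / (2 * k)) F.hasOpSum_lower]
  congr 1
  split_ifs
  · push_cast
    rw [mul_neg, neg_div_neg_eq]
  · rw [neg_div, neg_neg]

theorem lower_bb (k : ℤ) : Commute F.lower (F.bb k) :=
  commute_of_hasOpSum_ite F.hasOpSum_lower fun _ =>
    (commute_mul_of_anticommute (F.bb_bb _ _) (F.bb_bb _ _)).smul_left _

theorem lower_aa (μ : Fin 26) (m : ℤ) : Commute F.lower (F.aa μ m) :=
  commute_of_hasOpSum_ite F.hasOpSum_lower fun _ =>
    ((F.aa_bb _ _ _).symm.mul_left (F.aa_bb _ _ _).symm).smul_left _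

theorem lower_c0 : Commute F.lower F.c0 :=
  commute_of_hasOpSum_ite F.hasOpSum_lower fun i => (commute_mul_of_anticommute
    (by rw [c0_bb, neg_neg]) (by rw [c0_bb, neg_neg])).smul_left _

theorem gh_lower : HasWeight F.gh F.lower (-2) :=
  HasWeight.opSum F.hasOpSum_lower fun k => by
    split_ifs
    · exact (((F.gh_bb _).mul (F.gh_bb _)).smul _).congr (by norm_num)
    · exact HasWeight.zero

theorem lower_vac : F.lower F.vac = 0 :=
  apply_eq_zero_of_hasOpSum_ite F.hasOpSum_lower fun k hk => by simp [F.bb_vac k hk]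

theorem M_lower : F.M * F.lower - F.lower * F.M = F.gh := by
  rw [← sub_eq_zero]
  refine F.eq_zero_of_commute ?_ ?_ ?_ ?_ ?_
  · simp [F.M_vac, F.lower_vac, F.gh_vac]
  · intro μ m
    exact ((((F.M_aa μ m).mul_left (F.lower_aa μ m))).sub_left
      ((F.lower_aa μ m).mul_left (F.M_aa μ m))).sub_left (F.gh_aa μ m)
  · intro k
    have h1 : F.M * F.bb k = F.bb k * F.M + (2 * k : ℂ) • F.cc k := eq_add_of_sub_eq' (F.M_bb k)
    have h2 : F.lower * F.cc k = F.cc k * F.lower + (1 / (2 * k) : ℂ) • F.bb k :=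
      eq_add_of_sub_eq' (F.lower_cc k)
    have h3 := (F.gh_bb k).eq
    have h4 : (2 * k : ℂ) • (1 / (2 * k) : ℂ) • F.bb k = F.bb k := by
      by_cases hk : k = 0
      · simp [hk, F.bb_zero]
      · rw [smul_smul, mul_one_div_cancel (by simpa using hk), one_smul]
    unfold Commute SemiconjBy
    rw [sub_mul, sub_mul, h3, mul_assoc, (F.lower_bb k).eq, ← mul_assoc, h1, mul_assoc, h1, mul_add,
      mul_smul_comm, h2, ← mul_assoc F.lower, (F.lower_bb k).eq, smul_add, h4]
    simp only [add_mul, mul_sub, smul_mul_assoc, mul_assoc]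
    module
  · intro k
    have h1 : F.M * F.bb k = F.bb k * F.M + (2 * k : ℂ) • F.cc k := eq_add_of_sub_eq' (F.M_bb k)
    have h2 : F.lower * F.cc k = F.cc k * F.lower + (1 / (2 * k) : ℂ) • F.bb k :=
      eq_add_of_sub_eq' (F.lower_cc k)
    have h3 := (F.gh_cc k).eq
    have h4 : (1 / (2 * k) : ℂ) • (2 * k : ℂ) • F.cc k = F.cc k := by
      by_cases hk : k = 0
      · simp [hk, F.cc_zero]
      · rw [smul_smul, one_div_mul_cancel (by simpa using hk), one_smul]
    unfold Commute SemiconjBy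
    rw [sub_mul, sub_mul, h3, mul_assoc, h2, mul_add, mul_smul_comm, h1, ← mul_assoc F.M,
      (F.M_cc k).eq, mul_assoc F.lower, (F.M_cc k).eq, ← mul_assoc F.lower, h2, smul_add, h4]
    simp only [add_mul, mul_sub, smul_mul_assoc, mul_assoc]
    module
  · exact ((F.M_c0.mul_left F.lower_c0).sub_left (F.lower_c0.mul_left F.M_c0)).sub_left F.gh_c0

theorem pow_eq_zero_mono {T : Module.End ℂ E} {x : E} {j k : ℕ} (hjk : j ≤ k) (h : (T ^ j) x = 0) :
    (T ^ k) x = 0 := by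
  obtain ⟨i, rfl⟩ := Nat.exists_eq_add_of_le' hjk
  rw [pow_add, Module.End.mul_apply, h, map_zero]

/-- An operator is locally nilpotent if it annihilates the vacuum and its commutators with the
creation operators commute with it. -/
theorem locally_nilpotent {T : Module.End ℂ E} (hvac : T F.vac = 0)
    (h : ∀ A, (∃ μ m, A = F.aa μ m) ∨ (∃ m, A = F.bb m) ∨ (∃ m, A = F.cc m) ∨ A = F.c0 →
      ∃ B, T * A = A * T + B ∧ T * B = B * T) (x : E) : ∃ k, (T ^ k) x = 0 := by
  have key : ∀ A, ((∃ μ m, A = F.aa μ m) ∨ (∃ m, A = F.bb m) ∨ (∃ m, A = F.cc m) ∨ A = F.c0) →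
      ∀ x, (∃ k, (T ^ k) x = 0) → ∃ k, (T ^ k) (A x) = 0 := by
    rintro A hA x ⟨k, hk⟩
    obtain ⟨B, hB, hB'⟩ := h A hA
    exact ⟨k + 1, pow_succ_apply_eq_zero hB hB' hk⟩
  refine F.induction (fun x => ∃ k, (T ^ k) x = 0) ⟨1, by simpa using hvac⟩ ?_ ?_
    (fun μ m _ => key _ (.inl ⟨μ, m, rfl⟩)) (fun m _ => key _ (.inr (.inl ⟨m, rfl⟩)))
    (fun m _ => key _ (.inr (.inr (.inl ⟨m, rfl⟩)))) (key _ (.inr (.inr (.inr rfl)))) x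
  · rintro x y ⟨j, hj⟩ ⟨k, hk⟩
    exact ⟨max j k, by
      rw [map_add, pow_eq_zero_mono (le_max_left _ _) hj, pow_eq_zero_mono (le_max_right _ _) hk,
        add_zero]⟩
  · rintro t x ⟨k, hk⟩
    exact ⟨k, by rw [map_smul, hk, smul_zero]⟩

theorem M_nilpotent (x : E) : ∃ k, (F.M ^ k) x = 0 := by
  refine F.locally_nilpotent F.M_vac ?_ x
  rintro _ (⟨μ, m, rfl⟩ | ⟨m, rfl⟩ | ⟨m, rfl⟩ | rfl)
  · exact ⟨0, by rw [(F.M_aa μ m).eq, add_zero], by simp⟩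
  · exact ⟨_, eq_add_of_sub_eq' (F.M_bb m), by rw [mul_smul_comm, (F.M_cc m).eq, smul_mul_assoc]⟩
  · exact ⟨0, by rw [(F.M_cc m).eq, add_zero], by simp⟩
  · exact ⟨0, by rw [F.M_c0.eq, add_zero], by simp⟩

theorem lower_nilpotent (x : E) : ∃ k, (F.lower ^ k) x = 0 := by
  refine F.locally_nilpotent F.lower_vac ?_ x
  rintro _ (⟨μ, m, rfl⟩ | ⟨m, rfl⟩ | ⟨m, rfl⟩ | rfl)
  · exact ⟨0, by rw [(F.lower_aa μ m).eq, add_zero], by simp⟩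
  · exact ⟨0, by rw [(F.lower_bb m).eq, add_zero], by simp⟩
  · exact ⟨_, eq_add_of_sub_eq' (F.lower_cc m), by
      rw [mul_smul_comm, (F.lower_bb m).eq, smul_mul_assoc]⟩
  · exact ⟨0, by rw [F.lower_c0.eq, add_zero], by simp⟩

end OscillatorRep

namespace OscillatorRep

variable {E : Type*} [AddCommGroup E] [Module ℂ E] (F : OscillatorRep E)

/-! ### The matter Virasoro operators -/

theorem L_commute {n : ℤ} (hn : n ≠ 0) {A : Module.End ℂ E} (hA : ∀ μ m, Commute (F.aa μ m) A) :
    Commute (F.L n) A :=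
  (F.hasOpSum_L n hn).commute fun _ =>
    (Commute.sum_left _ _ _ fun μ _ => ((hA μ _).mul_left (hA μ _)).smul_left _).smul_left _

theorem L_cc {n : ℤ} (hn : n ≠ 0) (k : ℤ) : Commute (F.L n) (F.cc k) :=
  F.L_commute hn fun μ m => F.aa_cc μ m k

theorem L_bb {n : ℤ} (hn : n ≠ 0) (k : ℤ) : Commute (F.L n) (F.bb k) :=
  F.L_commute hn fun μ m => F.aa_bb μ m k

theorem gh_L {n : ℤ} (hn : n ≠ 0) : HasWeight F.gh (F.L n) 0 :=
  .of_commute (F.L_commute hn fun μ m => (F.gh_aa μ m).symm).symm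

theorem lev_L {n : ℤ} (hn : n ≠ 0) : HasWeight F.lev (F.L n) (-n) :=
  HasWeight.opSum (F.hasOpSum_L n hn) fun k => HasWeight.smul (HasWeight.sum fun μ _ =>
    (((F.lev_aa μ k).mul (F.lev_aa μ (n - k))).smul _).congr (by push_cast; ring)) _

/-- `[L_n, α_m] = -m α_{m+n}`: only the two summands of `L_n` that contain `α_{-m}` contribute. -/
theorem L_aa {n : ℤ} (hn : n ≠ 0) (ν : Fin 26) (m : ℤ) :
    F.L n * F.aa ν m - F.aa ν m * F.L n = (-m : ℂ) • F.aa ν (m + n) := by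
  have key : ∀ k, ((1 / 2 : ℂ) • ∑ μ, (eta μ : ℂ) • (F.aa μ k * F.aa μ (n - k))) * F.aa ν m
      - F.aa ν m * ((1 / 2 : ℂ) • ∑ μ, (eta μ : ℂ) • (F.aa μ k * F.aa μ (n - k))) =
      (if k = m + n then (-(m : ℂ) / 2) • F.aa ν (m + n) else 0)
        + (if k = -m then (-(m : ℂ) / 2) • F.aa ν (m + n) else 0) := by
    intro k
    rw [smul_mul_assoc, mul_smul_comm, ← smul_sub, Finset.sum_mul, Finset.mul_sum,
      ← Finset.sum_sub_distrib, Finset.sum_eq_single ν]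
    · rw [smul_mul_assoc, mul_smul_comm, mul_assoc, F.aa_aa ν ν (n - k) m, mul_add, ← mul_assoc,
        F.aa_aa ν ν k m, add_mul, ← mul_assoc]
      simp only [and_true, mul_smul_comm, smul_mul_assoc, one_mul, mul_one]
      have e1 : (n - k + m = 0) = (k = m + n) := by
        apply propext
        constructor <;> intro h <;> omega
      have e2 : (k + m = 0) = (k = -m) := by
        apply propext
        constructor <;> intro h <;> omega
      simp only [e1, e2]
      have h1 : (if k = m + n then ((n - k : ℤ) : ℂ) * eta ν else 0) • F.aa ν k =
          (eta ν : ℂ) • if k = m + n then (-(m : ℂ)) • F.aa ν (m + n) else 0 := by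
        split_ifs with h
        · rw [h, smul_smul]
          congr 1
          push_cast
          ring
        · simp
      have h2 : (if k = -m then (k : ℂ) * eta ν else 0) • F.aa ν (n - k) =
          (eta ν : ℂ) • if k = -m then (-(m : ℂ)) • F.aa ν (m + n) else 0 := by
        split_ifs with h
        · rw [h, smul_smul, sub_neg_eq_add, add_comm n m]
          congr 1
          push_cast
          ring
        · simp
      rw [h1, h2]
      have h3 : ∀ A B D : Module.End ℂ E, (1 / 2 : ℂ) • ((eta ν : ℂ) • (A + (eta ν : ℂ) • B
          + (eta ν : ℂ) • D) - (eta ν : ℂ) • A) = (1 / 2 : ℂ) • D + (1 / 2 : ℂ) • B := by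
        intro A B D
        rw [smul_add, smul_add, smul_smul, smul_smul, eta_mul_eta]
        module
      rw [h3 (F.aa ν m * F.aa ν k * F.aa ν (n - k))]
      congr 1 <;> split_ifs <;> simp only [smul_smul, smul_zero] <;> congr 1 <;> ring
    · intro μ _ hμ
      have h1 : ∀ j, Commute (F.aa μ j) (F.aa ν m) := fun j => by
        have := F.aa_aa μ ν j m
        rwa [if_neg fun hc => hμ hc.2, zero_smul, add_zero] at this
      rw [smul_mul_assoc, mul_smul_comm, ((h1 k).mul_left (h1 (n - k))).eq, sub_self]
    · simp
  have h := (F.hasOpSum_L n hn).commutator (F.aa ν m)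
  have s1 := HasOpSum.single (T := fun k => if k = m + n then (-(m : ℂ) / 2) • F.aa ν (m + n) else 0)
    (m + n) fun k hk => if_neg hk
  have s2 := HasOpSum.single (T := fun k => if k = -m then (-(m : ℂ) / 2) • F.aa ν (m + n) else 0)
    (-m) fun k hk => if_neg hk
  rw [h.eq_of_forall_eq (s1.add s2) key, if_pos rfl, if_pos rfl]
  module

/-! ### Commutators with the reduced BRST operator -/

theorem cc_mul_L_anticommute {A : Module.End ℂ E} (hA : ∀ μ m, Commute (F.aa μ m) A)
    (hcA : ∀ m, F.cc m * A = -(A * F.cc m)) (n : ℤ) :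
    F.cc n * F.L (-n) * A = -(A * (F.cc n * F.L (-n))) := by
  by_cases hn : n = 0
  · simp [hn, F.cc_zero]
  · rw [mul_assoc, (F.L_commute (neg_ne_zero.mpr hn) hA).eq, ← mul_assoc, hcA, neg_mul, mul_assoc]

/-- Products of three odd operators are odd. -/
theorem triple_anticommute {R : Type*} [Ring R] {A B C D : R} (hA : A * D = -(D * A))
    (hB : B * D = -(D * B)) (hC : C * D = -(D * C)) : A * B * C * D = -(D * (A * B * C)) := by
  rw [mul_assoc, hC, mul_neg, ← mul_assoc, (commute_mul_of_anticommute hA hB).eq, mul_assoc]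

theorem Qt_anticommute {A : Module.End ℂ E} (hA : ∀ μ m, Commute (F.aa μ m) A)
    (hcA : ∀ m, F.cc m * A = -(A * F.cc m)) (hbA : ∀ m, F.bb m * A = -(A * F.bb m)) :
    F.Qt * A = -(A * F.Qt) := by
  rw [F.Qt_eq, add_mul, F.hasOpSum_QMatter.anticommute fun n => F.cc_mul_L_anticommute hA hcA n,
    F.hasOpSum_QGhost.anticommute fun kl => by
      rw [smul_mul_assoc, triple_anticommute (hcA _) (hcA _) (hbA _), smul_neg, mul_smul_comm],
    mul_add, neg_add]

theorem Qt_c0 : F.Qt * F.c0 = -(F.c0 * F.Qt) :=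
  F.Qt_anticommute F.aa_c0 (fun m => by rw [c0_cc, neg_neg]) fun m => by rw [c0_bb, neg_neg]

theorem Qt_b0 : F.Qt * F.b0 = -(F.b0 * F.Qt) :=
  F.Qt_anticommute F.aa_b0 (fun m => by rw [b0_cc, neg_neg]) fun m => by rw [b0_bb, neg_neg]

theorem gh_Qt : HasWeight F.gh F.Qt 1 := by
  rw [F.Qt_eq]
  refine (HasWeight.opSum F.hasOpSum_QMatter fun n => ?_).add
    (HasWeight.opSum F.hasOpSum_QGhost fun kl => ?_)
  · by_cases hn : n = 0
    · rw [hn, F.cc_zero, zero_mul]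
      exact HasWeight.zero
    · exact ((F.gh_cc n).mul (F.gh_L (neg_ne_zero.mpr hn))).congr (by norm_num)
  · exact ((((F.gh_cc _).mul (F.gh_cc _)).mul (F.gh_bb _)).smul _).congr (by norm_num)

theorem lev_Qt : HasWeight F.lev F.Qt 0 := by
  rw [F.Qt_eq]
  refine (HasWeight.opSum F.hasOpSum_QMatter fun n => ?_).add
    (HasWeight.opSum F.hasOpSum_QGhost fun kl => ?_)
  · by_cases hn : n = 0
    · rw [hn, F.cc_zero, zero_mul]
      exact HasWeight.zero
    · exact ((F.lev_cc n).mul (F.lev_L (neg_ne_zero.mpr hn))).congr (by push_cast; ring)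
  · exact ((((F.lev_cc _).mul (F.lev_cc _)).mul (F.lev_bb _)).smul _).congr (by push_cast; ring)

/-- `{Q̃, c_m}` for `m ≠ 0`, as a sum of products of two ghosts. -/
theorem hasOpSum_Qt_cc {m : ℤ} (hm : m ≠ 0) :
    HasOpSum (fun k : ℤ => (1 / 2 * (2 * k - m) : ℂ) • (F.cc k * F.cc (m - k)))
      (F.Qt * F.cc m + F.cc m * F.Qt) := by
  have h1 : F.QMatter * F.cc m = -(F.cc m * F.QMatter) :=
    F.hasOpSum_QMatter.anticommute fun n =>
      F.cc_mul_L_anticommute (fun μ j => F.aa_cc μ j m) (fun j => F.cc_cc j m) n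
  have h2 := F.hasOpSum_QGhost.anticommutator (F.cc m)
  have h3 : ∀ kl : ℤ × ℤ, (1 / 2 * (kl.1 - kl.2) : ℂ) •
      (F.cc kl.1 * F.cc kl.2 * F.bb (-(kl.1 + kl.2))) * F.cc m + F.cc m *
      ((1 / 2 * (kl.1 - kl.2) : ℂ) • (F.cc kl.1 * F.cc kl.2 * F.bb (-(kl.1 + kl.2)))) =
      if kl.2 = m - kl.1 then (1 / 2 * (2 * kl.1 - m) : ℂ) • (F.cc kl.1 * F.cc (m - kl.1)) else 0 := by
    rintro ⟨k, l⟩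
    simp only
    have hc := commute_mul_of_anticommute (F.cc_cc k m) (F.cc_cc l m)
    rw [smul_mul_assoc, mul_smul_comm, ← smul_add, ← mul_assoc (F.cc m), ← hc.eq, mul_assoc,
      mul_assoc (F.cc k * F.cc l) (F.cc m), ← mul_add, F.bb_cc]
    by_cases hl : l = m - k
    · subst hl
      rw [if_pos rfl, if_pos ⟨by ring, by rw [add_sub_cancel]; exact neg_ne_zero.mpr hm⟩, mul_one]
      congr 1
      push_cast
      ring
    · rw [if_neg (by omega), if_neg hl, mul_zero, smul_zero]
  have h4 := (h2.congr fun kl => (h3 kl).symm).curry fun k : ℤ =>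
    HasOpSum.single (T := fun l : ℤ => if l = m - k then
      (1 / 2 * (2 * k - m) : ℂ) • (F.cc k * F.cc (m - k)) else 0) (m - k) fun l hl => if_neg hl
  have h5 : F.Qt * F.cc m + F.cc m * F.Qt = F.QGhost * F.cc m + F.cc m * F.QGhost := by
    rw [F.Qt_eq, add_mul, h1, mul_add]
    abel
  rw [h5]
  exact h4.congr fun k => (if_pos rfl).symm

/-- `[Q̃, α_m] = -m ∑_n c_n α_{m-n}`. -/
theorem hasOpSum_Qt_aa (μ : Fin 26) (m : ℤ) :
    HasOpSum (fun n => (-m : ℂ) • (F.cc n * F.aa μ (m - n))) (F.Qt * F.aa μ m - F.aa μ m * F.Qt) := by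
  have h1 : Commute F.QGhost (F.aa μ m) := F.hasOpSum_QGhost.commute fun kl =>
    (((F.aa_cc _ _ _).symm.mul_left (F.aa_cc _ _ _).symm).mul_left (F.aa_bb _ _ _).symm).smul_left _
  have h5 : F.Qt * F.aa μ m - F.aa μ m * F.Qt = F.QMatter * F.aa μ m - F.aa μ m * F.QMatter := by
    rw [F.Qt_eq, add_mul, h1.eq, mul_add]
    abel
  rw [h5]
  refine (F.hasOpSum_QMatter.commutator (F.aa μ m)).congr fun n => ?_
  by_cases hn : n = 0
  · simp [hn, F.cc_zero]
  · rw [← mul_assoc, (F.aa_cc μ m n).eq, mul_assoc, mul_assoc, ← mul_sub,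
      F.L_aa (neg_ne_zero.mpr hn), mul_smul_comm, ← sub_eq_add_neg]

theorem ccbb_finite {n : ℤ} (hn : n ≠ 0) (a : ℤ → ℂ) :
    PointwiseFinite fun k => a k • (F.cc k * F.bb (n - k)) := by
  intro x
  obtain ⟨K, hK⟩ := F.eventually_zero x
  refine (Set.finite_Icc (n - K) K).subset fun k hk => ?_
  by_contra hc
  refine hk ?_
  simp only [Set.mem_Icc, not_and_or, not_le] at hc
  rcases hc with h | h
  · simp [(hK (n - k) (by omega)).2.1]
  · have e : F.cc k * F.bb (n - k) = -(F.bb (n - k) * F.cc k) := by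
      rw [F.bb_cc_of_ne (by omega), neg_neg]
    simp [e, (hK k h).1]

/-- `{Q̃, b_n} - L_n` for `n ≠ 0`: the Virasoro operator of the nonzero ghost modes. -/
def G (n : ℤ) : Module.End ℂ E := F.Qt * F.bb n + F.bb n * F.Qt - F.L n

/-- Half of the sum comes from each of the two `c` modes that `b_n` can be contracted with. -/
theorem hasOpSum_G {n : ℤ} (hn : n ≠ 0) :
    HasOpSum (fun k : ℤ => (-(n + k) : ℂ) • (F.cc k * F.bb (n - k))) (F.G n) := by
  -- the contribution of the matter part
  have h1 : F.QMatter * F.bb n + F.bb n * F.QMatter = F.L n := by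
    refine (F.hasOpSum_QMatter.anticommutator (F.bb n)).unique ?_
    have key : ∀ k, F.cc k * F.L (-k) * F.bb n + F.bb n * (F.cc k * F.L (-k)) =
        if k = -n then F.L n else 0 := by
      intro k
      by_cases hk : k = 0
      · rw [hk, F.cc_zero, if_neg (by omega)]
        simp
      · rw [mul_assoc, (F.L_bb (neg_ne_zero.mpr hk) n).eq, ← mul_assoc, ← mul_assoc, ← add_mul,
          F.cc_bb]
        by_cases hkn : k = -n
        · rw [if_pos ⟨by omega, hn⟩, if_pos hkn, one_mul, hkn, neg_neg]
        · rw [if_neg (by omega), if_neg hkn, zero_mul]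
    have := HasOpSum.single (T := fun k => if k = -n then F.L n else 0) (-n) fun k hk => if_neg hk
    rw [if_pos rfl] at this
    exact this.congr key
  -- the two contractions in the cubic part
  have h2 : ∀ kl : ℤ × ℤ, (1 / 2 * (kl.1 - kl.2) : ℂ) •
      (F.cc kl.1 * F.cc kl.2 * F.bb (-(kl.1 + kl.2))) * F.bb n + F.bb n *
      ((1 / 2 * (kl.1 - kl.2) : ℂ) • (F.cc kl.1 * F.cc kl.2 * F.bb (-(kl.1 + kl.2)))) =
      (if kl.1 = -n then (-(1 / 2) * (n + kl.2) : ℂ) • (F.cc kl.2 * F.bb (n - kl.2)) else 0)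
      + (if kl.2 = -n then (-(1 / 2) * (n + kl.1) : ℂ) • (F.cc kl.1 * F.bb (n - kl.1)) else 0) := by
    rintro ⟨k, l⟩
    simp only
    have e : ∀ A B b' : Module.End ℂ E, b' * F.bb n = -(F.bb n * b') →
        A * B * b' * F.bb n + F.bb n * (A * B * b') =
        (A * F.bb n + F.bb n * A) * (B * b') - A * ((B * F.bb n + F.bb n * B) * b') := by
      intro A B b' h
      rw [mul_assoc, h]
      noncomm_ring
    rw [smul_mul_assoc, mul_smul_comm, ← smul_add, e _ _ _ (F.bb_bb _ _), F.cc_bb, F.cc_bb, smul_sub,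
      sub_eq_add_neg]
    congr 1
    · by_cases hk : k = -n
      · rw [if_pos ⟨by omega, hn⟩, if_pos hk, hk, one_mul, show -(-n + l) = n - l by ring]
        congr 1
        push_cast
        ring
      · rw [if_neg (by omega), if_neg hk, zero_mul, smul_zero]
    · by_cases hl : l = -n
      · rw [if_pos ⟨by omega, hn⟩, if_pos hl, hl, one_mul, show -(k + -n) = n - k by ring, ← neg_smul]
        congr 1
        push_cast
        ring
      · rw [if_neg (by omega), if_neg hl, zero_mul, mul_zero, smul_zero, neg_zero]
  have h3 := (F.ccbb_finite hn fun k => -(1 / 2) * (n + k)).hasOpSum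
  set S := opSum _ (F.ccbb_finite hn fun k => -(1 / 2) * (n + k))
  have h4 : HasOpSum (fun kl : ℤ × ℤ => if kl.1 = -n then
      (-(1 / 2) * (n + kl.2) : ℂ) • (F.cc kl.2 * F.bb (n - kl.2)) else 0) S := by
    refine h3.extend (j := fun l => (-n, l)) (fun a b hab => (Prod.mk.inj hab).2)
      (fun l => if_pos rfl) fun kl hkl => if_neg fun hc => hkl ⟨kl.2, ?_⟩
    rw [← hc]
  have h5 : HasOpSum (fun kl : ℤ × ℤ => if kl.2 = -n then
      (-(1 / 2) * (n + kl.1) : ℂ) • (F.cc kl.1 * F.bb (n - kl.1)) else 0) S := by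
    refine h3.extend (j := fun k => (k, -n)) (fun a b hab => (Prod.mk.inj hab).1)
      (fun l => if_pos rfl) fun kl hkl => if_neg fun hc => hkl ⟨kl.1, ?_⟩
    rw [← hc]
  have h6 : F.G n = (2 : ℂ) • S := by
    have := (F.hasOpSum_QGhost.anticommutator (F.bb n)).eq_of_forall_eq (h4.add h5) h2
    rw [G, ← h1, F.Qt_eq, two_smul, ← this, add_mul, mul_add]
    abel
  rw [h6]
  refine (h3.smul 2).congr fun k => ?_
  rw [smul_smul]
  congr 1
  ring

theorem Qt_bb (n : ℤ) : F.Qt * F.bb n + F.bb n * F.Qt = F.L n + F.G n := by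
  rw [G, add_sub_cancel]

end OscillatorRep

namespace OscillatorRep

variable {E : Type*} [AddCommGroup E] [Module ℂ E] (F : OscillatorRep E)

/-! ### The square of the reduced BRST operator commutes with matter and `c` modes -/

/-- `M` as a sum over all integers: the modes `k` and `-k` contribute equally. -/
theorem hasOpSum_M_symm : HasOpSum (fun k : ℤ => (k : ℂ) • (F.cc k * F.cc (-k))) F.M := by
  have h1 : HasOpSum (fun k : ℤ => if 0 < k then (k : ℂ) • (F.cc k * F.cc (-k)) else 0)
      ((1 / 2 : ℂ) • F.M) := (F.hasOpSum_M.smul (1 / 2)).congr fun k => by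
    split_ifs
    · rw [F.cc_cc k (-k), smul_smul, smul_neg, ← neg_smul]
      congr 1
      ring
    · rw [smul_zero]
  have h2 := h1.add (h1.reindex (Equiv.neg ℤ))
  rw [← add_smul, show (1 / 2 + 1 / 2 : ℂ) = 1 by norm_num, one_smul] at h2
  refine h2.congr fun k => ?_
  simp only [Equiv.neg_apply, neg_neg]
  rcases lt_trichotomy k 0 with h | h | h
  · rw [if_neg (by omega), if_pos (by omega), zero_add, F.cc_cc (-k) k, smul_neg, ← neg_smul]
    congr 1
    push_cast
    ring
  · simp [h]
  · rw [if_pos h, if_neg (by omega), add_zero]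

/-- The operator `½ ∑ (k - l) c_k c_l`, summed over `k + l = m`: it is `{Q̃, c_m}` for `m ≠ 0`, and `M`
for `m = 0`. -/
def C (m : ℤ) : Module.End ℂ E := if m = 0 then F.M else F.Qt * F.cc m + F.cc m * F.Qt

theorem hasOpSum_C (m : ℤ) :
    HasOpSum (fun k : ℤ => (1 / 2 * (2 * k - m) : ℂ) • (F.cc k * F.cc (m - k))) (F.C m) := by
  unfold C
  split_ifs with hm
  · subst hm
    refine F.hasOpSum_M_symm.congr fun k => ?_
    rw [zero_sub]
    congr 1
    push_cast
    ring
  · exact F.hasOpSum_Qt_cc hm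

theorem Qt_cc (m : ℤ) :
    F.Qt * F.cc m + F.cc m * F.Qt = F.C m - if m = 0 then F.M else 0 := by
  unfold C
  split_ifs with hm
  · simp [hm, F.cc_zero]
  · rw [sub_zero]

theorem C_cc (m k : ℤ) : Commute (F.C m) (F.cc k) :=
  (F.hasOpSum_C m).commute fun _ =>
    (commute_mul_of_anticommute (F.cc_cc _ _) (F.cc_cc _ _)).smul_left _

theorem ccX_finite {X : ℤ → Module.End ℂ E} (m : ℤ) (a : ℤ × ℤ → ℂ)
    (hX : ∀ x, ∃ K, ∀ n, K < n → X n x = 0)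
    (hc : ∀ j k, F.cc j * X k = -(X k * F.cc j) ∨ F.cc j * X k = X k * F.cc j) :
    PointwiseFinite fun kl : ℤ × ℤ => a kl • (F.cc kl.1 * F.cc kl.2 * X (m - kl.1 - kl.2)) := by
  intro x
  obtain ⟨K, hK⟩ := F.eventually_zero x
  obtain ⟨J, hJ⟩ := hX x
  have move : ∀ j k, F.cc j x = 0 → F.cc j (X k x) = 0 := by
    intro j k hj
    rw [← Module.End.mul_apply]
    rcases hc j k with h | h <;> simp [h, hj]
  refine ((Set.finite_Icc (m - K - J) K).prod (Set.finite_Icc (m - K - J) K)).subset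
    fun kl hkl => ?_
  obtain ⟨k, l⟩ := kl
  by_contra hn
  refine hkl ?_
  have h : K < k ∨ K < l ∨ J < m - k - l := by
    simp only [Set.mem_prod, Set.mem_Icc] at hn
    omega
  simp only
  rcases h with h | h | h
  · rw [F.cc_cc k l]
    simp [move k _ (hK k h).1]
  · simp [move l _ (hK l h).1]
  · simp [hJ _ h]

/-- The Jacobi identity of the ghost algebra. The summands are invariant under cyclic permutations
of the three modes, and the cyclic sum of the coefficients vanishes. -/
theorem jacobi (m : ℤ) :
    HasOpSum (fun i : ℤ => (2 * i - m : ℂ) • (F.C i * F.cc (m - i))) 0 := by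
  have fin := F.ccX_finite (X := F.cc) m
    (fun kl => 1 / 2 * (2 * (kl.1 + kl.2) - m) * (kl.1 - kl.2))
    (fun x => by
      obtain ⟨K, hK⟩ := F.eventually_zero x
      exact ⟨K, fun n hn => (hK n hn).1⟩) (fun j k => .inl (F.cc_cc j k))
  have hS := fin.hasOpSum
  set S := opSum _ fin
  have h1 : HasOpSum (fun i : ℤ => (2 * i - m : ℂ) • (F.C i * F.cc (m - i))) S := by
    let e : ℤ × ℤ ≃ ℤ × ℤ :=
      { toFun := fun ik => (ik.2, ik.1 - ik.2)
        invFun := fun kl => (kl.1 + kl.2, kl.1)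
        left_inv := fun ik => by simp
        right_inv := fun kl => by simp }
    refine (hS.reindex e).curry fun i => ?_
    refine (((F.hasOpSum_C i).mul_right (F.cc (m - i))).smul (2 * i - m)).congr fun k => ?_
    simp only [e, Equiv.coe_fn_mk]
    rw [smul_mul_assoc, smul_smul, show m - k - (i - k) = m - i by ring]
    congr 1
    push_cast
    ring
  let σ : ℤ × ℤ ≃ ℤ × ℤ :=
    { toFun := fun kl => (kl.2, m - kl.1 - kl.2)
      invFun := fun kl => (m - kl.1 - kl.2, kl.1)
      left_inv := fun kl => by ext <;> simp
      right_inv := fun kl => Prod.ext (by simp) (by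
        change m - (m - kl.1 - kl.2) - kl.1 = kl.2
        ring) }
  have cyc : ∀ j k l, F.cc k * F.cc l * F.cc j = F.cc j * F.cc k * F.cc l := fun j k l => by
    rw [(commute_mul_of_anticommute (F.cc_cc k j) (F.cc_cc l j)).eq, mul_assoc]
  have h3 := (hS.add (hS.reindex σ)).add ((hS.reindex σ).reindex σ)
  -- the sum over the three cyclic permutations vanishes term by term
  have h4 : S + S + S = 0 := by
    refine h3.unique ((HasOpSum.single (T := fun _ : ℤ × ℤ => (0 : Module.End ℂ E)) (0, 0)
      fun _ _ => rfl).congr ?_)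
    rintro ⟨k, l⟩
    simp only [σ, Equiv.coe_fn_mk]
    rw [show m - l - (m - k - l) = k by ring, show m - (m - k - l) - k = l by ring,
      cyc k l (m - k - l), ← cyc (m - k - l) k l, ← add_smul, ← add_smul]
    convert zero_smul ℂ _
    push_cast
    ring
  have h5 : S = 0 := by
    have : (3 : ℂ) • S = 0 := by rw [← h4]; module
    simpa using this
  rwa [h5] at h1

/-- `[Q̃², c_m] = m M c_m`. If the zero mode `c_0` were included, the commutator would vanish by the
Jacobi identity; its absence leaves the two terms with `C_0 = M`. -/
theorem Qt_sq_cc (m : ℤ) :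
    F.Qt * F.Qt * F.cc m - F.cc m * (F.Qt * F.Qt) = (m : ℂ) • (F.M * F.cc m) := by
  by_cases hm : m = 0
  · simp [hm, F.cc_zero]
  have h0 := ((F.hasOpSum_Qt_cc hm).commutator F.Qt).neg
  have e0 : -((F.Qt * F.cc m + F.cc m * F.Qt) * F.Qt - F.Qt * (F.Qt * F.cc m + F.cc m * F.Qt)) =
      F.Qt * F.Qt * F.cc m - F.cc m * (F.Qt * F.Qt) := by noncomm_ring
  rw [e0] at h0
  have h1 := (F.jacobi m).smul (1 / 2)
  have h2 := h1.reindex (Equiv.subLeft m)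
  have s1 := HasOpSum.single (T := fun k : ℤ => if k = 0 then (m / 2 : ℂ) • (F.M * F.cc m) else 0)
    0 fun k hk => if_neg hk
  have s2 := HasOpSum.single (T := fun k : ℤ => if k = m then (m / 2 : ℂ) • (F.M * F.cc m) else 0)
    m fun k hk => if_neg hk
  rw [h0.eq_of_forall_eq ((h1.add h2).add (s1.add s2)) ?_, if_pos rfl, if_pos rfl]
  · module
  intro k
  have e1 : ∀ A B : Module.End ℂ E, -(A * B * F.Qt - F.Qt * (A * B)) =
      (F.Qt * A + A * F.Qt) * B - A * (F.Qt * B + B * F.Qt) := fun A B => by noncomm_ring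
  rw [smul_mul_assoc, mul_smul_comm, ← smul_sub, ← smul_neg, e1, F.Qt_cc, F.Qt_cc, mul_sub (F.cc k),
    (F.C_cc (m - k) k).eq.symm, Equiv.subLeft_apply, sub_sub_cancel]
  have e2 : (1 / 2 * (2 * k - m) : ℂ) • ((if k = 0 then F.M else 0) * F.cc (m - k)) =
      -if k = 0 then (m / 2 : ℂ) • (F.M * F.cc m) else 0 := by
    split_ifs with hk
    · rw [hk, sub_zero, ← neg_smul]
      congr 1
      push_cast
      ring
    · simp
  have e3 : (1 / 2 * (2 * k - m) : ℂ) • (F.cc k * (if m - k = 0 then F.M else 0)) =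
      if k = m then (m / 2 : ℂ) • (F.M * F.cc m) else 0 := by
    by_cases hk : k = m
    · rw [if_pos (by omega), if_pos hk, hk, (F.M_cc m).eq]
      congr 1
      ring
    · rw [if_neg (by omega), if_neg hk]
      simp
  rw [sub_mul, smul_sub, smul_sub, smul_sub, e2, e3]
  push_cast
  module

/-- `[Q̃², α_m] = m M α_m`. Again all terms cancel except the one with `C_0 = M`. -/
theorem Qt_sq_aa (μ : Fin 26) (m : ℤ) :
    F.Qt * F.Qt * F.aa μ m - F.aa μ m * (F.Qt * F.Qt) = (m : ℂ) • (F.M * F.aa μ m) := by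
  have hfin := fun a => F.ccX_finite (X := F.aa μ) m a
    (fun x => by
      obtain ⟨K, hK⟩ := F.eventually_zero x
      exact ⟨K, fun n hn => (hK n hn).2.2 μ⟩) (fun j k => .inr (F.aa_cc μ k j).eq.symm)
  have hS := (hfin fun kl => 1 / 2 * (kl.1 - kl.2)).hasOpSum
  set S := opSum _ (hfin fun kl => 1 / 2 * (kl.1 - kl.2))
  have hS' := (hfin fun kl => -(m - kl.1)).hasOpSum
  set S' := opSum _ (hfin fun kl => -(m - kl.1))
  have hSS : S' = S := by
    have h := hS'.add (hS'.reindex (Equiv.prodComm ℤ ℤ))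
    have : S' + S' = (2 : ℂ) • S := by
      refine h.eq_of_forall_eq (hS.smul 2) ?_
      rintro ⟨k, l⟩
      simp only [Equiv.prodComm_apply, Prod.swap_prod_mk]
      rw [F.cc_cc l k, show m - l - k = m - k - l by ring]
      simp only [neg_mul]
      module
    rw [← two_smul ℂ] at this
    exact smul_right_injective _ (two_ne_zero (α := ℂ)) this
  have h1 : HasOpSum (fun i : ℤ => F.C i * F.aa μ (m - i)) S := by
    let e : ℤ × ℤ ≃ ℤ × ℤ :=
      { toFun := fun ik => (ik.2, ik.1 - ik.2)
        invFun := fun kl => (kl.1 + kl.2, kl.1)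
        left_inv := fun ik => by simp
        right_inv := fun kl => by simp }
    refine (hS.reindex e).curry fun i => ?_
    refine ((F.hasOpSum_C i).mul_right (F.aa μ (m - i))).congr fun k => ?_
    simp only [e, Equiv.coe_fn_mk]
    rw [smul_mul_assoc, show m - k - (i - k) = m - i by ring]
    congr 1
    push_cast
    ring
  have h2 : HasOpSum (fun k : ℤ => F.cc k * (F.Qt * F.aa μ (m - k) - F.aa μ (m - k) * F.Qt)) S := by
    rw [hSS] at hS'
    refine hS'.curry fun k => ?_
    refine ((F.hasOpSum_Qt_aa μ (m - k)).mul_left (F.cc k)).congr fun l => ?_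
    rw [mul_smul_comm, ← mul_assoc]
    push_cast
    rfl
  have h0 := (F.hasOpSum_Qt_aa μ m).anticommutator F.Qt
  have e0 : (F.Qt * F.aa μ m - F.aa μ m * F.Qt) * F.Qt + F.Qt * (F.Qt * F.aa μ m - F.aa μ m * F.Qt) =
      F.Qt * F.Qt * F.aa μ m - F.aa μ m * (F.Qt * F.Qt) := by noncomm_ring
  rw [e0] at h0
  have s1 := HasOpSum.single (T := fun k : ℤ => if k = 0 then F.M * F.aa μ m else 0)
    0 fun k hk => if_neg hk
  rw [h0.eq_of_forall_eq (((h1.sub h2).sub s1).smul (-m)) ?_, if_pos rfl, sub_self]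
  · module
  intro k
  have e1 : ∀ A B : Module.End ℂ E, A * B * F.Qt + F.Qt * (A * B) =
      (F.Qt * A + A * F.Qt) * B - A * (F.Qt * B - B * F.Qt) := fun A B => by noncomm_ring
  rw [smul_mul_assoc, mul_smul_comm, ← smul_add, e1, F.Qt_cc, sub_mul]
  congr 1
  have e2 : (if k = 0 then F.M else 0) * F.aa μ (m - k) = if k = 0 then F.M * F.aa μ m else 0 := by
    split_ifs with hk
    · rw [hk, sub_zero]
    · rw [zero_mul]
  rw [e2]
  abel

/-- `L_0 = r + level`. -/
def L0 : Module.End ℂ E := F.r • 1 + F.lev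

/-- The part `Q̃² + L_0 M` of `Q²`. -/
def anomaly : Module.End ℂ E := F.Qt * F.Qt + F.L0 * F.M

theorem L0_weight {A : Module.End ℂ E} {s : ℂ} (hA : HasWeight F.lev A s) : HasWeight F.L0 A s := by
  unfold HasWeight L0
  rw [add_mul, mul_add, ← hA]
  simp

/-- `L_0 M` has the opposite commutator with an operator of level `-m` that commutes with `M`. -/
theorem anomaly_commute {A : Module.End ℂ E} {m : ℤ}
    (hQ : F.Qt * F.Qt * A - A * (F.Qt * F.Qt) = (m : ℂ) • (F.M * A))
    (hA : HasWeight F.lev A (-m)) (hM : Commute F.M A) : Commute F.anomaly A := by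
  have h1 : F.Qt * F.Qt * A = A * (F.Qt * F.Qt) + (m : ℂ) • (F.M * A) := eq_add_of_sub_eq' hQ
  unfold Commute SemiconjBy anomaly
  rw [add_mul, h1, mul_assoc F.L0, hM.eq, ← mul_assoc F.L0, (F.L0_weight hA).eq]
  simp only [add_mul, mul_add, smul_mul_assoc, mul_assoc]
  module

theorem anomaly_cc (m : ℤ) : Commute F.anomaly (F.cc m) :=
  F.anomaly_commute (F.Qt_sq_cc m) (F.lev_cc m) (F.M_cc m)

theorem anomaly_aa (μ : Fin 26) (m : ℤ) : Commute F.anomaly (F.aa μ m) :=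
  F.anomaly_commute (F.Qt_sq_aa μ m) (F.lev_aa μ m) (F.M_aa μ m)

theorem anomaly_c0 : Commute F.anomaly F.c0 :=
  (commute_mul_of_anticommute F.Qt_c0 F.Qt_c0).add_left
    ((((Commute.one_left _).smul_left _).add_left F.lev_c0).mul_left F.M_c0)

theorem gh_anomaly : HasWeight F.gh F.anomaly 2 := by
  refine ((F.gh_Qt.mul F.gh_Qt).congr (by norm_num)).add
    ((HasWeight.mul (.of_commute ?_) F.gh_M).congr (zero_add 2))
  exact ((Commute.one_right _).smul_right _).add_right F.lev_gh.symm

theorem lev_anomaly : Commute F.lev F.anomaly :=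
  (F.lev_Qt.commute.mul_right F.lev_Qt.commute).add_right
    ((((Commute.one_right _).smul_right _).add_right (Commute.refl _)).mul_right F.lev_M)

end OscillatorRep

namespace OscillatorRep

variable {E : Type*} [AddCommGroup E] [Module ℂ E] (F : OscillatorRep E)

/-! ### The anomaly on one-particle states -/

theorem cc_bb_of_ne {m n : ℤ} (h : m + n ≠ 0) : F.cc m * F.bb n = -(F.bb n * F.cc m) := by
  rw [F.bb_cc_of_ne (by omega), neg_neg]

/-- `c_k b_{-k}` restores a state that contains no `b_{-k}`. -/
theorem cc_bb_apply {k : ℤ} (hk : k ≠ 0) {x : E} (hx : F.cc k x = 0) : F.cc k (F.bb (-k) x) = x := by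
  have := LinearMap.congr_fun (F.cc_bb k (-k)) x
  rw [if_pos ⟨by omega, by omega⟩] at this
  simpa [hx] using this

theorem bb_cc_apply {k : ℤ} (hk : k ≠ 0) {x : E} (hx : F.bb k x = 0) : F.bb k (F.cc (-k) x) = x := by
  have := LinearMap.congr_fun (F.bb_cc k (-k)) x
  rw [if_pos ⟨by omega, by omega⟩] at this
  simpa [hx] using this

theorem L_vac {n : ℤ} (hn : 0 < n) : F.L n F.vac = 0 :=
  (F.hasOpSum_L n hn.ne').apply_eq_zero fun k => by
    simp only [LinearMap.smul_apply, LinearMap.sum_apply, Module.End.mul_apply]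
    refine (congrArg _ (Finset.sum_eq_zero fun μ _ => ?_)).trans (smul_zero _)
    rcases lt_or_ge k n with h | h
    · rw [F.aa_vac μ (n - k) (by omega), map_zero, smul_zero]
    · rw [apply_of_commute (F.aa_commute (by omega)) (F.aa_vac μ k (by omega)), smul_zero]

theorem Qt_vac : F.Qt F.vac = 0 := by
  have h1 : F.QMatter F.vac = 0 := F.hasOpSum_QMatter.apply_eq_zero fun n => by
    rcases lt_trichotomy n 0 with h | h | h
    · rw [Module.End.mul_apply, F.L_vac (by omega), map_zero]
    · simp [h, F.cc_zero]
    · rw [(F.L_cc (by omega) n).symm.eq, Module.End.mul_apply, F.cc_vac n h, map_zero]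
  have h2 : F.QGhost F.vac = 0 := F.hasOpSum_QGhost.apply_eq_zero fun kl => by
    obtain ⟨k, l⟩ := kl
    simp only [LinearMap.smul_apply]
    suffices (F.cc k * F.cc l * F.bb (-(k + l))) F.vac = 0 by rw [this, smul_zero]
    by_cases hk : k = 0
    · simp [hk, F.cc_zero]
    by_cases hl : l = 0
    · simp [hl, F.cc_zero]
    rcases lt_trichotomy (k + l) 0 with h | h | h
    · rw [Module.End.mul_apply, F.bb_vac _ (by omega), map_zero]
    · simp only [h, neg_zero, F.bb_zero, mul_zero, LinearMap.zero_apply]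
    · rcases lt_or_ge 0 l with hl' | hl'
      · rw [mul_assoc, Module.End.mul_apply, Module.End.mul_apply,
          apply_of_anticommute (F.cc_bb_of_ne (by omega)) (F.cc_vac l hl'), map_zero]
      · rw [F.cc_cc k l, neg_mul, LinearMap.neg_apply, mul_assoc, Module.End.mul_apply,
          Module.End.mul_apply,
          apply_of_anticommute (F.cc_bb_of_ne (by omega)) (F.cc_vac k (by omega)), map_zero, neg_zero]
  rw [F.Qt_eq, LinearMap.add_apply, h1, h2, add_zero]

theorem G_vac {n : ℤ} (hn : 0 < n) : F.G n F.vac = 0 :=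
  (F.hasOpSum_G hn.ne').apply_eq_zero fun k => by
    rw [LinearMap.smul_apply, Module.End.mul_apply]
    rcases lt_trichotomy k n with h | h | h
    · rw [F.bb_vac _ (by omega), map_zero, smul_zero]
    · simp [h, F.bb_zero]
    · rw [apply_of_anticommute (F.cc_bb_of_ne (by omega)) (F.cc_vac k (by omega)), smul_zero]

theorem G_cc {n : ℤ} (hn : n ≠ 0) (j : ℤ) (hj : j ≠ 0) :
    F.G n * F.cc j - F.cc j * F.G n = (-(2 * n + j) : ℂ) • F.cc (n + j) := by
  have s := HasOpSum.single (T := fun k : ℤ => if k = n + j then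
    (-(2 * n + j) : ℂ) • F.cc (n + j) else 0) (n + j) fun k hk => if_neg hk
  rw [((F.hasOpSum_G hn).commutator (F.cc j)).eq_of_forall_eq s fun k => ?_, if_pos rfl]
  rw [smul_mul_assoc, mul_smul_comm, ← smul_sub, odd_mul_commutator, F.bb_cc, F.cc_cc', zero_mul,
    sub_zero]
  by_cases hk : k = n + j
  · rw [if_pos ⟨by omega, by omega⟩, if_pos hk, mul_one, hk]
    congr 1
    push_cast
    ring
  · rw [if_neg (by omega), if_neg hk, mul_zero, smul_zero]

theorem G_bb {n : ℤ} (hn : n ≠ 0) (j : ℤ) (hj : j ≠ 0) :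
    F.G n * F.bb j - F.bb j * F.G n = (n - j : ℂ) • F.bb (n + j) := by
  have s := HasOpSum.single (T := fun k : ℤ => if k = -j then
    (n - j : ℂ) • F.bb (n + j) else 0) (-j) fun k hk => if_neg hk
  rw [((F.hasOpSum_G hn).commutator (F.bb j)).eq_of_forall_eq s fun k => ?_, if_pos rfl]
  rw [smul_mul_assoc, mul_smul_comm, ← smul_sub, odd_mul_commutator, F.cc_bb, F.bb_bb', mul_zero,
    zero_sub]
  by_cases hk : k = -j
  · rw [if_pos ⟨by omega, by omega⟩, if_pos hk, one_mul, hk, sub_neg_eq_add, smul_neg, ← neg_smul]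
    congr 1
    push_cast
    ring
  · rw [if_neg (by omega), if_neg hk, zero_mul, neg_zero, smul_zero]

theorem L_G {m n : ℤ} (hm : m ≠ 0) (hn : n ≠ 0) : Commute (F.L m) (F.G n) :=
  ((F.hasOpSum_G hn).commute fun k =>
    ((F.L_cc hm k).symm.mul_left (F.L_bb hm (n - k)).symm).smul_left _).symm

theorem mem_map_succ {N : ℕ} {l : ℤ} {j : ℕ ↪ ℤ} (hj : ∀ i, j i = (i : ℤ) + 1)
    (h : 0 < l) (h' : l < N + 1) : l ∈ (Finset.range N).map j := by
  refine Finset.mem_map.mpr ⟨(l - 1).toNat, Finset.mem_range.mpr (by omega), ?_⟩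
  rw [hj]
  omega

/-- The central term of the ghost Virasoro operators. -/
theorem G_G_vac (N : ℕ) : F.G (N + 1) (F.G (-(N + 1)) F.vac) =
    (∑ j ∈ Finset.range N, ((N + j + 2) * (j - 1 - 2 * N) : ℂ)) • F.vac := by
  set n : ℤ := N + 1 with hn
  have hn0 : 0 < n := by omega
  have h := ((F.hasOpSum_G (neg_ne_zero.mpr hn0.ne')).reindex (Equiv.neg ℤ)).mul_left (F.G n)
  let e : ℕ ↪ ℤ := ⟨fun i => (i : ℤ) + 1, fun a b hab => by simpa using hab⟩
  rw [← Module.End.mul_apply, h.apply_eq_sum ((Finset.range N).map e) fun l hl => ?_, Finset.sum_map,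
    Finset.sum_smul]
  · refine Finset.sum_congr rfl fun j hj => ?_
    have hj' := Finset.mem_range.mp hj
    set l : ℤ := e j with hl
    have hl' : l = j + 1 := rfl
    have hG1 := LinearMap.congr_fun (F.G_cc hn0.ne' (-l) (by omega)) (F.bb (-n - -l) F.vac)
    have hG2 := LinearMap.congr_fun (F.G_bb hn0.ne' (-n - -l) (by omega)) F.vac
    simp only [LinearMap.sub_apply, Module.End.mul_apply, LinearMap.smul_apply, F.G_vac hn0, map_zero,
      sub_zero] at hG1 hG2
    rw [F.bb_vac (n + (-n - -l)) (by omega), smul_zero] at hG2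
    rw [hG2, map_zero, sub_zero, show -n - -l = -(n + -l) by ring,
      F.cc_bb_apply (by omega) (F.cc_vac _ (by omega))] at hG1
    simp only [Equiv.neg_apply, Module.End.mul_apply, LinearMap.smul_apply, map_smul]
    rw [show -n - -l = -(n + -l) by ring, hG1, smul_smul]
    congr 1
    rw [hl', hn]
    push_cast
    ring
  · simp only [Equiv.neg_apply, Module.End.mul_apply, LinearMap.smul_apply, map_smul]
    rcases lt_or_ge 0 l with h0 | h0
    · have h1 : n ≤ l := by
        by_contra hc
        exact hl (mem_map_succ (fun _ => rfl) h0 (by omega))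
      rcases h1.lt_or_eq with h1 | h1
      · rw [F.bb_vac _ (by omega), map_zero, map_zero, smul_zero]
      · rw [h1, sub_self, F.bb_zero]
        simp
    · rcases h0.lt_or_eq with h1 | h1
      · rw [apply_of_anticommute (F.cc_bb_of_ne (by omega)) (F.cc_vac _ (by omega)), map_zero,
          smul_zero]
      · rw [h1, neg_zero, F.cc_zero]
        simp

/-- The action of `L_n` on a two-particle state. -/
theorem L_aa_aa_vac {n : ℤ} (hn : 0 < n) (μ : Fin 26) (k : ℤ) :
    F.L n (F.aa μ (-k) (F.aa μ (k - n) F.vac)) =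
      (k : ℂ) • F.aa μ (n - k) (F.aa μ (k - n) F.vac)
        + (n - k : ℂ) • F.aa μ (-k) (F.aa μ k F.vac) := by
  have h1 := LinearMap.congr_fun (F.L_aa hn.ne' μ (-k)) (F.aa μ (k - n) F.vac)
  have h2 := LinearMap.congr_fun (F.L_aa hn.ne' μ (k - n)) F.vac
  simp only [LinearMap.sub_apply, Module.End.mul_apply, LinearMap.smul_apply, F.L_vac hn, map_zero,
    sub_zero] at h1 h2
  rw [eq_add_of_sub_eq h1, h2, map_smul, show -k + n = n - k by ring, show k - n + n = k by ring]
  push_cast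
  congr 2 <;> ring

theorem aa_aa_vac {k : ℤ} (hk : 0 < k) (μ : Fin 26) :
    F.aa μ k (F.aa μ (-k) F.vac) = (k * eta μ : ℂ) • F.vac := by
  have := LinearMap.congr_fun (F.aa_aa μ μ k (-k)) F.vac
  rw [if_pos ⟨by omega, rfl⟩] at this
  simpa [F.aa_vac μ k hk] using this

/-- The central term of the matter Virasoro operators. -/
theorem L_L_vac (N : ℕ) : F.L (N + 1) (F.L (-(N + 1)) F.vac) =
    (2 * (N + 1) * (F.r + 1) + ∑ j ∈ Finset.range N, (13 * ((j + 1) * (N - j)) : ℂ)) • F.vac := by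
  set n : ℤ := N + 1 with hn
  have hn0 : 0 < n := by omega
  have h := ((F.hasOpSum_L (-n) (neg_ne_zero.mpr hn0.ne')).reindex (Equiv.neg ℤ)).mul_left (F.L n)
  have term : ∀ k : ℤ, (F.L n * ((1 / 2 : ℂ) • ∑ μ, (eta μ : ℂ) •
      (F.aa μ (Equiv.neg ℤ k) * F.aa μ (-n - Equiv.neg ℤ k)))) F.vac =
      (1 / 2 : ℂ) • ∑ μ, (eta μ : ℂ) • ((k : ℂ) • F.aa μ (n - k) (F.aa μ (k - n) F.vac)
        + (n - k : ℂ) • F.aa μ (-k) (F.aa μ k F.vac)) := by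
    intro k
    simp only [Module.End.mul_apply, LinearMap.smul_apply, LinearMap.sum_apply, map_smul, map_sum,
      Equiv.neg_apply]
    refine congrArg _ (Finset.sum_congr rfl fun μ _ => ?_)
    rw [show -n - -k = k - n by ring, F.L_aa_aa_vac hn0]
  -- the boundary terms contain the momentum
  have boundary : ∀ t : ℂ, (1 / 2 : ℂ) • ∑ μ, (eta μ : ℂ) • t • F.aa μ 0 (F.aa μ 0 F.vac) =
      (t * (F.r + 1)) • F.vac := by
    intro t
    simp only [F.aa_zero, LinearMap.smul_apply, Module.End.one_apply, smul_smul]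
    rw [← Finset.sum_smul, smul_smul]
    congr 1
    have := F.sum_κ
    rw [show ∑ μ, (eta μ : ℂ) * (t * (F.κ μ * F.κ μ)) = t * ∑ μ, (eta μ : ℂ) * F.κ μ ^ 2 by
      rw [Finset.mul_sum]
      exact Finset.sum_congr rfl fun μ _ => by ring, this]
    ring
  let e : ℕ ↪ ℤ := ⟨fun i => (i : ℤ), fun a b hab => by simpa using hab⟩
  rw [← Module.End.mul_apply, h.apply_eq_sum ((Finset.range (N + 2)).map e) fun k hk => ?_,
    Finset.sum_map, Finset.sum_range_succ, Finset.sum_range_succ']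
  · simp only [term]
    have e0 : e 0 = 0 := rfl
    have eN : e (N + 1) = n := by
      change ((N + 1 : ℕ) : ℤ) = n
      omega
    have ej : ∀ j, e (j + 1) = (j : ℤ) + 1 := fun j => by
      change ((j + 1 : ℕ) : ℤ) = j + 1
      omega
    rw [e0, eN]
    have hb0 : (1 / 2 : ℂ) • ∑ μ, (eta μ : ℂ) • (((0 : ℤ) : ℂ) • F.aa μ (n - 0) (F.aa μ (0 - n) F.vac)
        + (n - (0 : ℤ) : ℂ) • F.aa μ (-0) (F.aa μ 0 F.vac)) = (n * (F.r + 1) : ℂ) • F.vac := by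
      simpa using boundary n
    have hbn : (1 / 2 : ℂ) • ∑ μ, (eta μ : ℂ) • ((n : ℂ) • F.aa μ (n - n) (F.aa μ (n - n) F.vac)
        + (n - n : ℂ) • F.aa μ (-n) (F.aa μ n F.vac)) = (n * (F.r + 1) : ℂ) • F.vac := by
      simpa using boundary n
    have hmid : ∀ j ∈ Finset.range N, (1 / 2 : ℂ) • ∑ μ, (eta μ : ℂ) •
        (((e (j + 1) : ℤ) : ℂ) • F.aa μ (n - e (j + 1)) (F.aa μ (e (j + 1) - n) F.vac)
        + (n - (e (j + 1) : ℤ) : ℂ) • F.aa μ (-e (j + 1)) (F.aa μ (e (j + 1)) F.vac)) =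
        (13 * ((j + 1) * (N - j)) : ℂ) • F.vac := by
      intro j hj
      have hj' := Finset.mem_range.mp hj
      rw [ej]
      have h1 : ∀ μ, (eta μ : ℂ) •
          ((((j : ℤ) + 1 : ℤ) : ℂ) • F.aa μ (n - (j + 1)) (F.aa μ (j + 1 - n) F.vac)
          + (n - ((j : ℤ) + 1 : ℤ) : ℂ) • F.aa μ (-(j + 1)) (F.aa μ (j + 1) F.vac)) =
          ((j + 1) * (N - j) : ℂ) • F.vac := by
        intro μ
        rw [F.aa_vac μ (j + 1) (by omega), map_zero, smul_zero, add_zero,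
          show ((j : ℤ) + 1 - n) = -(n - (j + 1)) by ring, F.aa_aa_vac (by omega), smul_smul,
          smul_smul]
        congr 1
        rw [hn]
        push_cast
        linear_combination ((j + 1) * (N - j) : ℂ) * eta_mul_eta μ
      simp only [h1]
      rw [Finset.sum_const, Finset.card_univ, Fintype.card_fin]
      module
    rw [hb0, hbn, Finset.sum_congr rfl hmid, ← Finset.sum_smul, ← add_smul, ← add_smul]
    congr 1
    rw [hn]
    push_cast
    ring
  · rw [term]
    have h0 : k < 0 ∨ n < k := by
      by_contra hc
      refine hk (Finset.mem_map.mpr ⟨k.toNat, Finset.mem_range.mpr (by omega), ?_⟩)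
      change (k.toNat : ℤ) = k
      omega
    refine (congrArg _ (Finset.sum_eq_zero fun μ _ => ?_)).trans (smul_zero _)
    rcases h0 with h0 | h0
    · -- both contributions have the same norm and opposite sign
      have h1 := F.aa_aa_vac (k := n - k) (by omega) μ
      rw [neg_sub] at h1
      have h2 := F.aa_aa_vac (k := -k) (by omega) μ
      rw [neg_neg] at h2
      rw [h1, h2, smul_smul, smul_smul, ← add_smul]
      push_cast
      rw [show (k * ((n - k) * eta μ) + (n - k) * (-k * eta μ) : ℂ) = 0 by ring, zero_smul, smul_zero]
    · rw [F.aa_vac μ (k - n) (by omega), F.aa_vac μ k (by omega)]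
      simp

/-- In 26 dimensions, with intercept one, the central terms of matter and ghosts cancel. -/
theorem anomaly_cancellation (N : ℕ) :
    ∑ j ∈ Finset.range N, (13 * ((j + 1) * (N - j)) : ℂ) +
      ∑ j ∈ Finset.range N, ((N + j + 2) * (j - 1 - 2 * N) : ℂ) = 2 * N * (N + 1) := by
  have key : ∀ (a : ℂ) (k : ℕ), ∑ j ∈ Finset.range k,
      (13 * ((j + 1) * (a - j)) + (a + j + 2) * (j - 1 - 2 * a) : ℂ) =
      -2 * (k - 1) * k * (2 * k - 1) + 6 * (a - 1) * k * (k - 1) + k * (-2 * a ^ 2 + 8 * a - 2) := by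
    intro a k
    induction k with
    | zero => simp
    | succ k ih =>
      rw [Finset.sum_range_succ, ih]
      push_cast
      ring
  rw [← Finset.sum_add_distrib, key]
  ring

/-- The coefficient of `c_{-n}` in the anomaly of the one-particle state `b_{-n} |0⟩` vanishes, where
`n = N + 1`. This is where the dimension and the intercept enter. -/
theorem bb_anomaly_bb_vac (N : ℕ) :
    F.bb (N + 1) (F.anomaly (F.bb (-(N + 1)) F.vac)) = 0 := by
  have hLL := F.L_L_vac N
  have hGG := F.G_G_vac N
  set n : ℤ := N + 1 with hn
  have hn0 : 0 < n := by omega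
  have hQb : ∀ (k : ℤ) x, F.Qt (F.bb k x) + F.bb k (F.Qt x) = F.L k x + F.G k x := fun k x => by
    simpa using LinearMap.congr_fun (F.Qt_bb k) x
  have h1 := hQb (-n) F.vac
  rw [F.Qt_vac, map_zero, add_zero] at h1
  have h2 : F.bb n (F.G (-n) F.vac) = 0 := by
    have := LinearMap.congr_fun (F.G_bb (neg_ne_zero.mpr hn0.ne') n hn0.ne') F.vac
    rw [neg_add_cancel, F.bb_zero] at this
    simpa [F.bb_vac n hn0] using this
  have h3 : F.bb n (F.L (-n) F.vac) = 0 :=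
    apply_of_commute (F.L_bb (neg_ne_zero.mpr hn0.ne') n).symm (F.bb_vac n hn0)
  have h4 := hQb n (F.L (-n) F.vac + F.G (-n) F.vac)
  rw [map_add (F.bb n), h2, h3, add_zero, map_zero, zero_add, map_add (F.L n), map_add (F.G n), hLL, hGG,
    apply_of_commute (F.L_G hn0.ne' (neg_ne_zero.mpr hn0.ne')) (F.L_vac hn0),
    apply_of_commute (F.L_G (neg_ne_zero.mpr hn0.ne') hn0.ne').symm (F.G_vac hn0), add_zero,
    zero_add] at h4
  have h5 : F.M (F.bb (-n) F.vac) = (-2 * n : ℂ) • F.cc (-n) F.vac := by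
    have := LinearMap.congr_fun (F.M_bb (-n)) F.vac
    simpa [F.M_vac] using this
  have h6 : F.L0 (F.cc (-n) F.vac) = (F.r + n) • F.cc (-n) F.vac := by
    have := (F.lev_cc (-n)).apply (t := 0) (x := F.vac) (by rw [F.lev_vac, zero_smul])
    simp only [L0, LinearMap.add_apply, LinearMap.smul_apply, Module.End.one_apply, this]
    push_cast
    module
  simp only [anomaly, LinearMap.add_apply, Module.End.mul_apply]
  rw [h1, h5, map_add, h4, map_smul, h6, map_smul, map_smul,
    F.bb_cc_apply hn0.ne' (F.bb_vac n hn0), smul_smul, ← add_smul, ← add_smul]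
  convert zero_smul ℂ F.vac
  have := anomaly_cancellation N
  rw [hn]
  push_cast
  linear_combination this

end OscillatorRep

namespace OscillatorRep

variable {E : Type*} [AddCommGroup E] [Module ℂ E] (F : OscillatorRep E)

/-! ### Nilpotency -/

theorem bijOn_M_pow (n : ℕ) : Set.BijOn (F.M ^ n : Module.End ℂ E)
    {x | F.gh x = (-n : ℂ) • x} {x | F.gh x = (n : ℂ) • x} :=
  bijOn_pow_weight F.M_lower F.gh_M F.gh_lower F.M_nilpotent F.lower_nilpotent n

/-- States without matter excitations and without `b` excitations: the modes `c_m`, `m > 0`, which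
remove the `b_{-m}`, annihilate them. -/
def PureC (y : E) : Prop := ∀ m, 0 < m → F.cc m y = 0 ∧ ∀ μ, F.aa μ m y = 0

variable {F}

theorem PureC.bb {y : E} (hy : F.PureC y) {m : ℤ} (hm : 0 < m) : F.PureC (F.bb m y) := fun k hk =>
  ⟨apply_of_anticommute (F.cc_bb_of_ne (by omega)) (hy k hk).1,
    fun μ => apply_of_commute (F.aa_bb μ k m) ((hy k hk).2 μ)⟩

/-- A state in which `c_n` and `b_n` vanish for `n > 0` has ghost number zero. -/
theorem PureC.gh_eq_zero {y : E} (hy : F.PureC y) (hb : ∀ m, 0 < m → F.bb m y = 0) : F.gh y = 0 :=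
  apply_eq_zero_of_hasOpSum_ite F.hasOpSum_gh fun k hk => by simp [(hy k hk).1, hb k hk]

theorem PureC.lev_eq_zero {y : E} (hy : F.PureC y) (hb : ∀ m, 0 < m → F.bb m y = 0) :
    F.lev y = 0 := by
  rw [F.lev_eq, LinearMap.add_apply,
    apply_eq_zero_of_hasOpSum_ite F.hasOpSum_levGhost fun k hk => by simp [(hy k hk).1, hb k hk],
    apply_eq_zero_of_hasOpSum_ite F.hasOpSum_levMatter fun k hk => by
      simp [(hy k hk).2, LinearMap.sum_apply], add_zero]

/-- A state without `b` excitations is annihilated by `M`, so that its ghost number cannot be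
negative. -/
theorem PureC.eq_zero_of_neg {y : E} (hy : F.PureC y) {n : ℕ} (hn : 0 < n)
    (hgh : F.gh y = (-n : ℂ) • y) : y = 0 := by
  have hM : F.M y = 0 := apply_eq_zero_of_hasOpSum_ite F.hasOpSum_M fun k hk => by simp [(hy k hk).1]
  have hMn : (F.M ^ n) y = 0 := by
    obtain ⟨j, rfl⟩ := Nat.exists_eq_succ_of_ne_zero hn.ne'
    rw [pow_succ, Module.End.mul_apply, hM, map_zero]
  exact (F.bijOn_M_pow n).injOn hgh (show F.gh 0 = (-n : ℂ) • (0 : E) by simp) (by rw [hMn, map_zero])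

/-- At ghost number zero and without `b` excitations only the vacuum level is possible. -/
theorem PureC.eq_zero_of_zero {y : E} (hy : F.PureC y) (hgh : F.gh y = 0) {N : ℂ} (hN : N ≠ 0)
    (hlev : F.lev y = N • y) : y = 0 := by
  have hb : ∀ m, 0 < m → F.bb m y = 0 := fun m hm =>
    (hy.bb hm).eq_zero_of_neg one_pos
      (((F.gh_bb m).apply (t := 0) (by rw [hgh, zero_smul])).trans (by norm_num))
  rw [hy.lev_eq_zero hb] at hlev
  exact (smul_eq_zero.mp hlev.symm).resolve_left hN

/-- At ghost number one, level `N` and without `b` excitations the only possible excitation is `c_{-N}`,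
which `b_N` detects. -/
theorem PureC.eq_zero_of_one {y : E} (hy : F.PureC y) (hgh : F.gh y = y) {N : ℤ}
    (hlev : F.lev y = (N : ℂ) • y) (hb : F.bb N y = 0) : y = 0 := by
  have hb' : ∀ m, 0 < m → F.bb m y = 0 := by
    intro m hm
    by_cases hmN : m = N
    · rw [hmN, hb]
    · refine (hy.bb hm).eq_zero_of_zero
        (((F.gh_bb m).apply (t := 1) (by rw [hgh, one_smul])).trans (by simp))
        (N := -m + N) ?_ ((F.lev_bb m).apply hlev)
      intro hc
      apply hmN
      have : (m : ℂ) = N := by linear_combination -hc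
      exact_mod_cast this
  rw [← hgh, hy.gh_eq_zero hb']

variable (F)

/-- The product of the creation operators `b_{-(k+1)}` with `k` in the list. -/
def bList (l : List ℕ) : Module.End ℂ E := (l.map fun k : ℕ => F.bb (-(k + 1))).prod

theorem bList_nil : F.bList [] = 1 := rfl

theorem bList_cons (k : ℕ) (l : List ℕ) : F.bList (k :: l) = F.bb (-(k + 1)) * F.bList l := by
  simp [bList]

theorem bList_concat (k : ℕ) (l : List ℕ) :
    F.bList (l ++ [k]) = F.bList l * F.bb (-(k + 1)) := by
  simp [bList]

theorem gh_bList (l : List ℕ) : F.gh (F.bList l F.vac) = (-l.length : ℂ) • F.bList l F.vac := by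
  induction l with
  | nil => simp [bList_nil, F.gh_vac]
  | cons k l ih =>
    rw [bList_cons, Module.End.mul_apply, (F.gh_bb _).apply ih, List.length_cons]
    congr 1
    push_cast
    ring

theorem lev_bList (l : List ℕ) : F.lev (F.bList l F.vac) =
    (((l.map fun k => k + 1).sum : ℕ) : ℂ) • F.bList l F.vac := by
  induction l with
  | nil => simp [bList_nil, F.lev_vac]
  | cons k l ih =>
    rw [bList_cons, Module.End.mul_apply, (F.lev_bb _).apply ih, List.map_cons, List.sum_cons]
    congr 1
    push_cast
    ring

theorem aa_bList (l : List ℕ) (μ : Fin 26) {m : ℤ} (hm : 0 < m) :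
    F.aa μ m (F.bList l F.vac) = 0 := by
  induction l with
  | nil => simp [bList_nil, F.aa_vac μ m hm]
  | cons k l ih =>
    rw [bList_cons, Module.End.mul_apply]
    exact apply_of_commute (F.aa_bb _ _ _) ih

/-- The modes `c_m`, `m > 0`, remove one of the `b` excitations. -/
theorem cc_bList (l : List ℕ) {m : ℤ} (hm : 0 < m) : F.cc m (F.bList l F.vac) ∈
    Submodule.span ℂ {y | ∃ l' : List ℕ, l'.length + 1 = l.length ∧ F.bList l' F.vac = y} := by
  induction l with
  | nil =>
    simp only [bList_nil, Module.End.one_apply, F.cc_vac m hm]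
    exact Submodule.zero_mem _
  | cons k l ih =>
    have h := LinearMap.congr_fun (F.cc_bb m (-(k + 1))) (F.bList l F.vac)
    simp only [LinearMap.add_apply, Module.End.mul_apply] at h
    rw [bList_cons, Module.End.mul_apply, eq_sub_of_add_eq h]
    refine Submodule.sub_mem _ ?_ ?_
    · split_ifs
      · exact Submodule.subset_span ⟨l, rfl, rfl⟩
      · exact Submodule.zero_mem _
    · have := Submodule.mem_map_of_mem (f := F.bb (-(k + 1))) ih
      rw [Submodule.map_span] at this
      refine Submodule.span_mono ?_ this
      rintro _ ⟨_, ⟨l', hl', rfl⟩, rfl⟩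
      exact ⟨k :: l', by simp [hl'], by rw [bList_cons, Module.End.mul_apply]⟩

theorem anomaly_vac : F.anomaly F.vac = 0 := by
  simp [anomaly, F.Qt_vac, F.M_vac]

/-- The anomaly vanishes on the states that contain only `b` excitations: it maps a state with `k` of
them to one of ghost number `2 - k` without `b` excitations, and so only `k = 1` requires the explicit
value of the central charges. -/
theorem anomaly_bList (n : ℕ) : ∀ l : List ℕ, l.length = n → F.anomaly (F.bList l F.vac) = 0 := by
  induction n with
  | zero =>
    intro l hl
    rw [List.length_eq_zero_iff.mp hl, bList_nil, Module.End.one_apply, anomaly_vac]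
  | succ n ih =>
    intro l hl
    have hp : F.PureC (F.anomaly (F.bList l F.vac)) := by
      refine fun m hm => ⟨?_, fun μ => apply_of_commute (F.anomaly_aa μ m).symm (F.aa_bList l μ hm)⟩
      have h1 : F.cc m (F.bList l F.vac) ∈ LinearMap.ker F.anomaly := by
        refine Submodule.span_le.mpr ?_ (F.cc_bList l hm)
        rintro _ ⟨l', hl', rfl⟩
        exact ih l' (by omega)
      have h2 := LinearMap.congr_fun (F.anomaly_cc m).eq (F.bList l F.vac)
      rw [Module.End.mul_apply, Module.End.mul_apply, LinearMap.mem_ker.mp h1] at h2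
      exact h2.symm
    have hgh := F.gh_anomaly.apply (F.gh_bList l)
    have hlev := (HasWeight.of_commute F.lev_anomaly).apply (F.lev_bList l)
    rw [hl] at hgh
    match n, l, hl with
    | 0, [k], _ =>
      refine hp.eq_zero_of_one (hgh.trans ?_) (N := k + 1) (hlev.trans ?_) ?_
      · norm_num
      · push_cast
        simp
      · rw [bList_cons, bList_nil, mul_one]
        exact F.bb_anomaly_bb_vac k
    | 1, [k, j], _ =>
      refine hp.eq_zero_of_zero (hgh.trans ?_) (N := ((k + 1 + (j + 1) : ℕ) : ℂ)) ?_ (hlev.trans ?_)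
      · norm_num
      · exact Nat.cast_ne_zero.mpr (by omega)
      · simp
    | n + 2, l, _ =>
      refine hp.eq_zero_of_neg (n := n + 1) (by omega) (hgh.trans ?_)
      congr 1
      push_cast
      ring

/-- `bList l` moves past every operator that commutes or anticommutes with the modes of `b`. -/
theorem bList_mul_eq_smul {A : Module.End ℂ E} (hA : ∀ k : ℕ, ∃ ε : ℂ,
    F.bb (-(k + 1)) * A = ε • (A * F.bb (-(k + 1)))) (l : List ℕ) :
    ∃ ε : ℂ, F.bList l * A = ε • (A * F.bList l) := by
  induction l with
  | nil => exact ⟨1, by simp [bList_nil]⟩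
  | cons k l ih =>
    obtain ⟨ε, h⟩ := ih
    obtain ⟨ε', h'⟩ := hA k
    exact ⟨ε * ε', by
      rw [bList_cons, mul_assoc, h, mul_smul_comm, ← mul_assoc, h', smul_mul_assoc, smul_smul,
        mul_assoc]⟩

/-- `Q̃² + L_0 M = 0`. The anomaly commutes with all creation operators except those of `b`; the
induction over the Fock space therefore carries along all products of the latter. -/
theorem anomaly_eq_zero : F.anomaly = 0 := by
  have key : ∀ A, Commute F.anomaly A → (∀ k : ℕ, ∃ ε : ℂ,
      F.bb (-(k + 1)) * A = ε • (A * F.bb (-(k + 1)))) → ∀ x,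
      (∀ l, F.anomaly (F.bList l x) = 0) → ∀ l, F.anomaly (F.bList l (A x)) = 0 := by
    intro A hA hbA x hx l
    obtain ⟨ε, h⟩ := F.bList_mul_eq_smul hbA l
    rw [← Module.End.mul_apply (F.bList l), h, LinearMap.smul_apply, map_smul, Module.End.mul_apply,
      apply_of_commute hA (hx l), smul_zero]
  refine LinearMap.ext fun x => ?_
  refine F.induction (fun x => ∀ l, F.anomaly (F.bList l x) = 0) (fun l => F.anomaly_bList _ l rfl)
    (fun x y hx hy l => by rw [map_add, map_add, hx, hy, add_zero])
    (fun t x hx l => by rw [map_smul, map_smul, hx, smul_zero]) ?_ ?_ ?_ ?_ x []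
  · exact fun μ m _ => key _ (F.anomaly_aa μ m) fun k => ⟨1, by rw [one_smul, (F.aa_bb _ _ _).eq]⟩
  · intro m hm x hx l
    have h := hx (l ++ [(-m - 1).toNat])
    have hk : -((((-m - 1).toNat : ℕ) : ℤ) + 1) = m := by omega
    rwa [bList_concat, hk] at h
  · exact fun m hm => key _ (F.anomaly_cc m) fun k => ⟨-1, by
      rw [F.bb_cc_of_ne (by omega), neg_smul, one_smul]⟩
  · exact key _ F.anomaly_c0 fun k => ⟨-1, by rw [c0_bb, smul_neg, neg_smul, one_smul, neg_neg]⟩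

end OscillatorRep

/-! ### Gauge fixing at a fixed momentum and level -/

/-- The algebraic relations among `b_0`, `c_0`, `M`, `Q̃`, the ghost number and the level that decide
about gauge fixing. The number `r` is `L_0` minus the level. -/
structure GaugeData (E : Type*) [AddCommGroup E] [Module ℂ E] where
  b0 : Module.End ℂ E
  c0 : Module.End ℂ E
  M : Module.End ℂ E
  Qt : Module.End ℂ E
  gh : Module.End ℂ E
  lev : Module.End ℂ E
  r : ℂ
  b0_c0 : b0 * c0 + c0 * b0 = 1
  c0_c0 : c0 * c0 = 0
  M_b0 : M * b0 = b0 * M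
  M_c0 : M * c0 = c0 * M
  Qt_b0 : Qt * b0 + b0 * Qt = 0
  Qt_c0 : Qt * c0 + c0 * Qt = 0
  gh_b0 : gh * b0 = b0 * gh
  gh_M : gh * M = M * gh + (2 : ℂ) • M
  gh_Qt : gh * Qt = Qt * gh + Qt
  lev_c0 : lev * c0 = c0 * lev
  lev_gh : lev * gh = gh * lev
  lev_M : lev * M = M * lev
  lev_Qt : lev * Qt = Qt * lev
  Qt_Qt : Qt * Qt + (r • 1 + lev) * M = 0
  bijOn : ∀ n : ℕ, Set.BijOn (M ^ n : Module.End ℂ E) {x | gh x = (-n : ℂ) • x}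
    {x | gh x = (n : ℂ) • x}

namespace GaugeData

variable {E : Type*} [AddCommGroup E] [Module ℂ E] (D : GaugeData E)

/-- The states annihilated by `b_0`, of level `N` and ghost number `m`. -/
def states (N : ℂ) (m : ℤ) : Submodule ℂ E :=
  LinearMap.ker D.b0 ⊓ LinearMap.eqLocus D.gh ((m : ℂ) • LinearMap.id) ⊓
    LinearMap.eqLocus D.lev (N • LinearMap.id)

variable {D} {N : ℂ} {m : ℤ} {x : E}

theorem mem_states : x ∈ D.states N m ↔ D.b0 x = 0 ∧ D.gh x = (m : ℂ) • x ∧ D.lev x = N • x := by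
  simp [states, and_assoc]

variable (D) in
/-- The BRST operator `Q̃ + c_0 L_0 + b_0 M`. -/
def Q : Module.End ℂ E := D.Qt + D.c0 * (D.r • 1 + D.lev) + D.b0 * D.M

theorem Qt_mem (hx : x ∈ D.states N m) : D.Qt x ∈ D.states N (m + 1) := by
  obtain ⟨h1, h2, h3⟩ := mem_states.mp hx
  have e1 := LinearMap.congr_fun D.Qt_b0 x
  have e2 := LinearMap.congr_fun D.gh_Qt x
  have e3 := LinearMap.congr_fun D.lev_Qt x
  simp only [LinearMap.add_apply, Module.End.mul_apply, h1, h2, h3, map_zero, zero_add,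
    LinearMap.zero_apply, map_smul] at e1 e2 e3
  refine mem_states.mpr ⟨e1, ?_, e3⟩
  rw [e2]
  push_cast
  module

theorem M_mem (hx : x ∈ D.states N m) : D.M x ∈ D.states N (m + 2) := by
  obtain ⟨h1, h2, h3⟩ := mem_states.mp hx
  have e1 := LinearMap.congr_fun D.M_b0 x
  have e2 := LinearMap.congr_fun D.gh_M x
  have e3 := LinearMap.congr_fun D.lev_M x
  simp only [LinearMap.add_apply, Module.End.mul_apply, LinearMap.smul_apply, h1, h2, h3, map_zero,
    map_smul] at e1 e2 e3
  refine mem_states.mpr ⟨e1.symm, ?_, e3⟩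
  rw [e2]
  push_cast
  module

theorem M_pow_mem (hx : x ∈ D.states N m) (k : ℕ) : (D.M ^ k) x ∈ D.states N (m + 2 * k) := by
  induction k with
  | zero => simpa using hx
  | succ k ih =>
    rw [pow_succ', Module.End.mul_apply, show m + 2 * ((k + 1 : ℕ) : ℤ) = m + 2 * k + 2 by
      push_cast
      ring]
    exact M_mem ih

variable (D) (N) in
/-- `Mⁿ` restricts to a bijection of the states of level `N`: the conditions `b_0 = 0` and `level = N`
hold for a preimage, since they hold for its image and `Mⁿ` is injective. -/
theorem bijOn_states (n : ℕ) :
    Set.BijOn (D.M ^ n : Module.End ℂ E) (D.states N (-(n : ℤ))) (D.states N n) := by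
  have hM : ∀ {A : Module.End ℂ E}, D.M * A = A * D.M → ∀ x, (D.M ^ n) (A x) = A ((D.M ^ n) x) :=
    fun {A} h x => LinearMap.congr_fun ((show Commute D.M A from h).pow_left n).eq x
  refine ⟨fun x hx => ?_, ?_, fun y hy => ?_⟩
  · have := M_pow_mem hx n
    rwa [show -(n : ℤ) + 2 * n = n by ring] at this
  · exact (D.bijOn n).injOn.mono fun x hx => by simpa using (mem_states.mp hx).2.1
  · obtain ⟨h1, h2, h3⟩ := mem_states.mp hy
    obtain ⟨x, hx, rfl⟩ := (D.bijOn n).surjOn (show y ∈ {x | D.gh x = (n : ℂ) • x} by simpa using h2)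
    have hx' : D.gh x = (-n : ℂ) • x := hx
    have inj : ∀ z, D.gh z = (-n : ℂ) • z → (D.M ^ n) z = 0 → z = 0 := fun z hz h =>
      (D.bijOn n).injOn hz (show D.gh 0 = (-n : ℂ) • (0 : E) by simp) (by rw [h, map_zero])
    refine ⟨x, mem_states.mpr ⟨inj _ ?_ ?_, by simpa using hx', sub_eq_zero.mp (inj _ ?_ ?_)⟩, rfl⟩
    · rw [← Module.End.mul_apply, D.gh_b0, Module.End.mul_apply, hx', map_smul]
    · rw [hM D.M_b0, h1]
    · have := LinearMap.congr_fun D.lev_gh x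
      rw [Module.End.mul_apply, Module.End.mul_apply, hx', map_smul] at this
      rw [map_sub, map_smul, ← this, hx', smul_sub, smul_comm N]
    · rw [map_sub, map_smul, hM D.lev_M.symm, h3, sub_self]

theorem eq_zero_of_M_pow {n : ℕ} (hx : x ∈ D.states N (-(n : ℤ))) (h : (D.M ^ n) x = 0) : x = 0 :=
  (D.bijOn_states N n).injOn hx (Submodule.zero_mem _) (by rw [h, map_zero])

theorem Qt_Qt_apply (hx : x ∈ D.states N m) : D.Qt (D.Qt x) = -((D.r + N) • D.M x) := by
  have h := LinearMap.congr_fun D.Qt_Qt x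
  simp only [LinearMap.add_apply, Module.End.mul_apply, LinearMap.smul_apply, Module.End.one_apply,
    (mem_states.mp (M_mem hx)).2.2, LinearMap.zero_apply, ← add_smul] at h
  exact eq_neg_of_add_eq_zero_left h

/-- Off shell, `M` is proportional to `Q̃²` and hence commutes with `Q̃`. -/
theorem Qt_M (hN : D.r + N ≠ 0) (hx : x ∈ D.states N m) : D.Qt (D.M x) = D.M (D.Qt x) := by
  have h := Qt_Qt_apply (Qt_mem hx)
  rw [Qt_Qt_apply hx, map_neg, map_smul, neg_inj] at h
  exact smul_right_injective _ hN h

theorem Qt_M_pow (hN : D.r + N ≠ 0) (hx : x ∈ D.states N m) (k : ℕ) :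
    D.Qt ((D.M ^ k) x) = (D.M ^ k) (D.Qt x) := by
  induction k with
  | zero => simp
  | succ k ih =>
    rw [pow_succ', Module.End.mul_apply, Module.End.mul_apply, Qt_M hN (M_pow_mem hx k), ih]

theorem Qt_M_pow_Qt (hN : D.r + N ≠ 0) (hx : x ∈ D.states N m) (k : ℕ) :
    D.Qt ((D.M ^ k) (D.Qt x)) = -((D.r + N) • (D.M ^ (k + 1)) x) := by
  rw [← Qt_M_pow hN hx, Qt_Qt_apply (M_pow_mem hx k), pow_succ', Module.End.mul_apply]

/-! #### Ghost number at most one -/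

/-- The parameter solves `L_0 M^{k+1} ξ = Q̃ M^k φ`. -/
theorem exists_landau_low (hN : D.r + N ≠ 0) {k : ℕ} {φ : E} (hφ : φ ∈ D.states N (-(k : ℤ))) :
    ∃ ξ ∈ D.states N (-((k + 1 : ℕ) : ℤ)), D.Qt ((D.M ^ k) (φ + D.Qt ξ)) = 0 := by
  have h1 : (D.r + N)⁻¹ • D.Qt ((D.M ^ k) φ) ∈ D.states N ((k + 1 : ℕ) : ℤ) := by
    have := Submodule.smul_mem _ (D.r + N)⁻¹ (Qt_mem (M_pow_mem hφ k))
    rwa [show -(k : ℤ) + 2 * k + 1 = ((k + 1 : ℕ) : ℤ) by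
      push_cast
      ring] at this
  obtain ⟨ξ, hξ, h2⟩ := (D.bijOn_states N (k + 1)).surjOn h1
  refine ⟨ξ, hξ, ?_⟩
  rw [map_add, map_add, Qt_M_pow_Qt hN hξ, h2, smul_inv_smul₀ hN, add_neg_cancel]

theorem eq_zero_of_landau_low (hN : D.r + N ≠ 0) {k : ℕ} {ξ : E}
    (hξ : ξ ∈ D.states N (-((k + 1 : ℕ) : ℤ))) (h : D.Qt ((D.M ^ k) (D.Qt ξ)) = 0) : ξ = 0 := by
  rw [Qt_M_pow_Qt hN hξ, neg_eq_zero] at h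
  exact eq_zero_of_M_pow hξ ((smul_eq_zero.mp h).resolve_left hN)

/-! #### Ghost number at least two -/

/-- The parameter is `ξ = L_0⁻¹ (Q̃ M^k f - ω)`, where `f` solves `M^{k+1} f = φ - L_0⁻¹ Q̃ ω`. -/
theorem exists_landau_high (hN : D.r + N ≠ 0) {k : ℕ} {φ ω : E}
    (hφ : φ ∈ D.states N ((k + 1 : ℕ) : ℤ)) (hω : ω ∈ D.states N (k : ℤ)) :
    ∃ ξ ∈ D.states N (k : ℤ), φ + D.Qt ξ = 0 ∧
      ∃ f ∈ D.states N (-((k + 1 : ℕ) : ℤ)), D.Qt ((D.M ^ k) f) = ω + (D.r + N) • ξ := by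
  have h1 : φ - (D.r + N)⁻¹ • D.Qt ω ∈ D.states N ((k + 1 : ℕ) : ℤ) := by
    refine Submodule.sub_mem _ hφ (Submodule.smul_mem _ _ ?_)
    have := Qt_mem hω
    rwa [show (k : ℤ) + 1 = ((k + 1 : ℕ) : ℤ) by push_cast; ring] at this
  obtain ⟨f, hf, h2⟩ := (D.bijOn_states N (k + 1)).surjOn h1
  have h3 : D.Qt ((D.M ^ k) f) ∈ D.states N (k : ℤ) := by
    have := Qt_mem (M_pow_mem hf k)
    rwa [show -((k + 1 : ℕ) : ℤ) + 2 * k + 1 = k by push_cast; ring] at this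
  refine ⟨(D.r + N)⁻¹ • (D.Qt ((D.M ^ k) f) - ω),
    Submodule.smul_mem _ _ (Submodule.sub_mem _ h3 hω), ?_, f, hf, ?_⟩
  · rw [map_smul, map_sub, Qt_Qt_apply (M_pow_mem hf k), ← Module.End.mul_apply, ← pow_succ', h2,
      smul_sub, smul_neg, inv_smul_smul₀ hN]
    abel
  · rw [smul_inv_smul₀ hN]
    abel

theorem eq_zero_of_landau_high (hN : D.r + N ≠ 0) {k : ℕ} {ω ξ f f' : E}
    (hf : f ∈ D.states N (-((k + 1 : ℕ) : ℤ))) (hf' : f' ∈ D.states N (-((k + 1 : ℕ) : ℤ)))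
    (h : D.Qt ((D.M ^ k) f) = ω) (h' : D.Qt ((D.M ^ k) f') = ω + (D.r + N) • ξ)
    (hξ : D.Qt ξ = 0) : ξ = 0 := by
  have hg := Submodule.sub_mem _ hf' hf
  have h1 : D.Qt ((D.M ^ k) (f' - f)) = (D.r + N) • ξ := by
    rw [map_sub, map_sub, h, h', add_sub_cancel_left]
  have h2 := congrArg D.Qt h1
  rw [Qt_Qt_apply (M_pow_mem hg k), map_smul, hξ, smul_zero, neg_eq_zero, ← Module.End.mul_apply,
    ← pow_succ'] at h2
  rw [eq_zero_of_M_pow hg ((smul_eq_zero.mp h2).resolve_left hN), map_zero, map_zero] at h1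
  exact (smul_eq_zero.mp h1.symm).resolve_left hN

/-- `Q̃` is injective at negative ghost number; in particular `Q̃ W φ = 0` forces `W φ = 0`. -/
theorem eq_zero_of_Qt_W (hN : D.r + N ≠ 0) {k : ℕ} {f : E}
    (hf : f ∈ D.states N (-((k + 1 : ℕ) : ℤ))) (h : D.Qt f = 0) : f = 0 := by
  have h1 := Qt_Qt_apply hf
  rw [h, map_zero, eq_comm, neg_eq_zero] at h1
  refine eq_zero_of_M_pow hf ?_
  rw [pow_succ, Module.End.mul_apply, (smul_eq_zero.mp h1).resolve_left hN, map_zero]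

/-! #### String fields -/

theorem b0_c0_apply (hx : x ∈ D.states N m) : D.b0 (D.c0 x) = x := by
  have := LinearMap.congr_fun D.b0_c0 x
  simpa [(mem_states.mp hx).1] using this

theorem c0_c0_apply (x : E) : D.c0 (D.c0 x) = 0 := LinearMap.congr_fun D.c0_c0 x

theorem phi_apply {φ ω : E} (hφ : φ ∈ D.states N m) :
    D.b0 (D.c0 (φ + D.c0 ω)) = φ := by
  rw [map_add, c0_c0_apply, add_zero, b0_c0_apply hφ]

theorem omega_apply {m' : ℤ} {φ ω : E} (hφ : φ ∈ D.states N m) (hω : ω ∈ D.states N m') :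
    D.b0 (φ + D.c0 ω) = ω := by
  rw [map_add, b0_c0_apply hω, (mem_states.mp hφ).1, zero_add]

/-- `b_0 c_0 Q̃ M^k (φ + c_0 ω) = Q̃ M^k φ`. -/
theorem b0_c0_Qt_M_pow {φ : E} (hφ : φ ∈ D.states N m) (ω : E) (k : ℕ) :
    D.b0 (D.c0 (D.Qt ((D.M ^ k) (φ + D.c0 ω)))) = D.Qt ((D.M ^ k) φ) := by
  have h1 : (D.M ^ k) (D.c0 ω) = D.c0 ((D.M ^ k) ω) :=
    LinearMap.congr_fun ((show Commute D.M D.c0 from D.M_c0).pow_left k).eq ω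
  have h2 : D.Qt (D.c0 ((D.M ^ k) ω)) = -D.c0 (D.Qt ((D.M ^ k) ω)) :=
    eq_neg_of_add_eq_zero_left (LinearMap.congr_fun D.Qt_c0 ((D.M ^ k) ω))
  rw [map_add, h1, map_add, h2, map_add, map_neg, c0_c0_apply, neg_zero, add_zero,
    b0_c0_apply (Qt_mem (M_pow_mem hφ k))]

theorem Q_apply {m' : ℤ} {φ ω : E} (hφ : φ ∈ D.states N m) (hω : ω ∈ D.states N m') :
    D.Q (φ + D.c0 ω) = D.Qt φ + D.M ω + D.c0 ((D.r + N) • φ - D.Qt ω) := by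
  obtain ⟨h1, -, h3⟩ := mem_states.mp hφ
  obtain ⟨-, -, h4⟩ := mem_states.mp hω
  have e1 : D.Qt (D.c0 ω) = -D.c0 (D.Qt ω) :=
    eq_neg_of_add_eq_zero_left (LinearMap.congr_fun D.Qt_c0 ω)
  have e2 : D.M (D.c0 ω) = D.c0 (D.M ω) := LinearMap.congr_fun D.M_c0 ω
  have e3 : D.lev (D.c0 ω) = D.c0 (D.lev ω) := LinearMap.congr_fun D.lev_c0 ω
  simp only [Q, LinearMap.add_apply, Module.End.mul_apply, LinearMap.smul_apply, Module.End.one_apply,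
    map_add, map_smul, h3, e1, e2, e3, h4, c0_c0_apply, (mem_states.mp (M_mem hφ)).1,
    b0_c0_apply (M_mem hω), map_sub]
  module

/-- Off shell, every gauge variation is generated by a parameter without `c_0` part. -/
theorem exists_Q_eq (hN : D.r + N ≠ 0) {m' : ℤ} (hm : m' + 1 = m) {ξ χ : E}
    (hξ : ξ ∈ D.states N m) (hχ : χ ∈ D.states N m') :
    ∃ ζ ∈ D.states N m, D.Q (ξ + D.c0 χ) = D.Qt ζ + D.c0 ((D.r + N) • ζ) := by
  refine ⟨ξ - (D.r + N)⁻¹ • D.Qt χ,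
    Submodule.sub_mem _ hξ (Submodule.smul_mem _ _ (hm ▸ Qt_mem hχ)), ?_⟩
  rw [Q_apply hξ hχ, map_sub D.Qt, map_smul D.Qt, Qt_Qt_apply hχ, smul_neg, inv_smul_smul₀ hN,
    smul_sub (D.r + N), smul_inv_smul₀ hN, sub_neg_eq_add]

end GaugeData

/-! ### Gauge fixing of string fields -/

section Family

open GaugeData

variable {ι E : Type*} [AddCommGroup E] [Module ℂ E] (D : ι → GaugeData E) (N : ι → ℂ)

/-- String fields `φ^{(n-1)} + c_0 ω^{(n-2)}` of ghost number `n`. -/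
def IsStringField (n : ℤ) (Φ : ι → E) : Prop :=
  ∀ s, ∃ φ ∈ (D s).states (N s) (n - 1), ∃ ω ∈ (D s).states (N s) (n - 2), φ + (D s).c0 ω = Φ s

variable {D N}

/-- A condition that is imposed separately at every momentum and level exactly fixes the gauge symmetry
if it does so for gauge parameters `ξ` without `c_0` part, which act by `δφ = Q̃ ξ`, `δω = L_0 ξ`. -/
theorem exactly_fixes (hN : ∀ s, (D s).r + N s ≠ 0) (n : ℤ) (P : ι → E → Prop)
    (hex : ∀ s, ∀ φ ∈ (D s).states (N s) (n - 1), ∀ ω ∈ (D s).states (N s) (n - 2),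
      ∃ ξ ∈ (D s).states (N s) (n - 2),
        P s ((φ + (D s).Qt ξ) + (D s).c0 (ω + ((D s).r + N s) • ξ)))
    (hun : ∀ s, ∀ φ ∈ (D s).states (N s) (n - 1), ∀ ω ∈ (D s).states (N s) (n - 2),
      ∀ ξ ∈ (D s).states (N s) (n - 2), P s (φ + (D s).c0 ω) →
        P s ((φ + (D s).Qt ξ) + (D s).c0 (ω + ((D s).r + N s) • ξ)) → ξ = 0) :
    (∀ Φ, IsStringField D N n Φ → ∃ Λ, IsStringField D N (n - 1) Λ ∧
      IsStringField D N n (Φ + fun s => (D s).Q (Λ s)) ∧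
        ∀ s, P s ((Φ + fun s => (D s).Q (Λ s)) s)) ∧
    (∀ Φ, IsStringField D N n Φ → (∀ s, P s (Φ s)) → ∀ Λ, IsStringField D N (n - 1) Λ →
      (∀ s, P s ((Φ + fun s => (D s).Q (Λ s)) s)) → (fun s => (D s).Q (Λ s)) = 0) := by
  constructor
  · intro Φ hΦ
    choose φ hφ ω hω hΦ' using hΦ
    choose ξ hξ hP using fun s => hex s (φ s) (hφ s) (ω s) (hω s)
    have e : ∀ s, Φ s + (D s).Q (ξ s) =
        (φ s + (D s).Qt (ξ s)) + (D s).c0 (ω s + ((D s).r + N s) • ξ s) := by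
      intro s
      have := Q_apply (hξ s) (Submodule.zero_mem ((D s).states (N s) 0))
      simp only [map_zero, add_zero, sub_zero] at this
      rw [this, ← hΦ' s, map_add]
      abel
    refine ⟨ξ, fun s => ⟨ξ s, ?_, 0, Submodule.zero_mem _, by simp⟩, fun s => ?_, fun s => ?_⟩
    · rw [show n - 1 - 1 = n - 2 by ring]
      exact hξ s
    · refine ⟨_, Submodule.add_mem _ (hφ s) ?_, _,
        Submodule.add_mem _ (hω s) (Submodule.smul_mem _ ((D s).r + N s) (hξ s)), (e s).symm⟩
      have := Qt_mem (hξ s)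
      rwa [show n - 2 + 1 = n - 1 by ring] at this
    · have := hP s
      rw [← e s] at this
      exact this
  · intro Φ hΦ hP Λ hΛ hP'
    funext s
    obtain ⟨φ, hφ, ω, hω, hΦs⟩ := hΦ s
    obtain ⟨ξ, hξ, χ, hχ, hΛs⟩ := hΛ s
    rw [show n - 1 - 1 = n - 2 by ring] at hξ
    obtain ⟨ζ, hζ, hQ⟩ := exists_Q_eq (hN s) (by ring) hξ hχ
    have e : Φ s + (D s).Q (Λ s) =
        (φ + (D s).Qt ζ) + (D s).c0 (ω + ((D s).r + N s) • ζ) := by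
      rw [← hΛs, hQ, ← hΦs, map_add]
      abel
    have h0 : ζ = 0 := by
      refine hun s φ hφ ω hω ζ hζ ?_ ?_
      · rw [hΦs]
        exact hP s
      · rw [← e]
        exact hP' s
    rw [h0] at hQ
    simpa [← hΛs] using hQ

end Family

/-! ### The oscillator algebra of the matter and ghost sectors -/

theorem alpha_zero (α' : ℝ) (p : Momentum) (μ : Fin 26) :
    alpha α' p μ 0 = ((Real.sqrt (2 * α') * p μ : ℝ) : ℂ) • 1 := rfl

theorem alpha_commutator (α' : ℝ) (p : Momentum) (μ ν : Fin 26) (m n : ℤ) :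
    alpha α' p μ m * alpha α' p ν n = alpha α' p ν n * alpha α' p μ m +
      (if m + n = 0 ∧ μ = ν then (m : ℂ) * eta μ else 0) • 1 := by
  have XX : ∀ k l : ℕ, ∀ x : MatterFock,
      MvPolynomial.X (k, μ) * (MvPolynomial.X (l, ν) * x) =
        MvPolynomial.X (l, ν) * (MvPolynomial.X (k, μ) * x) := fun k l x => by ring
  have DD : ∀ a b : ℕ × Fin 26, ∀ x : MatterFock,
      MvPolynomial.pderiv a (MvPolynomial.pderiv b x) =
        MvPolynomial.pderiv b (MvPolynomial.pderiv a x) := fun a b x => by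
    have := Derivation.commutator_apply (D1 := MvPolynomial.pderiv (R := ℂ) a)
      (D2 := MvPolynomial.pderiv (R := ℂ) b) x
    have h0 : ⁅MvPolynomial.pderiv (R := ℂ) a, MvPolynomial.pderiv (R := ℂ) b⁆ = 0 := by
      refine MvPolynomial.derivation_ext fun i => ?_
      simp only [Derivation.commutator_apply, MvPolynomial.pderiv_X, Derivation.zero_apply]
      simp [Pi.single_apply, apply_ite]
    rw [h0, Derivation.zero_apply] at this
    exact sub_eq_zero.mp this.symm
  refine LinearMap.ext fun x => ?_
  match m, n with
  | .ofNat 0, n =>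
    simp [alpha_zero]
  | m, .ofNat 0 =>
    by_cases h : m = 0
    · simp [alpha_zero, h]
      exact smul_comm _ _ _
    · simp [alpha_zero, h]
  | .ofNat (k + 1), .ofNat (l + 1) =>
    rw [if_neg (by simp only [Int.ofNat_eq_natCast]; omega)]
    simp [alpha, DD (k, μ), smul_smul, mul_comm]
  | .negSucc k, .negSucc l =>
    rw [if_neg (by omega)]
    simp [alpha, XX]
  | .ofNat (k + 1), .negSucc l =>
    by_cases h : (l, ν) = (k, μ)
    · obtain ⟨rfl, rfl⟩ := Prod.mk.inj h
      rw [if_pos ⟨by simp only [Int.ofNat_eq_natCast]; omega, rfl⟩]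
      simp [alpha, Derivation.leibniz, smul_add]
    · rw [if_neg fun hc => h (by
        have h1 := hc.1
        simp only [Int.ofNat_eq_natCast] at h1
        rw [hc.2, show l = k by omega])]
      simp [alpha, Derivation.leibniz, MvPolynomial.pderiv_X, h]
  | .negSucc k, .ofNat (l + 1) =>
    by_cases h : (k, μ) = (l, ν)
    · obtain ⟨rfl, rfl⟩ := Prod.mk.inj h
      rw [if_pos ⟨by simp only [Int.ofNat_eq_natCast]; omega, rfl⟩]
      simp [alpha, Derivation.leibniz, smul_add, Int.negSucc_eq]
      module
    · rw [if_neg fun hc => h (by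
        have h1 := hc.1
        simp only [Int.ofNat_eq_natCast] at h1
        rw [hc.2, show k = l by omega])]
      simp [alpha, Derivation.leibniz, MvPolynomial.pderiv_X, h]

theorem ghostCreate_anticommutator (g h : GhostGen) :
    ghostCreate g * ghostCreate h + ghostCreate h * ghostCreate g = 0 := by
  refine LinearMap.ext fun x => ?_
  simp only [ghostCreate, LinearMap.add_apply, Module.End.mul_apply, LinearMap.mulLeft_apply,
    ← mul_assoc, ← add_mul, ExteriorAlgebra.ι_add_mul_swap, zero_mul, LinearMap.zero_apply]

theorem ghostRemove_anticommutator (g h : GhostGen) :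
    ghostRemove g * ghostRemove h + ghostRemove h * ghostRemove g = 0 := by
  refine LinearMap.ext fun x => ?_
  rw [LinearMap.add_apply, Module.End.mul_apply, Module.End.mul_apply]
  exact add_eq_zero_iff_eq_neg.mpr (CliffordAlgebra.contractLeft_comm _ _ x)

open scoped Classical in
theorem ghostRemove_ghostCreate (g h : GhostGen) :
    ghostRemove g * ghostCreate h + ghostCreate h * ghostRemove g = if g = h then 1 else 0 := by
  refine LinearMap.ext fun x => ?_
  by_cases hgh : g = h
  · subst hgh
    simp [ghostRemove, ghostCreate, ExteriorAlgebra.ι, CliffordAlgebra.contractLeft_ι_mul]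
  · simp [ghostRemove, ghostCreate, ExteriorAlgebra.ι, CliffordAlgebra.contractLeft_ι_mul, hgh,
      Finsupp.single_eq_of_ne hgh]

theorem cMode_cMode (m n : ℤ) : cMode m * cMode n + cMode n * cMode m = 0 := by
  refine LinearMap.ext fun x => ?_
  rw [LinearMap.add_apply, Module.End.mul_apply, Module.End.mul_apply, cMode_anticomm, neg_add_cancel,
    LinearMap.zero_apply]

theorem bMode_bMode (m n : ℤ) : bMode m * bMode n + bMode n * bMode m = 0 := by
  have rc : ∀ k l : ℕ, ghostRemove (.c k) * ghostCreate (.b l) +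
      ghostCreate (.b l) * ghostRemove (.c k) = 0 := fun k l => by
    rw [ghostRemove_ghostCreate, if_neg (by simp)]
  match m, n with
  | .ofNat k, .ofNat l => exact ghostRemove_anticommutator _ _
  | .ofNat k, .negSucc l => exact rc _ _
  | .negSucc k, .ofNat l => exact (add_comm _ _).trans (rc _ _)
  | .negSucc k, .negSucc l => exact ghostCreate_anticommutator _ _

theorem bMode_cMode (m n : ℤ) :
    bMode m * cMode n + cMode n * bMode m = if m + n = 0 then 1 else 0 := by
  split_ifs with h
  · obtain rfl : n = -m := by omega
    match m with
    | .ofNat 0 => exact (ghostRemove_ghostCreate _ _).trans (if_pos rfl)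
    | .ofNat (k + 1) => exact (ghostRemove_ghostCreate _ _).trans (if_pos rfl)
    | .negSucc k =>
      exact (add_comm _ _).trans ((ghostRemove_ghostCreate (.b k) (.b k)).trans (if_pos rfl))
  · refine LinearMap.ext fun x => ?_
    rw [LinearMap.add_apply, Module.End.mul_apply, Module.End.mul_apply, bc_anticomm _ _ h,
      neg_add_cancel, LinearMap.zero_apply]

/-! ### The oscillators on the Fock space -/

theorem onGhost_mul (S T : Module.End ℂ GhostFock) : onGhost (S * T) = onGhost S * onGhost T :=
  LinearMap.lTensor_mul _ _ _

theorem onMatter_mul (S T : Module.End ℂ MatterFock) : onMatter (S * T) = onMatter S * onMatter T :=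
  LinearMap.rTensor_mul _ _ _

theorem onMatter_onGhost (S : Module.End ℂ MatterFock) (T : Module.End ℂ GhostFock) :
    Commute (onMatter S) (onGhost T) := by
  refine TensorProduct.ext' fun x y => ?_
  simp [onMatter, onGhost]

theorem onGhost_add (S T : Module.End ℂ GhostFock) : onGhost (S + T) = onGhost S + onGhost T :=
  LinearMap.lTensor_add _ _ _

theorem onGhost_smul (r : ℂ) (T : Module.End ℂ GhostFock) : onGhost (r • T) = r • onGhost T :=
  LinearMap.lTensor_smul _ _ _

theorem onGhost_one : onGhost 1 = 1 := LinearMap.lTensor_id _ _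

theorem onGhost_zero : onGhost 0 = 0 := LinearMap.lTensor_zero _

theorem onMatter_add (S T : Module.End ℂ MatterFock) : onMatter (S + T) = onMatter S + onMatter T :=
  LinearMap.rTensor_add _ _ _

theorem onMatter_smul (r : ℂ) (T : Module.End ℂ MatterFock) : onMatter (r • T) = r • onMatter T :=
  LinearMap.rTensor_smul _ _ _

theorem onMatter_one : onMatter 1 = 1 := LinearMap.rTensor_id _ _

theorem onMatter_zero : onMatter 0 = 0 := LinearMap.rTensor_zero _

theorem onMatter_sum {ι : Type*} (s : Finset ι) (T : ι → Module.End ℂ MatterFock) :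
    onMatter (∑ i ∈ s, T i) = ∑ i ∈ s, onMatter (T i) := by
  classical
  induction s using Finset.induction_on with
  | empty => exact onMatter_zero
  | insert i s hi ih => rw [Finset.sum_insert hi, Finset.sum_insert hi, onMatter_add, ih]

/-- The ghost mode `c_k` on the Fock space for `k ≠ 0`, and `0` for `k = 0`. -/
def cc (k : ℤ) : Module.End ℂ Fock := if k = 0 then 0 else onGhost (cMode k)

/-- The antighost mode `b_k` on the Fock space for `k ≠ 0`, and `0` for `k = 0`. -/
def bb (k : ℤ) : Module.End ℂ Fock := if k = 0 then 0 else onGhost (bMode k)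

/-- The matter oscillator `α_m^μ` on the Fock space. -/
def aa (α' : ℝ) (p : Momentum) (μ : Fin 26) (m : ℤ) : Module.End ℂ Fock := onMatter (alpha α' p μ m)

/-- The matter Virasoro operator on the Fock space. -/
def Lm (α' : ℝ) (p : Momentum) (n : ℤ) : Module.End ℂ Fock := onMatter (virasoro α' p n)

/-- The vacuum `|0,p;↓⟩`. -/
def vac : Fock := 1 ⊗ₜ 1

@[simp] theorem cc_zero : cc 0 = 0 := if_pos rfl
@[simp] theorem bb_zero : bb 0 = 0 := if_pos rfl
theorem cc_of_ne {k : ℤ} (h : k ≠ 0) : cc k = onGhost (cMode k) := if_neg h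
theorem bb_of_ne {k : ℤ} (h : k ≠ 0) : bb k = onGhost (bMode k) := if_neg h

theorem cc_cc (m n : ℤ) : cc m * cc n + cc n * cc m = 0 := by
  by_cases hm : m = 0
  · simp [hm]
  by_cases hn : n = 0
  · simp [hn]
  rw [cc_of_ne hm, cc_of_ne hn, ← onGhost_mul, ← onGhost_mul, ← onGhost_add, cMode_cMode, onGhost_zero]

theorem bb_bb (m n : ℤ) : bb m * bb n + bb n * bb m = 0 := by
  by_cases hm : m = 0
  · simp [hm]
  by_cases hn : n = 0
  · simp [hn]
  rw [bb_of_ne hm, bb_of_ne hn, ← onGhost_mul, ← onGhost_mul, ← onGhost_add, bMode_bMode, onGhost_zero]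

theorem bb_cc (m n : ℤ) :
    bb m * cc n + cc n * bb m = if m + n = 0 ∧ m ≠ 0 then 1 else 0 := by
  by_cases hm : m = 0
  · simp [hm]
  by_cases hn : n = 0
  · simp [hn, hm]
  rw [cc_of_ne hn, bb_of_ne hm, ← onGhost_mul, ← onGhost_mul, ← onGhost_add, bMode_cMode]
  by_cases h : m + n = 0
  · rw [if_pos h, if_pos ⟨h, hm⟩, onGhost_one]
  · rw [if_neg h, if_neg (fun hc => h hc.1), onGhost_zero]

theorem commute_onMatter_cc (S : Module.End ℂ MatterFock) (k : ℤ) : Commute (onMatter S) (cc k) := by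
  unfold cc
  split_ifs
  · exact Commute.zero_right _
  · exact onMatter_onGhost _ _

theorem commute_onMatter_bb (S : Module.End ℂ MatterFock) (k : ℤ) : Commute (onMatter S) (bb k) := by
  unfold bb
  split_ifs
  · exact Commute.zero_right _
  · exact onMatter_onGhost _ _

theorem c0_cc (k : ℤ) : c0 * cc k + cc k * c0 = 0 := by
  by_cases h : k = 0
  · simp [h]
  rw [cc_of_ne h, c0, ← onGhost_mul, ← onGhost_mul, ← onGhost_add, cMode_cMode, onGhost_zero]

theorem c0_bb (k : ℤ) : c0 * bb k + bb k * c0 = 0 := by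
  by_cases h : k = 0
  · simp [h]
  rw [bb_of_ne h, c0, ← onGhost_mul, ← onGhost_mul, ← onGhost_add, add_comm, bMode_cMode,
    if_neg (by omega), onGhost_zero]

theorem b0_cc (k : ℤ) : b0 * cc k + cc k * b0 = 0 := by
  by_cases h : k = 0
  · simp [h]
  rw [cc_of_ne h, b0, ← onGhost_mul, ← onGhost_mul, ← onGhost_add, bMode_cMode, if_neg (by omega),
    onGhost_zero]

theorem b0_bb (k : ℤ) : b0 * bb k + bb k * b0 = 0 := by
  by_cases h : k = 0
  · simp [h]
  rw [bb_of_ne h, b0, ← onGhost_mul, ← onGhost_mul, ← onGhost_add, bMode_bMode, onGhost_zero]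

theorem b0_c0 : b0 * c0 + c0 * b0 = 1 := by
  rw [b0, c0, ← onGhost_mul, ← onGhost_mul, ← onGhost_add, bMode_cMode, if_pos (add_zero 0),
    onGhost_one]

theorem c0_c0 : c0 * c0 = 0 := by
  have h := cMode_cMode 0 0
  rw [← two_smul ℂ, smul_eq_zero_iff_right two_ne_zero] at h
  rw [c0, ← onGhost_mul, h, onGhost_zero]

section Matter

variable (α' : ℝ) (p : Momentum)

theorem aa_aa (μ ν : Fin 26) (m n : ℤ) :
    aa α' p μ m * aa α' p ν n = aa α' p ν n * aa α' p μ m +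
      (if m + n = 0 ∧ μ = ν then (m : ℂ) * eta μ else 0) • 1 := by
  unfold aa
  rw [← onMatter_mul, ← onMatter_mul, alpha_commutator, onMatter_add, onMatter_smul, onMatter_one]

theorem aa_vac (μ : Fin 26) {m : ℤ} (hm : 0 < m) : aa α' p μ m vac = 0 := by
  match m, hm with
  | .ofNat 0, hm => simp at hm
  | .ofNat (k + 1), _ => simp [aa, vac, onMatter, alpha]

theorem aa_zero (μ : Fin 26) : aa α' p μ 0 = ((Real.sqrt (2 * α') * p μ : ℝ) : ℂ) • 1 := by
  rw [aa, alpha_zero, onMatter_smul, onMatter_one]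

/-- The mass-shell relation `α_0² = 2 (L_0 + 1 - N)`. -/
theorem sum_eta_zeroMode {α' : ℝ} (hα : 0 ≤ α') (p : Momentum) :
    ∑ μ, (eta μ : ℂ) * ((Real.sqrt (2 * α') * p μ : ℝ) : ℂ) ^ 2 =
      2 * (((α' * momentumSq p - 1 : ℝ) : ℂ) + 1) := by
  have h : Real.sqrt (2 * α') ^ 2 = 2 * α' := Real.sq_sqrt (by positivity)
  have : ∑ μ, eta μ * (Real.sqrt (2 * α') * p μ) ^ 2 = 2 * ((α' * momentumSq p - 1) + 1) := by
    simp only [mul_pow, h, momentumSq, sub_add_cancel, Finset.mul_sum]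
    exact Finset.sum_congr rfl fun μ _ => by ring
  exact_mod_cast congrArg (fun t : ℝ => (t : ℂ)) this

end Matter

theorem cMode_one {m : ℤ} (hm : 0 < m) : cMode m 1 = 0 := by
  match m, hm with
  | .ofNat 0, hm => simp at hm
  | .ofNat (k + 1), _ => simp [cMode, ghostRemove]

theorem bMode_one {m : ℤ} (hm : 0 ≤ m) : bMode m 1 = 0 := by
  match m, hm with
  | .ofNat k, _ => simp [bMode, ghostRemove]

theorem cc_vac {m : ℤ} (hm : 0 < m) : cc m vac = 0 := by
  rw [cc_of_ne hm.ne', vac, onGhost, LinearMap.lTensor_tmul, cMode_one hm, TensorProduct.tmul_zero]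

theorem bb_vac {m : ℤ} (hm : 0 < m) : bb m vac = 0 := by
  rw [bb_of_ne hm.ne', vac, onGhost, LinearMap.lTensor_tmul, bMode_one hm.le, TensorProduct.tmul_zero]

/-- The Fock space is generated from the vacuum by the creation operators. -/
theorem fock_induction (α' : ℝ) (p : Momentum) {P : Fock → Prop} (vac : P vac)
    (add : ∀ x y, P x → P y → P (x + y)) (smul : ∀ (r : ℂ) x, P x → P (r • x))
    (a : ∀ μ (m : ℤ), m < 0 → ∀ x, P x → P (aa α' p μ m x))
    (b : ∀ m : ℤ, m < 0 → ∀ x, P x → P (bb m x)) (c : ∀ m : ℤ, m < 0 → ∀ x, P x → P (cc m x))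
    (c_zero : ∀ x, P x → P (c0 x)) (x : Fock) : P x := by
  have hcreate : ∀ g x, P x → P (onGhost (ghostCreate g) x) := by
    intro g x hx
    match g with
    | .c 0 => exact c_zero x hx
    | .c (k + 1) => exact c (.negSucc k) (Int.negSucc_lt_zero k) x hx
    | .b k => exact b (.negSucc k) (Int.negSucc_lt_zero k) x hx
  have hzero : P 0 := by simpa using smul 0 _ vac
  have hghost : ∀ z : GhostFock, P (1 ⊗ₜ z) := by
    intro z
    induction z using CliffordAlgebra.left_induction with
    | algebraMap r =>
      rw [Algebra.algebraMap_eq_smul_one, TensorProduct.tmul_smul]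
      exact smul r _ vac
    | add y z hy hz =>
      rw [TensorProduct.tmul_add]
      exact add _ _ hy hz
    | ι_mul z m hz =>
      induction m using Finsupp.induction_linear with
      | zero => simpa using hzero
      | add m m' h h' =>
        rw [map_add, add_mul, TensorProduct.tmul_add]
        exact add _ _ h h'
      | single g r =>
        have h := smul r _ (hcreate g _ hz)
        have e : CliffordAlgebra.ι (0 : QuadraticForm ℂ (GhostGen →₀ ℂ)) (Finsupp.single g r) * z =
            r • ghostCreate g z := by
          rw [← Finsupp.smul_single_one, map_smul, smul_mul_assoc]
          rfl
        have e' : (1 : MatterFock) ⊗ₜ[ℂ] (r • ghostCreate g z) =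
            r • onGhost (ghostCreate g) (1 ⊗ₜ z) := TensorProduct.tmul_smul _ _ _
        exact ((congrArg (fun y => (1 : MatterFock) ⊗ₜ[ℂ] y) e).trans e').symm ▸ h
  induction x using TensorProduct.induction_on with
  | zero => exact hzero
  | add x y hx hy => exact add _ _ hx hy
  | tmul f z =>
    induction f using MvPolynomial.induction_on with
    | C r =>
      rw [← mul_one (MvPolynomial.C r), ← MvPolynomial.smul_eq_C_mul, ← TensorProduct.smul_tmul']
      exact smul r _ (hghost z)
    | add f g hf hg =>
      rw [TensorProduct.add_tmul]
      exact add _ _ hf hg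
    | mul_X f i hf =>
      have := a i.2 (.negSucc i.1) (Int.negSucc_lt_zero _) _ hf
      rw [mul_comm]
      exact this

/-! ### The operators of the Fock space as sums over modes -/

theorem hasOpSum_Lm (α' : ℝ) (p : Momentum) {n : ℤ} (hn : n ≠ 0) :
    HasOpSum (fun k => (1 / 2 : ℂ) • ∑ μ, (eta μ : ℂ) • (aa α' p μ k * aa α' p μ (n - k)))
      (Lm α' p n) := by
  refine (virasoroTerm_finite α' p n).hasOpSum.onMatter.congr fun k => ?_
  have h : ∀ μ, alpha α' p μ (min k (n - k)) * alpha α' p μ (max k (n - k)) =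
      alpha α' p μ k * alpha α' p μ (n - k) := by
    intro μ
    rcases le_total k (n - k) with h | h
    · rw [min_eq_left h, max_eq_right h]
    -- the two oscillators commute because their mode numbers add up to `n ≠ 0`
    · rw [min_eq_right h, max_eq_left h, alpha_commutator, if_neg (by omega), zero_smul, add_zero]
  simp only [virasoroTerm, h, onMatter_smul, onMatter_sum, onMatter_mul, aa]

theorem hasOpSum_M :
    HasOpSum (fun k : ℤ => if 0 < k then (-2 * k : ℂ) • (cc (-k) * cc k) else 0) M := by
  refine (HasOpSum.smul (-2 : ℂ) mTerm_finite.hasOpSum).onGhost.int_of_nat fun k => ?_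
  rw [cc_of_ne (by omega), cc_of_ne (by omega), mTerm, smul_smul, onGhost_smul, onGhost_mul]
  push_cast
  rfl

theorem hasOpSum_ghostNumber : HasOpSum (fun k : ℤ => if 0 < k then
    (1 : ℂ) • (cc (-k) * bb k) + (-1 : ℂ) • (bb (-k) * cc k) else 0) ghostNumber := by
  refine ghostNumberTerm_finite.hasOpSum.onGhost.int_of_nat fun k => ?_
  rw [cc_of_ne (by omega), cc_of_ne (by omega), bb_of_ne (by omega), bb_of_ne (by omega),
    ← onGhost_mul, ← onGhost_mul, ← onGhost_smul, ← onGhost_smul, ← onGhost_add, one_smul]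
  exact congrArg onGhost ((congrArg _ (neg_one_smul ℂ _)).trans (sub_eq_add_neg _ _).symm)

theorem hasOpSum_matterLevel (α' : ℝ) (p : Momentum) :
    HasOpSum (fun k : ℤ => if 0 < k then ∑ μ, (eta μ : ℂ) • (aa α' p μ (-k) * aa α' p μ k) else 0)
      (onMatter (matterLevel α' p)) := by
  refine (matterLevelTerm_finite α' p).hasOpSum.onMatter.int_of_nat fun k => ?_
  simp only [matterLevelTerm, onMatter_smul, onMatter_sum, onMatter_mul, aa]

theorem hasOpSum_ghostLevel : HasOpSum (fun k : ℤ => if 0 < k then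
    (k : ℂ) • (cc (-k) * bb k) + (k : ℂ) • (bb (-k) * cc k) else 0)
      (onGhost (opSum ghostLevelTerm ghostLevelTerm_finite)) := by
  refine ghostLevelTerm_finite.hasOpSum.onGhost.int_of_nat fun k => ?_
  rw [cc_of_ne (by omega), cc_of_ne (by omega), bb_of_ne (by omega), bb_of_ne (by omega),
    ← onGhost_mul, ← onGhost_mul, ← onGhost_smul, ← onGhost_smul, ← onGhost_add, ← smul_add,
    ghostLevelTerm]
  push_cast
  rfl

theorem hasOpSum_cVirasoro (α' : ℝ) (p : Momentum) :
    HasOpSum (fun n => cc n * Lm α' p (-n))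
      (opSum (cVirasoroTerm α' p) (cVirasoroTerm_finite α' p)) := by
  refine (cVirasoroTerm_finite α' p).hasOpSum.extend (j := fun n => -n.1)
    (fun a b h => Subtype.ext (neg_injective h)) (fun n => ?_) fun k hk => ?_
  · rw [cc_of_ne (neg_ne_zero.mpr n.2), neg_neg]
    rfl
  · have h : k = 0 := by
      by_contra h
      exact hk ⟨⟨-k, neg_ne_zero.mpr h⟩, neg_neg k⟩
    rw [h, cc_zero, zero_mul]

/-- Normal ordering is immaterial in the ghost cubic, because the modes of each of its terms
anticommute. -/
theorem ccb_eq {m n : ℤ} (hm : m ≠ 0) (hn : n ≠ 0) :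
    ccb m n = cMode (-m) * cMode (-n) * bMode (m + n) := by
  unfold ccb
  split_ifs
  · rfl
  · refine LinearMap.ext fun x => ?_
    simp only [Module.End.mul_apply]
    rw [bc_anticomm _ _ (by omega), bc_anticomm _ _ (by omega), map_neg, neg_neg]

theorem hasOpSum_ghostCubic : HasOpSum (fun kl : ℤ × ℤ => (1 / 2 * (kl.1 - kl.2) : ℂ) •
    (cc kl.1 * cc kl.2 * bb (-(kl.1 + kl.2)))) (onGhost ghostCubic) := by
  refine ghostCubicTerm_finite.hasOpSum.onGhost.extend (j := fun mn => (-mn.1.1, -mn.1.2))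
    (fun a b h => ?_) (fun mn => ?_) fun kl hkl => ?_
  · obtain ⟨h1, h2⟩ := Prod.mk.inj h
    exact Subtype.ext (Prod.ext (neg_injective h1) (neg_injective h2))
  · obtain ⟨⟨m, n⟩, h, h'⟩ := mn
    have hm : m ≠ 0 := left_ne_zero_of_mul h
    have hn : n ≠ 0 := right_ne_zero_of_mul h
    simp only at h'
    simp only [ghostCubicTerm, ccb_eq hm hn, onGhost_smul, onGhost_mul]
    rw [cc_of_ne (neg_ne_zero.mpr hm), cc_of_ne (neg_ne_zero.mpr hn), bb_of_ne (by omega),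
      show -(-m + -n) = m + n by ring]
    congr 1
    push_cast
    ring
  · obtain ⟨k, l⟩ := kl
    by_cases hk : k = 0
    · simp [hk]
    by_cases hl : l = 0
    · simp [hl]
    have h : k + l = 0 := by
      by_contra h
      refine hkl ⟨⟨(-k, -l), mul_ne_zero (neg_ne_zero.mpr hk) (neg_ne_zero.mpr hl), ?_⟩, ?_⟩
      · simp only
        omega
      · simp
    simp [h]

/-- The Fock space of momentum `p` represents the oscillators, with `r = α' p² - 1`. -/
def fockRep (α' : ℝ) (hα : 0 < α') (p : Momentum) : OscillatorRep Fock where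
  cc := cc
  bb := bb
  aa := aa α' p
  c0 := c0
  b0 := b0
  L := Lm α' p
  M := M
  gh := ghostNumber
  lev := level α' p
  Qt := Qt α' p
  κ μ := ((Real.sqrt (2 * α') * p μ : ℝ) : ℂ)
  r := ((α' * momentumSq p - 1 : ℝ) : ℂ)
  vac := vac
  cc_zero := cc_zero
  bb_zero := bb_zero
  cc_cc' := cc_cc
  bb_bb' := bb_bb
  bb_cc := bb_cc
  c0_cc' := c0_cc
  c0_bb' := c0_bb
  b0_cc' := b0_cc
  b0_bb' := b0_bb
  b0_c0 := b0_c0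
  c0_c0 := c0_c0
  aa_aa := aa_aa α' p
  aa_zero := aa_zero α' p
  sum_κ := sum_eta_zeroMode hα.le p
  aa_cc _ _ _ := commute_onMatter_cc _ _
  aa_bb _ _ _ := commute_onMatter_bb _ _
  aa_c0 _ _ := onMatter_onGhost _ _
  aa_b0 _ _ := onMatter_onGhost _ _
  aa_vac μ _ hm := aa_vac α' p μ hm
  cc_vac _ hm := cc_vac hm
  bb_vac _ hm := bb_vac hm
  induction _ := fock_induction α' p
  hasOpSum_L _ hn := hasOpSum_Lm α' p hn
  hasOpSum_M := hasOpSum_M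
  hasOpSum_gh := hasOpSum_ghostNumber
  levMatter := onMatter (matterLevel α' p)
  levGhost := onGhost (opSum ghostLevelTerm ghostLevelTerm_finite)
  lev_eq := rfl
  hasOpSum_levMatter := hasOpSum_matterLevel α' p
  hasOpSum_levGhost := hasOpSum_ghostLevel
  QMatter := opSum (cVirasoroTerm α' p) (cVirasoroTerm_finite α' p)
  QGhost := onGhost ghostCubic
  Qt_eq := rfl
  hasOpSum_QMatter := hasOpSum_cVirasoro α' p
  hasOpSum_QGhost := hasOpSum_ghostCubic

/-! ### Coefficients in a vector space -/

section Coefficients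

variable {E : Type*} [AddCommGroup E] [Module ℂ E] (V : Type*) [AddCommGroup V] [Module ℂ V]

theorem rTensor_nilpotent {T : Module.End ℂ E} (hT : ∀ x, ∃ k, (T ^ k) x = 0) (x : E ⊗[ℂ] V) :
    ∃ k, (T.rTensor V ^ k : Module.End ℂ (E ⊗[ℂ] V)) x = 0 := by
  induction x using TensorProduct.induction_on with
  | zero => exact ⟨0, map_zero _⟩
  | add x y hx hy =>
    obtain ⟨j, hj⟩ := hx
    obtain ⟨k, hk⟩ := hy
    exact ⟨max j k, by
      rw [map_add, OscillatorRep.pow_eq_zero_mono (le_max_left _ _) hj,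
        OscillatorRep.pow_eq_zero_mono (le_max_right _ _) hk, add_zero]⟩
  | tmul x v =>
    obtain ⟨k, hk⟩ := hT x
    exact ⟨k, by rw [LinearMap.rTensor_pow, LinearMap.rTensor_tmul, hk, TensorProduct.zero_tmul]⟩

/-- The operators of an oscillator representation, acting on states with coefficients in `V`. -/
def OscillatorRep.gaugeData (F : OscillatorRep E) : GaugeData (E ⊗[ℂ] V) :=
  let ρ := Module.End.rTensorAlgHom ℂ E V
  { b0 := ρ F.b0
    c0 := ρ F.c0
    M := ρ F.M
    Qt := ρ F.Qt
    gh := ρ F.gh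
    lev := ρ F.lev
    r := F.r
    b0_c0 := by rw [← map_mul, ← map_mul, ← map_add, F.b0_c0, map_one]
    c0_c0 := by rw [← map_mul, F.c0_c0, map_zero]
    M_b0 := F.M_b0.map ρ
    M_c0 := F.M_c0.map ρ
    Qt_b0 := by rw [← map_mul, ← map_mul, ← map_add, F.Qt_b0, neg_add_cancel, map_zero]
    Qt_c0 := by rw [← map_mul, ← map_mul, ← map_add, F.Qt_c0, neg_add_cancel, map_zero]
    gh_b0 := F.gh_b0.map ρ
    gh_M := by rw [← map_mul, F.gh_M.eq, map_add, map_mul, map_smul]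
    gh_Qt := by rw [← map_mul, F.gh_Qt.eq, one_smul, map_add, map_mul]
    lev_c0 := F.lev_c0.map ρ
    lev_gh := F.lev_gh.map ρ
    lev_M := F.lev_M.map ρ
    lev_Qt := F.lev_Qt.commute.map ρ
    Qt_Qt := by
      have h := congrArg ρ F.anomaly_eq_zero
      simpa [OscillatorRep.anomaly, OscillatorRep.L0] using h
    bijOn := by
      have h1 := congrArg ρ F.M_lower
      have h2 := congrArg ρ F.gh_M
      have h3 := congrArg ρ F.gh_lower
      rw [map_sub, map_mul, map_mul] at h1
      rw [map_sub, map_mul, map_mul, map_smul] at h2 h3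
      exact bijOn_pow_weight h1 h2 h3 (rTensor_nilpotent V F.M_nilpotent)
        (rTensor_nilpotent V F.lower_nilpotent) }

end Coefficients

/-! ### Landau gauges of string fields -/

section LandauGauge

variable {α' : ℝ} (V : Type*) [AddCommGroup V] [Module ℂ V]

/-- The gauge-fixing data of the open string at momentum `p`. -/
abbrev stringData (hα : 0 < α') (p : Momentum) : GaugeData (Fock ⊗[ℂ] V) :=
  (fockRep α' hα p).gaugeData V

variable {V}

theorem coeff_mul (S T : Module.End ℂ Fock) : coeff V (S * T) = coeff V S * coeff V T :=
  LinearMap.rTensor_mul _ _ _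

theorem coeff_pow (T : Module.End ℂ Fock) (n : ℕ) : coeff V (T ^ n) = coeff V T ^ n :=
  (LinearMap.rTensor_pow _ _).symm

theorem mem_stateSpace (hα : 0 < α') {p : Momentum} {N : ℕ} {m : ℤ} {x : Fock ⊗[ℂ] V} :
    x ∈ stateSpace α' V p N m ↔ x ∈ (stringData V hα p).states N m :=
  (GaugeData.mem_states (D := stringData V hα p)).symm

theorem mem_stringField (hα : 0 < α') {n : ℤ} {Φ : Field α' V} : Φ ∈ stringField α' V n ↔
    IsStringField (fun s : OffShell α' => stringData V hα s.p) (fun s => (s.N : ℂ)) n Φ := by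
  simp only [stringField, Submodule.mem_pi, Set.mem_univ, true_implies, Submodule.mem_sup,
    Submodule.mem_map, IsStringField]
  refine forall_congr' fun s => ⟨?_, ?_⟩
  · rintro ⟨φ, hφ, _, ⟨ω, hω, rfl⟩, h⟩
    exact ⟨φ, (mem_stateSpace hα).mp hφ, ω, (mem_stateSpace hα).mp hω, h⟩
  · rintro ⟨φ, hφ, ω, hω, h⟩
    exact ⟨φ, (mem_stateSpace hα).mpr hφ, _, ⟨ω, (mem_stateSpace hα).mpr hω, rfl⟩, h⟩

theorem gaugeVar_eq (hα : 0 < α') (Λ : Field α' V) :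
    gaugeVar Λ = fun s : OffShell α' => (stringData V hα s.p).Q (Λ s) := by
  funext s
  have h : coeff V (Q α' s.p) = (stringData V hα s.p).Q := by
    have h1 : coeff V (L0 α' s.p) = (stringData V hα s.p).r • 1 + (stringData V hα s.p).lev := by
      have := map_add (Module.End.rTensorAlgHom ℂ Fock V)
        (((α' * momentumSq s.p - 1 : ℝ) : ℂ) • 1) (level α' s.p)
      rw [map_smul, map_one] at this
      exact this
    have h2 : coeff V (Q α' s.p) =
        coeff V (Qt α' s.p) + coeff V c0 * coeff V (L0 α' s.p) + coeff V b0 * coeff V M := by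
      rw [← coeff_mul, ← coeff_mul]
      exact (LinearMap.rTensor_add _ _ _).trans (congrArg (· + _) (LinearMap.rTensor_add _ _ _))
    rw [h2, h1]
    rfl
  exact LinearMap.congr_fun h _

theorem stringData_ne_zero (hα : 0 < α') (s : OffShell α') :
    (stringData V hα s.p).r + (s.N : ℂ) ≠ 0 := by
  have h : (((α' * momentumSq s.p - 1 : ℝ) : ℂ) + (s.N : ℂ)) =
      ((α' * momentumSq s.p + s.N - 1 : ℝ) : ℂ) := by
    push_cast
    ring
  exact h ▸ Complex.ofReal_ne_zero.mpr s.L0_ne_zero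

theorem bijOn_stateSpace (hα : 0 < α') (p : Momentum) (N n : ℕ) : Set.BijOn (coeff V (M ^ n))
    (stateSpace α' V p N (-(n : ℤ))) (stateSpace α' V p N n) := by
  have e : ∀ m, (stateSpace α' V p N m : Set (Fock ⊗[ℂ] V)) = (stringData V hα p).states N m :=
    fun m => Set.ext fun _ => mem_stateSpace hα
  rw [coeff_pow, e, e]
  exact (stringData V hα p).bijOn_states N n

/-- `W_n` inverts `M^n`. -/
theorem W_spec (hα : 0 < α') {p : Momentum} {N n : ℕ} {x : Fock ⊗[ℂ] V}
    (hx : x ∈ stateSpace α' V p N n) :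
    W α' V p N n x ∈ stateSpace α' V p N (-(n : ℤ)) ∧ coeff V (M ^ n) (W α' V p N n x) = x := by
  have h := (bijOn_stateSpace hα (V := V) p N n).surjOn hx
  exact ⟨Function.invFunOn_mem h, Function.invFunOn_eq h⟩

/-- A criterion for a condition imposed at every momentum and level to fix the gauge exactly. -/
theorem exactlyFixes_of_forall (hα : 0 < α') (n : ℤ) (P : OffShell α' → Fock ⊗[ℂ] V → Prop)
    (hex : ∀ s, ∀ φ ∈ (stringData V hα s.p).states s.N (n - 1),
      ∀ ω ∈ (stringData V hα s.p).states s.N (n - 2),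
      ∃ ξ ∈ (stringData V hα s.p).states s.N (n - 2),
        P s ((φ + (stringData V hα s.p).Qt ξ) +
          (stringData V hα s.p).c0 (ω + ((stringData V hα s.p).r + s.N) • ξ)))
    (hun : ∀ s, ∀ φ ∈ (stringData V hα s.p).states s.N (n - 1),
      ∀ ω ∈ (stringData V hα s.p).states s.N (n - 2),
      ∀ ξ ∈ (stringData V hα s.p).states s.N (n - 2),
        P s (φ + (stringData V hα s.p).c0 ω) →
        P s ((φ + (stringData V hα s.p).Qt ξ) +
          (stringData V hα s.p).c0 (ω + ((stringData V hα s.p).r + s.N) • ξ)) → ξ = 0) :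
    ExactlyFixes α' V n {Φ | Φ ∈ stringField α' V n ∧ ∀ s, P s (Φ s)} := by
  obtain ⟨h1, h2⟩ := exactly_fixes (stringData_ne_zero hα (V := V)) n P hex hun
  constructor
  · intro Φ hΦ
    obtain ⟨Λ, hΛ, h, h'⟩ := h1 Φ ((mem_stringField hα).mp hΦ)
    refine ⟨Λ, (mem_stringField hα).mpr hΛ, ?_⟩
    rw [gaugeVar_eq hα]
    exact ⟨(mem_stringField hα).mpr h, h'⟩
  · rintro Φ ⟨hΦ, hP⟩ Λ hΛ ⟨-, hP'⟩
    rw [gaugeVar_eq hα] at hP' ⊢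
    exact h2 Φ ((mem_stringField hα).mp hΦ) hP Λ ((mem_stringField hα).mp hΛ) hP'

/-! #### Ghost number at most one -/

theorem landau_low_iff (hα : 0 < α') {p : Momentum} {N : ℕ} {m : ℤ} {φ : Fock ⊗[ℂ] V}
    (hφ : φ ∈ (stringData V hα p).states N m) (ω : Fock ⊗[ℂ] V) (k : ℕ) :
    coeff V (b0 * c0 * Qt α' p * M ^ k) (φ + (stringData V hα p).c0 ω) = 0 ↔
      (stringData V hα p).Qt (((stringData V hα p).M ^ k) φ) = 0 := by
  rw [← GaugeData.b0_c0_Qt_M_pow hφ ω k, coeff_mul, coeff_mul, coeff_mul, coeff_pow]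
  rfl

theorem exactlyFixes_low (hα : 0 < α') (k : ℕ) : ExactlyFixes α' V (1 - k)
    {Φ | Φ ∈ stringField α' V (1 - k) ∧
      ∀ s : OffShell α', coeff V (b0 * c0 * Qt α' s.p * M ^ k) (Φ s) = 0} := by
  refine exactlyFixes_of_forall hα _ (fun s x => coeff V (b0 * c0 * Qt α' s.p * M ^ k) x = 0) ?_ ?_
  all_goals
    rw [show (1 - k : ℤ) - 1 = -(k : ℤ) by ring, show (1 - k : ℤ) - 2 = -((k + 1 : ℕ) : ℤ) by
      push_cast
      ring]
  · intro s φ hφ ω hω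
    obtain ⟨ξ, hξ, h⟩ := GaugeData.exists_landau_low (stringData_ne_zero hα s) hφ
    refine ⟨ξ, hξ, (landau_low_iff hα (Submodule.add_mem _ hφ ?_) _ k).mpr h⟩
    have := GaugeData.Qt_mem hξ
    rwa [show -((k + 1 : ℕ) : ℤ) + 1 = -(k : ℤ) by push_cast; ring] at this
  · intro s φ hφ ω hω ξ hξ h h'
    have hQ := GaugeData.Qt_mem hξ
    rw [show -((k + 1 : ℕ) : ℤ) + 1 = -(k : ℤ) by push_cast; ring] at hQ
    rw [landau_low_iff hα hφ] at h
    rw [landau_low_iff hα (Submodule.add_mem _ hφ hQ), map_add, map_add, h, zero_add] at h'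
    exact GaugeData.eq_zero_of_landau_low (stringData_ne_zero hα s) hξ h'

theorem forall_landau_low_iff (hα : 0 < α') {n : ℤ} {Φ : Field α' V}
    (hΦ : Φ ∈ stringField α' V n) (k : ℕ) :
    (∀ s : OffShell α', coeff V (b0 * c0 * Qt α' s.p * M ^ k) (Φ s) = 0) ↔
      ∀ s : OffShell α', coeff V (Qt α' s.p * M ^ k) (phi (Φ s)) = 0 := by
  refine forall_congr' fun s => ?_
  obtain ⟨φ, hφ, ω, hω, h⟩ := (mem_stringField hα).mp hΦ s
  have h1 : phi (Φ s) = φ := by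
    rw [← h, phi, coeff_mul]
    exact GaugeData.phi_apply hφ
  rw [h1, ← h, landau_low_iff hα hφ, coeff_mul, coeff_pow]
  rfl

/-! #### Ghost number at least two -/

/-- `Q̃ W` is injective on states of positive ghost number. -/
theorem landau_high_iff (hα : 0 < α') (s : OffShell α') (k : ℕ) {x : Fock ⊗[ℂ] V}
    (hx : x ∈ stateSpace α' V s.p s.N ((k + 1 : ℕ) : ℤ)) :
    coeff V (Qt α' s.p) (W α' V s.p s.N (k + 1) x) = 0 ↔ x = 0 := by
  obtain ⟨h1, h2⟩ := W_spec hα hx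
  constructor
  · intro h
    rw [← h2, GaugeData.eq_zero_of_Qt_W (stringData_ne_zero hα s) ((mem_stateSpace hα).mp h1) h,
      map_zero]
  · rintro rfl
    have : W α' V s.p s.N (k + 1) 0 = 0 :=
      (bijOn_stateSpace hα s.p s.N (k + 1)).injOn h1 (Submodule.zero_mem _) (by rw [h2, map_zero])
    rw [this, map_zero]

theorem forall_landau_high_iff (hα : 0 < α') (k : ℕ) {Φ : Field α' V}
    (hΦ : Φ ∈ stringField α' V (k + 2)) (s : OffShell α') : coeff V (Qt α' s.p) (W α' V s.p s.N (k + 1) (phi (Φ s))) = 0 ↔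
      phi (Φ s) = 0 := by
  refine landau_high_iff hα s k ?_
  obtain ⟨φ, hφ, ω, hω, h⟩ := (mem_stringField hα).mp hΦ s
  rw [show (k + 2 : ℤ) - 1 = ((k + 1 : ℕ) : ℤ) by push_cast; ring] at hφ
  rw [← h, phi, coeff_mul]
  exact (mem_stateSpace hα).mpr ((GaugeData.phi_apply hφ).symm ▸ hφ)

theorem exactlyFixes_high (hα : 0 < α') (k : ℕ) : ExactlyFixes α' V (k + 2)
    {Φ | Φ ∈ stringField α' V (k + 2) ∧ ∀ s : OffShell α', phi (Φ s) = 0 ∧ omega (Φ s) ∈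
      (stateSpace α' V s.p s.N (-((k + 1 : ℕ) : ℤ))).map (coeff V (Qt α' s.p * M ^ k))} := by
  have hP : ∀ (s : OffShell α') {m m' : ℤ} {φ ω : Fock ⊗[ℂ] V},
      φ ∈ (stringData V hα s.p).states s.N m → ω ∈ (stringData V hα s.p).states s.N m' →
      ((phi (φ + (stringData V hα s.p).c0 ω) = 0 ∧ omega (φ + (stringData V hα s.p).c0 ω) ∈
        (stateSpace α' V s.p s.N (-((k + 1 : ℕ) : ℤ))).map (coeff V (Qt α' s.p * M ^ k))) ↔
      φ = 0 ∧ ∃ f ∈ (stringData V hα s.p).states s.N (-((k + 1 : ℕ) : ℤ)),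
        (stringData V hα s.p).Qt (((stringData V hα s.p).M ^ k) f) = ω) := by
    intro s m m' φ ω hφ hω
    have h1 : phi (φ + (stringData V hα s.p).c0 ω) = φ := by
      rw [phi, coeff_mul]
      exact GaugeData.phi_apply hφ
    have h2 : omega (φ + (stringData V hα s.p).c0 ω) = ω := GaugeData.omega_apply hφ hω
    rw [h1, h2, coeff_mul, coeff_pow]
    exact and_congr_right fun _ => ⟨fun ⟨f, hf, h⟩ => ⟨f, (mem_stateSpace hα).mp hf, h⟩,
      fun ⟨f, hf, h⟩ => ⟨f, (mem_stateSpace hα).mpr hf, h⟩⟩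
  refine exactlyFixes_of_forall hα _ (fun s x => phi x = 0 ∧ omega x ∈
      (stateSpace α' V s.p s.N (-((k + 1 : ℕ) : ℤ))).map (coeff V (Qt α' s.p * M ^ k))) ?_ ?_
  all_goals
    rw [show (k + 2 : ℤ) - 1 = ((k + 1 : ℕ) : ℤ) by push_cast; ring,
      show (k + 2 : ℤ) - 2 = (k : ℤ) by ring]
  · intro s φ hφ ω hω
    obtain ⟨ξ, hξ, h, h'⟩ := GaugeData.exists_landau_high (stringData_ne_zero hα s) hφ hω
    exact ⟨ξ, hξ, (hP s (Submodule.add_mem _ hφ (by exact_mod_cast GaugeData.Qt_mem hξ))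
      (Submodule.add_mem _ hω (Submodule.smul_mem _ _ hξ))).mpr ⟨h, h'⟩⟩
  · intro s φ hφ ω hω ξ hξ h h'
    rw [hP s hφ hω] at h
    rw [hP s (Submodule.add_mem _ hφ (by exact_mod_cast GaugeData.Qt_mem hξ))
      (Submodule.add_mem _ hω (Submodule.smul_mem _ _ hξ))] at h'
    obtain ⟨h1, f, hf, h2⟩ := h
    obtain ⟨h1', f', hf', h2'⟩ := h'
    rw [h1, zero_add] at h1'
    exact GaugeData.eq_zero_of_landau_high (stringData_ne_zero hα s) hf hf' h2 h2' h1'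

end LandauGauge

end OpenString
end

open OpenString in
theorem mainTheorem3 (α' : ℝ) (hα : 0 < α') (V : Type*) [AddCommGroup V] [Module ℂ V] :
    -- the operators `W_n` of the gauge condition are well defined
    (∀ (p : Momentum) (N n : ℕ), Set.BijOn (coeff V (M ^ n))
      (stateSpace α' V p N (-(n : ℤ))) (stateSpace α' V p N n)) ∧
    -- the gauge `b_0 c_0 Q̃ Φ_1 = 0` for the string field of ghost number one
    ExactlyFixes α' V 1
      {Φ | Φ ∈ stringField α' V 1 ∧
        ∀ s : OffShell α', coeff V (b0 * c0 * Qt α' s.p) (Φ s) = 0} ∧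
    (∀ Φ ∈ stringField α' V 1,
      (∀ s : OffShell α', coeff V (b0 * c0 * Qt α' s.p) (Φ s) = 0) ↔
        ∀ s : OffShell α', coeff V (Qt α' s.p) (phi (Φ s)) = 0) ∧
    -- the gauge for all ghost numbers
    (∀ n : ℤ, ExactlyFixes α' V n (landauGauge α' V n)) ∧
    -- its form in terms of `φ` and `ω`
    (∀ n : ℤ, n ≤ 1 → ∀ Φ ∈ stringField α' V n,
      (Φ ∈ landauGauge α' V n ↔
        ∀ s : OffShell α', coeff V (Qt α' s.p * M ^ (1 - n).toNat) (phi (Φ s)) = 0)) ∧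
    (∀ n : ℤ, 2 ≤ n → ∀ Φ ∈ stringField α' V n,
      (Φ ∈ landauGauge α' V n ↔
        ∀ s : OffShell α', phi (Φ s) = 0 ∧ omega (Φ s) ∈
          (stateSpace α' V s.p s.N (1 - n)).map (coeff V (Qt α' s.p * M ^ (n - 2).toNat)))) := by
  have low : ∀ n : ℤ, n ≤ 1 → landauGauge α' V n = {Φ | Φ ∈ stringField α' V n ∧
      ∀ s : OffShell α', coeff V (b0 * c0 * Qt α' s.p * M ^ (1 - n).toNat) (Φ s) = 0} := by
    intro n hn
    simp only [landauGauge, if_pos hn]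
  have high : ∀ n : ℤ, 2 ≤ n → landauGauge α' V n = {Φ | Φ ∈ stringField α' V n ∧
      ∀ s : OffShell α', phi (Φ s) = 0 ∧ omega (Φ s) ∈
        (stateSpace α' V s.p s.N (1 - n)).map (coeff V (Qt α' s.p * M ^ (n - 2).toNat))} := by
    intro n hn
    obtain ⟨k, rfl⟩ : ∃ k : ℕ, n = k + 2 := ⟨(n - 2).toNat, by omega⟩
    simp only [landauGauge, if_neg (show ¬(k + 2 : ℤ) ≤ 1 by omega),
      show ((k : ℤ) + 2 - 1).toNat = k + 1 by omega]
    ext Φ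
    exact and_congr_right fun hΦ => forall_congr' fun s =>
      and_congr_left fun _ => forall_landau_high_iff hα k hΦ s
  refine ⟨fun p N n => bijOn_stateSpace hα p N n, ?_, fun Φ hΦ => ?_, fun n => ?_,
    fun n hn Φ hΦ => ?_, fun n hn Φ hΦ => ?_⟩
  · simpa using exactlyFixes_low hα (V := V) 0
  · simpa using forall_landau_low_iff hα hΦ 0
  · rcases le_or_gt n 1 with hn | hn
    · rw [low n hn]
      obtain ⟨k, rfl⟩ : ∃ k : ℕ, n = 1 - k := ⟨(1 - n).toNat, by omega⟩
      rw [show (1 - (1 - k : ℤ)).toNat = k by omega]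
      exact exactlyFixes_low hα k
    · rw [high n hn]
      obtain ⟨k, rfl⟩ : ∃ k : ℕ, n = k + 2 := ⟨(n - 2).toNat, by omega⟩
      rw [show ((k : ℤ) + 2 - 2).toNat = k by omega,
        show (1 - (k + 2) : ℤ) = -((k + 1 : ℕ) : ℤ) by push_cast; ring]
      exact exactlyFixes_high hα k
  · rw [low n hn]
    exact (and_iff_right hΦ).trans (forall_landau_low_iff hα hΦ _)
  · rw [high n hn]
    exact and_iff_right hΦ
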